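/- Let $N\ge 0$ be an integer, $\kappa\in\mathbb R$, and let $\alpha(z)=\alpha_2z^2+\alpha_1z+\alpha_0$ and $\beta(z)=\beta_1z+\beta_0$ be polynomials with complex coefficients. Put $$\tilde H_N=\sum_{j=1}^N\alpha(z_j)\frac{\partial^2}{\partial z_j^2}+\sum_{j=1}^N\beta(z_j)\frac{\partial}{\partial z_j}+2\kappa\sum_{j<k}\frac{1}{z_j-z_k}\Bigl(\alpha(z_j)\frac{\partial}{\partial z_j}-\alpha(z_k)\frac{\partial}{\partial z_k}\Bigr).$$ This is $-\Psi_0^{-1}(H_N-E_0)\Psi_0$, written in the variables $z_j=z(x_j)$, for the Schrödinger operator $$H_N=-\sum_{j}\frac{\partial^2}{\partial x_j^2}+\sum_{j}v(z(x_j))+\kappa(\kappa-1)\sum_{j<k}\frac{\alpha(z(x_j))+\alpha(z(x_k))}{(z(x_j)-z(x_k))^2},\qquad v=\frac{(2\beta-\alpha')(2\beta-3\alpha')}{16\alpha}-\frac{\alpha''}{4}+\frac{\beta'}{2},$$ where $z'(x)^2=\alpha(z(x))\neq0$, $\Psi_0(x)=\prod_j e^{-w(z(x_j))}\prod_{j<k}(z(x_k)-z(x_j))^\kappa$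 with $w'=(\alpha'-2\beta)/(4\alpha)$ (on any open set of configurations on which the $z(x_j)$ are distinct and branches of the multivalued functions are chosen), and $$E_0=-\tfrac12\kappa\beta_1N(N-1)-\tfrac13\kappa^2\alpha_2N(N-1)(N-2).$$ For $n\in\mathbb Z^N$ let $f_n$ be the coefficient of $y^{-n}$ in the expansion of $\prod_{j<k}(1-y_j/y_k)^\kappa\big/\prod_{j,k}(1-x_j/y_k)^\kappa$ for $|y_N|>\cdots>|y_1|>\max_j|x_j|$. Write $|n|=\sum_jn_j$; $m\preceq n$ if $m_j+\cdots+m_N\le n_j+\cdots+n_N$ for all $j$, and $m\prec n$ if also $m\ne n$; $n_j^+=n_j+\kappa(N+1-j)$; $e_j$ for the standard basis of $\mathbb Z^N$; and $\delta_n(m)=1$ if $m=n$ and $0$ otherwise. Let $$\tilde E_n=-\sum_{j=1}^N\bigl(\alpha_2n_j(n_j-1+2\kappa(N-j))+\beta_1n_j\bigr),\qquad b_n(m)=\tilde E_n-\tilde E_m,\qquad E^{p\nu}_{jk}=(1-\nu)e_j+(1-p+\nu)e_k,$$ $$g_{jk}(p,\nu;m)=(1-\delta_{jk})\kappa(\kappa-1)\alpha_p(2\nu-p)-\delta_{jk}\delta_{\nu1}m_j^+\bigl(\delta_{p0}\alpha_0(m_j^++1)+\delta_{p1}(\alpha_1(m_j^+-\kappa)+\beta_0)\bigr).$$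 Let $d=\deg\alpha$ (read as $0$ if $\alpha=0$), except that $d=1$ if $\alpha$ is constant and $\beta_0\ne0$, and put $$P_n=f_n+\sum_{m}u_n(m)f_m,$$ where the sum is over the $m\in\mathbb Z^N$ with $m\prec n$ and $|m|\le|n|+d-2$, and $$u_n(m)=\sum_{l=1}^\infty\ \sum_{j_1\le k_1}\cdots\sum_{j_l\le k_l}\ \sum_{p_1,\dots,p_l=0}^2\ \sum_{\nu_1,\dots,\nu_l=1}^\infty\delta_n\Bigl(m+\sum_{t=1}^lE^{p_t\nu_t}_{j_tk_t}\Bigr)\prod_{r=1}^l\frac{g_{j_rk_r}\bigl(p_r,\nu_r;n-\sum_{q=r}^lE^{p_q\nu_q}_{j_qk_q}\bigr)}{b_n\bigl(n-\sum_{q=r}^lE^{p_q\nu_q}_{j_qk_q}\bigr)}$$ (terms with zero numerator are read as zero). 1. Let $n\in\mathbb Z^N$ be such that $b_n(m)\ne0$ for all $m\in\mathbb Z^N$ with $m\prec n$ and $|m|\le|n|+d-2$. Then $P_n$ is a well-defined symmetric polynomial: each series $u_n(m)$ has only finitely many nonzero terms, no denominator of a term with nonzero numerator vanishes, and only finitely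 many summands $u_n(m)f_m$ are nonzero. Moreover $\tilde H_NP_n=-\tilde E_nP_n$, and $\Psi(x)=\Psi_0(x)P_n(z(x_1),\dots,z(x_N))$ satisfies $H_N\Psi=(E_0+\tilde E_n)\Psi$. If $\kappa>0$ and $n$ is a partition, i.e. $n_1\ge\cdots\ge n_N\ge0$, then $P_n\ne0$. 2. If $\kappa>0$ and the hypothesis of 1 holds for every partition $n=\lambda=(\lambda_1\ge\cdots\ge\lambda_N\ge0)$, then the $P_\lambda$ form a linear basis of the space of symmetric polynomials in $N$ variables. -/

import Mathlib

open Polynomial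

noncomputable section

namespace CalogeroSutherland

variable {N : ℕ}

/-! ### Integer vectors -/

/-- `|n| = n_1 + ⋯ + n_N`. -/
def size (n : Fin N → ℤ) : ℤ := ∑ j, n j

/-- The partial order `m ⪯ n`: `m_j + ⋯ + m_N ≤ n_j + ⋯ + n_N` for all `j`. -/
def Below (m n : Fin N → ℤ) : Prop :=
  ∀ j : Fin N, ∑ i ∈ Finset.Ici j, m i ≤ ∑ i ∈ Finset.Ici j, n i

/-- The strict order `m ≺ n`. -/
def StrictlyBelow (m n : Fin N → ℤ) : Prop := Below m n ∧ m ≠ n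

/-- Partitions of length at most `N`, as vectors `n_1 ≥ ⋯ ≥ n_N ≥ 0`. -/
def IsPartition (n : Fin N → ℤ) : Prop := Antitone n ∧ ∀ j, 0 ≤ n j

/-! ### The symmetric polynomials `f_n`

They are the coefficients of `y^{-n}` in the expansion of
`∏_{j<k} (1 - y_j/y_k)^κ / ∏_{j,k} (1 - x_j/y_k)^κ` in the region
`|y_N| > ⋯ > |y_1| > max_j |x_j|`, where every factor is expanded in its binomial series. -/

/-- A choice of one term in the binomial series of every factor: the exponents `p_{jk}` of
`y_j/y_k` for `j < k`, and the exponents `q_{jk}` of `x_j/y_k` for all `j, k`. -/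
abbrev GenIndex (N : ℕ) : Type :=
  ({jk : Fin N × Fin N // jk.1 < jk.2} → ℕ) × (Fin N × Fin N → ℕ)

/-- The vector `n` such that the chosen terms multiply to a multiple of `y^{-n}`. -/
def genWeight (e : GenIndex N) (i : Fin N) : ℤ :=
  ∑ jk, (e.1 jk : ℤ) * ((if jk.1.2 = i then 1 else 0) - (if jk.1.1 = i then 1 else 0)) +
    ∑ jk, (e.2 jk : ℤ) * (if jk.2 = i then 1 else 0)

/-- The product of the chosen terms, without the factor `y^{-n}`. -/
def genTerm (κ : ℝ) (e : GenIndex N) : MvPolynomial (Fin N) ℂ :=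
  MvPolynomial.C (((∏ jk, (-1) ^ e.1 jk * Ring.choose κ (e.1 jk)) *
      ∏ jk, (-1) ^ e.2 jk * Ring.choose (-κ) (e.2 jk) : ℝ) : ℂ) *
    ∏ jk, MvPolynomial.X jk.1 ^ e.2 jk

/-- Only finitely many choices contribute to a given power `y^{-n}`, so that the sum that defines
`f_n` is finite. -/
theorem finite_genWeight_eq (n : Fin N → ℤ) : {e : GenIndex N | genWeight e = n}.Finite := by
  set B : ℤ := ∑ i : Fin N, ((i : ℤ) + 1) * n i with hB
  have key : ∀ e : GenIndex N, genWeight e = n →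
      ∑ jk, (e.1 jk : ℤ) * ((jk.1.2 : ℤ) - jk.1.1) + ∑ jk, (e.2 jk : ℤ) * ((jk.2 : ℤ) + 1) = B := by
    intro e he
    rw [hB, ← he]
    simp only [genWeight, mul_add, Finset.sum_add_distrib, Finset.mul_sum]
    congr 1
    · rw [Finset.sum_comm]
      refine Finset.sum_congr rfl fun jk _ => ?_
      have h : ∀ i : Fin N, ((i : ℤ) + 1) * ((e.1 jk : ℤ) *
          ((if jk.1.2 = i then 1 else 0) - (if jk.1.1 = i then 1 else 0))) =
          (if jk.1.2 = i then (e.1 jk : ℤ) * ((i : ℤ) + 1) else 0) -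
          (if jk.1.1 = i then (e.1 jk : ℤ) * ((i : ℤ) + 1) else 0) := by
        intro i
        split_ifs <;> ring
      rw [Finset.sum_congr rfl fun i _ => h i, Finset.sum_sub_distrib]
      simp
      ring
    · rw [← Finset.sum_add_distrib, Finset.sum_comm]
      refine Finset.sum_congr rfl fun jk _ => ?_
      have h : ∀ i : Fin N, ((i : ℤ) + 1) * ((e.2 jk : ℤ) * (if jk.2 = i then 1 else 0)) =
          (if jk.2 = i then (e.2 jk : ℤ) * ((i : ℤ) + 1) else 0) := by
        intro i
        split_ifs <;> ring
      rw [Finset.sum_congr rfl fun i _ => h i]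
      simp
      ring
  have hp : ∀ (e : GenIndex N) jk, 0 ≤ (e.1 jk : ℤ) * ((jk.1.2 : ℤ) - jk.1.1) := by
    intro e jk
    have : (jk.1.1 : ℕ) < jk.1.2 := jk.2
    exact mul_nonneg (by positivity) (by omega)
  have hq : ∀ (e : GenIndex N) jk, 0 ≤ (e.2 jk : ℤ) * ((jk.2 : ℤ) + 1) := by
    intro e jk
    positivity
  refine Set.Finite.subset (Set.Finite.prod
    (Set.Finite.pi' (t := fun _ => Set.Iic B.toNat) fun _ => Set.finite_Iic _)
    (Set.Finite.pi' (t := fun _ => Set.Iic B.toNat) fun _ => Set.finite_Iic _)) ?_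
  intro e he
  have hk := key e he
  have h1 := Finset.sum_nonneg fun jk (_ : jk ∈ Finset.univ) => hp e jk
  have h2 := Finset.sum_nonneg fun jk (_ : jk ∈ Finset.univ) => hq e jk
  refine ⟨fun jk => ?_, fun jk => ?_⟩
  · have h3 := Finset.single_le_sum (fun jk _ => hp e jk) (Finset.mem_univ jk)
    have h4 : (1 : ℤ) ≤ (jk.1.2 : ℤ) - jk.1.1 := by
      have : (jk.1.1 : ℕ) < jk.1.2 := jk.2
      omega
    have h5 : (e.1 jk : ℤ) ≤ (e.1 jk : ℤ) * ((jk.1.2 : ℤ) - jk.1.1) :=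
      le_mul_of_one_le_right (by positivity) h4
    simp only [Set.mem_Iic]
    omega
  · have h3 := Finset.single_le_sum (fun jk _ => hq e jk) (Finset.mem_univ jk)
    have h5 : (e.2 jk : ℤ) ≤ (e.2 jk : ℤ) * ((jk.2 : ℤ) + 1) :=
      le_mul_of_one_le_right (by positivity) (by omega)
    simp only [Set.mem_Iic]
    omega

/-- The symmetric polynomial `f_n`. -/
def f (κ : ℝ) (n : Fin N → ℤ) : MvPolynomial (Fin N) ℂ :=
  ∑ᶠ e ∈ {e : GenIndex N | genWeight e = n}, genTerm κ e

/-! ### The coefficients `u_n(m)` -/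

/-- `Ẽ_n = - ∑_j (α_2 n_j (n_j - 1 + 2 κ (N - j)) + β_1 n_j)`, where `j` runs from `1` to `N`. -/
def energy (κ : ℝ) (α β : ℂ[X]) (n : Fin N → ℤ) : ℂ :=
  -∑ j : Fin N, (α.coeff 2 * n j * (n j - 1 + 2 * κ * (N - (j + 1 : ℕ))) + β.coeff 1 * n j)

/-- `b_n(m) = Ẽ_n - Ẽ_m`. -/
def b (κ : ℝ) (α β : ℂ[X]) (n m : Fin N → ℤ) : ℂ := energy κ α β n - energy κ α β m

/-- `n_j^+ = n_j + κ (N + 1 - j)`, where `j` runs from `1` to `N`. -/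
def shift (κ : ℝ) (n : Fin N → ℤ) (j : Fin N) : ℂ := n j + κ * (N + 1 - (j + 1 : ℕ))

/-- The summation indices `j ≤ k`, `p ∈ {0, 1, 2}` and `ν ≥ 1`. -/
structure Step (N : ℕ) where
  j : Fin N
  k : Fin N
  p : Fin 3
  ν : ℕ
  j_le_k : j ≤ k
  one_le_ν : 1 ≤ ν

/-- `E_{jk}^{pν} = (1 - ν) e_j + (1 - p + ν) e_k`. -/
def Step.E (s : Step N) : Fin N → ℤ :=
  Pi.single s.j (1 - (s.ν : ℤ)) + Pi.single s.k (1 - ((s.p : ℕ) : ℤ) + (s.ν : ℤ))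

/-- The coefficient `g_{jk}(p, ν; m)`. -/
def Step.g (κ : ℝ) (α β : ℂ[X]) (s : Step N) (m : Fin N → ℤ) : ℂ :=
  (if s.j = s.k then 0 else κ * (κ - 1) * α.coeff s.p * (2 * s.ν - (s.p : ℕ))) -
    (if s.j = s.k ∧ s.ν = 1 then
      shift κ m s.j *
        ((if s.p = 0 then α.coeff 0 * (shift κ m s.j + 1) else 0) +
          (if s.p = 1 then α.coeff 1 * (shift κ m s.j - κ) + β.coeff 0 else 0))
    else 0)

/-- Finite nonempty sequences of steps: the summation indices of the series for `u_n(m)`. -/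
abbrev Steps (N : ℕ) : Type := Σ l : ℕ, (Fin (l + 1) → Step N)

/-- The integer vector `n - ∑_{q=r}^l E_q`. -/
def Steps.vertex (s : Steps N) (n : Fin N → ℤ) (r : Fin (s.1 + 1)) : Fin N → ℤ :=
  n - ∑ q ∈ Finset.Ici r, (s.2 q).E

/-- The term of the series for `u_n(m)` that belongs to a given sequence of steps. -/
def uTerm (κ : ℝ) (α β : ℂ[X]) (n m : Fin N → ℤ) (s : Steps N) : ℂ :=
  (if m + ∑ t, (s.2 t).E = n then 1 else 0) *
    ∏ r, (s.2 r).g κ α β (s.vertex n r) / b κ α β n (s.vertex n r)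

/-- The coefficient `u_n(m)`. -/
def u (κ : ℝ) (α β : ℂ[X]) (n m : Fin N → ℤ) : ℂ := ∑ᶠ s : Steps N, uTerm κ α β n m s

/-! ### The polynomials `P_n` -/

/-- The number `d`: it is `deg α`, unless `α` is constant and `β(0) ≠ 0`, where it is `1`. -/
def effDegree (α β : ℂ[X]) : ℕ := max α.natDegree (if β.coeff 0 = 0 then 0 else 1)

/-- The vectors `m` with `m ≺ n` and `|m| ≤ |n| + d - 2`. -/
def lowerIndices (α β : ℂ[X]) (n : Fin N → ℤ) : Set (Fin N → ℤ) :=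
  {m | StrictlyBelow m n ∧ size m ≤ size n + effDegree α β - 2}

/-- `P_n = f_n + ∑_m u_n(m) f_m`. -/
def P (κ : ℝ) (α β : ℂ[X]) (n : Fin N → ℤ) : MvPolynomial (Fin N) ℂ :=
  f κ n + ∑ᶠ m ∈ lowerIndices α β n, u κ α β n m • f κ m

/-- `b_n(m) ≠ 0` for all `m` over which the sum in `P_n` extends. -/
def NonResonant (κ : ℝ) (α β : ℂ[X]) (n : Fin N → ℤ) : Prop :=
  ∀ m ∈ lowerIndices α β n, b κ α β n m ≠ 0

/-- All sums and quotients in the definition of `P_n` make sense: the series for every coefficient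
`u_n(m)` has only finitely many nonzero terms, no denominator of a term with nonzero numerator
vanishes, and only finitely many summands `u_n(m) f_m` are nonzero. -/
def WellDefined (κ : ℝ) (α β : ℂ[X]) (n : Fin N → ℤ) : Prop :=
  (∀ m ∈ lowerIndices α β n,
    {s : Steps N | uTerm κ α β n m s ≠ 0}.Finite ∧
    ∀ s : Steps N, m + ∑ t, (s.2 t).E = n → ∏ r, (s.2 r).g κ α β (s.vertex n r) ≠ 0 →
      ∀ r, b κ α β n (s.vertex n r) ≠ 0) ∧
  {m ∈ lowerIndices α β n | u κ α β n m • f κ m ≠ 0}.Finite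

/-! ### The Schrödinger operator and its reduced form -/

/-- The value at a point `z` with distinct coordinates of
`∑_j α(z_j) ∂_j² Q + ∑_j β(z_j) ∂_j Q
  + 2κ ∑_{j<k} (α(z_j) ∂_j Q - α(z_k) ∂_k Q) / (z_j - z_k)`. -/
def reducedOp (κ : ℝ) (α β : ℂ[X]) (Q : MvPolynomial (Fin N) ℂ) (z : Fin N → ℂ) : ℂ :=
  ∑ j, α.eval (z j) * MvPolynomial.eval z (MvPolynomial.pderiv j (MvPolynomial.pderiv j Q)) +
    ∑ j, β.eval (z j) * MvPolynomial.eval z (MvPolynomial.pderiv j Q) +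
    2 * κ * ∑ j, ∑ k ∈ Finset.Ioi j,
      (α.eval (z j) * MvPolynomial.eval z (MvPolynomial.pderiv j Q) -
        α.eval (z k) * MvPolynomial.eval z (MvPolynomial.pderiv k Q)) / (z j - z k)

/-- The one-body potential as a function of `z`:
`v = (2β - α')(2β - 3α') / (16 α) - α''/4 + β'/2`. -/
def oneBody (α β : ℂ[X]) (t : ℂ) : ℂ :=
  (2 * β.eval t - (derivative α).eval t) * (2 * β.eval t - 3 * (derivative α).eval t) /
      (16 * α.eval t) -
    (derivative (derivative α)).eval t / 4 + (derivative β).eval t / 2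

/-- The interaction potential as a function of `z(x)` and `z(y)`. -/
def twoBody (κ : ℝ) (α : ℂ[X]) (s t : ℂ) : ℂ :=
  κ * (κ - 1) * (α.eval s + α.eval t) / (s - t) ^ 2

/-- The Schrödinger operator
`H_N = - ∑_j ∂²/∂x_j² + ∑_j V(x_j) + ∑_{j<k} W(x_j, x_k)` with `V(x) = v(z(x))`. -/
def hamiltonian (κ : ℝ) (α β : ℂ[X]) (z : ℝ → ℂ) (Ψ : (Fin N → ℝ) → ℂ) (x : Fin N → ℝ) : ℂ :=
  -∑ j, iteratedDeriv 2 (fun t : ℝ => Ψ (Function.update x j t)) (x j) +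
    (∑ j, oneBody α β (z (x j))) * Ψ x +
    (∑ j, ∑ k ∈ Finset.Ioi j, twoBody κ α (z (x j)) (z (x k))) * Ψ x

/-- The data that enter the ground state, on an open set `U` of particle configurations: a solution
`z` of `z' = √α(z)` (for either branch of the root), a primitive `w` of `(α' - 2β) / (4α)` along the
values of `z`, and for all `j < k` a branch `ℓ j k` on `U` of the logarithm of `z(x_k) - z(x_j)`.
The variable `z` may be complex (as in `z = exp (i x)` for `α = -z²`). -/
structure IsModel (α β : ℂ[X]) (z : ℝ → ℂ) (w : ℂ → ℂ) (U : Set (Fin N → ℝ))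
    (ℓ : Fin N → Fin N → (Fin N → ℝ) → ℂ) : Prop where
  isOpen : IsOpen U
  contDiffAt : ∀ x ∈ U, ∀ j, ContDiffAt ℝ 2 z (x j)
  deriv_sq : ∀ x ∈ U, ∀ j, deriv z (x j) ^ 2 = α.eval (z (x j))
  eval_ne_zero : ∀ x ∈ U, ∀ j, α.eval (z (x j)) ≠ 0
  hasDerivAt : ∀ x ∈ U, ∀ j, HasDerivAt w
    (((derivative α).eval (z (x j)) - 2 * β.eval (z (x j))) / (4 * α.eval (z (x j)))) (z (x j))
  differentiableOn : ∀ j k, j < k → DifferentiableOn ℝ (ℓ j k) U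
  exp_eq : ∀ j k, j < k → ∀ x ∈ U, Complex.exp (ℓ j k x) = z (x k) - z (x j)

/-- `Ψ_0(x) = ∏_j ψ_0(x_j) ∏_{j<k} (z(x_k) - z(x_j))^κ` with `ψ_0(x) = exp (-w(z(x)))`. -/
def groundState (κ : ℝ) (z : ℝ → ℂ) (w : ℂ → ℂ) (ℓ : Fin N → Fin N → (Fin N → ℝ) → ℂ)
    (x : Fin N → ℝ) : ℂ :=
  (∏ j, Complex.exp (-w (z (x j)))) * ∏ j, ∏ k ∈ Finset.Ioi j, Complex.exp (κ * ℓ j k x)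

/-- The eigenvalue `E_0` of the ground state. -/
def groundEnergy (N : ℕ) (κ : ℝ) (α β : ℂ[X]) : ℂ :=
  -(κ * β.coeff 1 * (N * (N - 1)) / 2 + κ ^ 2 * α.coeff 2 * (N * (N - 1) * (N - 2)) / 3)

/-- `Q` is a reduced eigenfunction of `H_N` for the eigenvalue `E_0 + E`: the function
`Ψ(x) = Ψ_0(x) Q(z(x_1), …, z(x_N))` is twice continuously differentiable and solves
`H_N Ψ = (E_0 + E) Ψ`; in the variables `z_j`, `H̃_N Q = -E Q`. -/
def IsReducedEigenfunction (κ : ℝ) (α β : ℂ[X]) (Q : MvPolynomial (Fin N) ℂ) (E : ℂ) : Prop :=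
  (∀ z : Fin N → ℂ, Function.Injective z →
    reducedOp κ α β Q z = -E * MvPolynomial.eval z Q) ∧
  ∀ (z : ℝ → ℂ) (w : ℂ → ℂ) (U : Set (Fin N → ℝ)) (ℓ : Fin N → Fin N → (Fin N → ℝ) → ℂ),
    IsModel α β z w U ℓ →
    ContDiffOn ℝ 2
      (fun x => groundState κ z w ℓ x * MvPolynomial.eval (fun j => z (x j)) Q) U ∧
    ∀ x ∈ U,
      hamiltonian κ α β z
          (fun x => groundState κ z w ℓ x * MvPolynomial.eval (fun j => z (x j)) Q) x =
        (groundEnergy N κ α β + E) *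
          (groundState κ z w ℓ x * MvPolynomial.eval (fun j => z (x j)) Q)

end CalogeroSutherland

end

noncomputable section

namespace CalogeroSutherland

variable {N : ℕ}

/-! In the variables u_1 = 1/y_1, u_i = y_{i-1}/y_i the generating function F of the f_n is a formal
power series, and y^{-n} is the monomial whose exponents are the tail sums n_i + ⋯ + n_N. The order
⪯ is thus the componentwise order of exponents, f_n = 0 as soon as a tail sum is negative, and only
finitely many f_m with m ⪯ n are nonzero.

The eigenvalue equation rests on a kernel identity: the reduced operator in x, applied to F, equals
an operator in y applied to F. It is proved in the fraction field of the power series ring, where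
y_k and 1/(y_k - x_j) exist. After division by F it is a rational identity (`kernel_identity`),
which follows from the three-body identity `three_body` for 2N particles, those at x_j with mass 1
and those at y_k with mass -1. Comparing coefficients of y^{-n} gives `reducedOp_f`: the operator
maps f_n to -Ẽ_n f_n minus the sum over steps s of g_s(n - E_s) f_{n - E_s}. Every step with g ≠ 0
strictly lowers n (`step_bounds`), so the action is triangular.

A combination of the f_m with coefficients c(m) is therefore an eigenvector for -Ẽ_n if b_n(m) c(m)
= ∑_s g_s(m) c(m + E_s). The series for u_n(m) is this recursion iterated along all chains of steps
from m to n; splitting off the first step gives the recursion back (`coeffP_recursion`). Conjugation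
by Ψ_0 leads to the Schrödinger equation; there `three_body` with unit masses cancels the
interaction and produces the α_2 part of E_0.

For the basis, P_λ is unitriangular over the products h_μ of coefficients of ∏_j (1 - x_j T)^{-κ}
(`P_sub_hProd_mem_span`). That the h_μ with μ a partition form a basis of the symmetric polynomials
follows from positivity: K = ∏_{j,k} (1 - x_j y_k)^{-κ} = ∑_μ h_μ(x) y^μ satisfies d K_d = κ ∑_r
p_r(x) p_r(y) K_{d-r} in degree d. For κ > 0 the Hermitian form c ↦ (c ⊗ c̄)(K_d) is hence
nonnegative, and if it vanishes in every degree, c kills all products of power sums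
(`kernelForm_nonneg`). Both independence and spanning result from a suitable c. -/

/-! ### Substituting a monomial into a univariate power series -/

section MonoSubst

variable {σ R : Type*} [CommRing R]

/-- The ring homomorphism `R⟦X⟧ → R⟦u⟧` that sends `X` to the nonconstant monomial `u^s`. -/
def monoSubst (s : σ →₀ ℕ) (hs : s ≠ 0) : PowerSeries R →ₐ[R] MvPowerSeries σ R :=
  PowerSeries.substAlgHom (PowerSeries.HasSubst.monomial hs (1 : R))

theorem monoSubst_X (s : σ →₀ ℕ) (hs : s ≠ 0) :
    monoSubst s hs (PowerSeries.X : PowerSeries R) = MvPowerSeries.monomial s 1 := by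
  rw [monoSubst, PowerSeries.coe_substAlgHom,
    PowerSeries.subst_X (PowerSeries.HasSubst.monomial hs (1 : R))]

theorem monoSubst_C (s : σ →₀ ℕ) (hs : s ≠ 0) (r : R) :
    monoSubst s hs (PowerSeries.C r) = MvPowerSeries.C r := by
  rw [monoSubst, PowerSeries.coe_substAlgHom, PowerSeries.subst_C]

theorem coeff_monoSubst [DecidableEq σ] (s : σ →₀ ℕ) (hs : s ≠ 0) (c : PowerSeries R)
    (d : σ →₀ ℕ) : MvPowerSeries.coeff d (monoSubst s hs c) =
      ∑ᶠ n : ℕ, if d = n • s then PowerSeries.coeff n c else 0 := by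
  rw [monoSubst, PowerSeries.coe_substAlgHom,
    PowerSeries.coeff_subst (PowerSeries.HasSubst.monomial hs (1 : R))]
  refine finsum_congr fun n => ?_
  rw [MvPowerSeries.monomial_pow, MvPowerSeries.coeff_monomial]
  simp

theorem nsmul_injective {s : σ →₀ ℕ} (hs : s ≠ 0) : Function.Injective fun n : ℕ => n • s := by
  intro a b hab
  obtain ⟨i, hi⟩ := Finsupp.ne_iff.mp hs
  have := congrArg (fun f => f i) hab
  simp only [Finsupp.coe_smul, Pi.smul_apply, smul_eq_mul] at this
  exact Nat.eq_of_mul_eq_mul_right (Nat.pos_of_ne_zero hi) this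

theorem coeff_monoSubst_nsmul (s : σ →₀ ℕ) (hs : s ≠ 0) (c : PowerSeries R) (n : ℕ) :
    MvPowerSeries.coeff (n • s) (monoSubst s hs c) = PowerSeries.coeff n c := by
  classical
  rw [coeff_monoSubst, finsum_eq_single _ n]
  · simp
  · intro m hm
    rw [if_neg]
    exact fun h => hm (nsmul_injective hs h).symm

theorem coeff_monoSubst_of_ne (s : σ →₀ ℕ) (hs : s ≠ 0) (c : PowerSeries R) (d : σ →₀ ℕ)
    (hd : ∀ n : ℕ, d ≠ n • s) : MvPowerSeries.coeff d (monoSubst s hs c) = 0 := by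
  classical
  rw [coeff_monoSubst]
  simp [hd]

/-- Both kinds of derivations below act coefficient by coefficient, so they keep the support on the
multiples of `s`; this criterion then reduces them to operations on univariate series. -/
theorem monoSubst_ext {s : σ →₀ ℕ} (hs : s ≠ 0) {c : PowerSeries R} {F : MvPowerSeries σ R}
    (h₁ : ∀ n : ℕ, MvPowerSeries.coeff (n • s) F = PowerSeries.coeff n c)
    (h₂ : ∀ d, (∀ n : ℕ, d ≠ n • s) → MvPowerSeries.coeff d F = 0) : F = monoSubst s hs c := by
  ext d
  by_cases hd : ∃ n : ℕ, d = n • s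
  · obtain ⟨n, rfl⟩ := hd
    rw [h₁, coeff_monoSubst_nsmul]
  · push Not at hd
    rw [h₂ d hd, coeff_monoSubst_of_ne s hs c d hd]

theorem finite_sum_nsmul_eq {ι : Type*} [Fintype ι] {s : ι → σ →₀ ℕ} (hs : ∀ i, s i ≠ 0)
    (d : σ →₀ ℕ) : {e : ι → ℕ | ∑ i, e i • s i = d}.Finite := by
  classical
  refine Set.Finite.of_finite_image (f := fun e => Finsupp.equivFunOnFinite.symm
    (fun i => e i • s i)) ((Finset.finite_toSet (Finset.univ.finsuppAntidiag d)).subset ?_) ?_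
  · rintro _ ⟨e, he, rfl⟩
    simp only [Finset.mem_coe, Finset.mem_finsuppAntidiag]
    exact ⟨by simpa using he, Finset.subset_univ _⟩
  · intro e _ e' _ h
    refine funext fun i => nsmul_injective (hs i) ?_
    exact congrFun (Finsupp.equivFunOnFinite.symm.injective h) i

theorem coeff_prod_monoSubst {ι : Type*} [Fintype ι] (s : ι → σ →₀ ℕ)
    (hs : ∀ i, s i ≠ 0) (c : ι → PowerSeries R) (d : σ →₀ ℕ) :
    MvPowerSeries.coeff d (∏ i, monoSubst (s i) (hs i) (c i)) =
      ∑ᶠ e ∈ {e : ι → ℕ | ∑ i, e i • s i = d}, ∏ i, PowerSeries.coeff (e i) (c i) := by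
  classical
  rw [MvPowerSeries.coeff_prod]
  have hinj : ∀ e e' : ι → ℕ, (∀ i, e i • s i = e' i • s i) → e = e' := fun e e' h =>
    funext fun i => nsmul_injective (hs i) (h i)
  have hfin := finite_sum_nsmul_eq hs d
  rw [finsum_mem_eq_finite_toFinset_sum _ hfin]
  symm
  refine Finset.sum_bij_ne_zero (fun e _ _ => Finsupp.equivFunOnFinite.symm
      (fun i => e i • s i)) ?_ ?_ ?_ ?_
  · intro e he _
    rw [Set.Finite.mem_toFinset] at he
    simp only [Finset.mem_finsuppAntidiag]
    exact ⟨by simpa using he, Finset.subset_univ _⟩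
  · intro e _ _ e' _ _ h
    refine hinj _ _ fun i => ?_
    exact congrFun (Finsupp.equivFunOnFinite.symm.injective h) i
  · intro l hl h
    have h' : ∀ i, ∃ n : ℕ, l i = n • s i := by
      intro i
      by_contra hcon
      push Not at hcon
      exact h (Finset.prod_eq_zero (Finset.mem_univ i) (coeff_monoSubst_of_ne _ _ _ _ hcon))
    choose e he using h'
    refine ⟨e, ?_, ?_, ?_⟩
    · rw [Set.Finite.mem_toFinset, Set.mem_ofPred_eq]
      rw [Finset.mem_finsuppAntidiag] at hl
      rw [← hl.1]
      exact Finset.sum_congr rfl fun i _ => (he i).symm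
    · convert h using 2 with i
      rw [he, coeff_monoSubst_nsmul]
    · ext1 i
      exact (he i).symm
  · intro e _ _
    refine Finset.prod_congr rfl fun i _ => ?_
    simp [coeff_monoSubst_nsmul]

/-- From degree `B` on, the univariate series contributes only multiples of u^{B s}, which do not
reach the exponent `d`. This turns the infinite sum over ν into a finite one. -/
theorem coeff_monoSubst_mul (s : σ →₀ ℕ) (hs : s ≠ 0) (c : PowerSeries R) (F : MvPowerSeries σ R)
    (d : σ →₀ ℕ) (B : ℕ) (hB : ¬ B • s ≤ d) :
    MvPowerSeries.coeff d (monoSubst s hs c * F) = ∑ n ∈ Finset.range B,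
      PowerSeries.coeff n c * MvPowerSeries.coeff d (MvPowerSeries.monomial (n • s) 1 * F) := by
  classical
  conv_lhs => rw [PowerSeries.eq_X_pow_mul_shift_add_trunc B c]
  rw [map_add (monoSubst s hs), map_mul (monoSubst s hs), map_pow, monoSubst_X, MvPowerSeries.monomial_pow, add_mul,
    map_add,
    mul_assoc, MvPowerSeries.coeff_monomial_mul, if_neg hB, zero_add]
  have : (PowerSeries.trunc B c : PowerSeries R) = ∑ i ∈ Finset.range B,
      PowerSeries.C (PowerSeries.coeff i c) * PowerSeries.X ^ i := by
    ext k
    rw [Polynomial.coeff_coe, PowerSeries.coeff_trunc, map_sum]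
    simp [PowerSeries.coeff_X_pow]
  rw [this, map_sum, Finset.sum_mul, map_sum]
  refine Finset.sum_congr rfl fun i _ => ?_
  rw [map_mul (monoSubst s hs), map_pow, monoSubst_X, monoSubst_C, MvPowerSeries.monomial_pow, mul_assoc,
    MvPowerSeries.coeff_C_mul, one_pow]

theorem map_monoSubst {S : Type*} [CommRing S] (g : R →+* S) (s : σ →₀ ℕ) (hs : s ≠ 0)
    (c : PowerSeries R) : MvPowerSeries.map g (monoSubst s hs c) =
      monoSubst s hs (PowerSeries.map g c) := by
  refine monoSubst_ext hs (fun n => ?_) fun d hd => ?_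
  · rw [MvPowerSeries.coeff_map, coeff_monoSubst_nsmul, PowerSeries.coeff_map]
  · rw [MvPowerSeries.coeff_map, coeff_monoSubst_of_ne s hs c d hd, map_zero]

end MonoSubst

/-! ### Two kinds of derivations on multivariate power series -/

section Derivations

variable {σ R : Type*} [CommRing R]

/-- The derivation that multiplies the coefficient of `u^d` by `ℓ d`. -/
def weightDer (ℓ : (σ →₀ ℕ) →+ R) : Derivation R (MvPowerSeries σ R) (MvPowerSeries σ R) :=
  Derivation.mk'
    { toFun := fun F => (fun d => ℓ d * MvPowerSeries.coeff d F : (σ →₀ ℕ) → R)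
      map_add' := fun F G => by
        funext d
        exact mul_add _ _ _
      map_smul' := fun r F => by
        funext d
        exact mul_left_comm _ _ _ } <| by
    classical
    intro F G
    ext d
    change ℓ d * MvPowerSeries.coeff d (F * G) = MvPowerSeries.coeff d (F * _ + G * _)
    rw [map_add, mul_comm G, MvPowerSeries.coeff_mul, MvPowerSeries.coeff_mul,
      MvPowerSeries.coeff_mul, Finset.mul_sum, ← Finset.sum_add_distrib]
    refine Finset.sum_congr rfl fun p hp => ?_
    -- Additivity of `ℓ` on `d = p.1 + p.2` is exactly the Leibniz rule.
    rw [← (Finset.HasAntidiagonal.mem_antidiagonal.mp hp), map_add]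
    change _ = MvPowerSeries.coeff p.1 F * (ℓ p.2 * MvPowerSeries.coeff p.2 G) +
      (ℓ p.1 * MvPowerSeries.coeff p.1 F) * MvPowerSeries.coeff p.2 G
    ring

theorem coeff_weightDer (ℓ : (σ →₀ ℕ) →+ R) (F : MvPowerSeries σ R) (d : σ →₀ ℕ) :
    MvPowerSeries.coeff d (weightDer ℓ F) = ℓ d * MvPowerSeries.coeff d F := rfl

theorem weightDer_monoSubst (ℓ : (σ →₀ ℕ) →+ R) (s : σ →₀ ℕ) (hs : s ≠ 0) (c : PowerSeries R) :
    weightDer ℓ (monoSubst s hs c) =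
      monoSubst s hs (PowerSeries.C (ℓ s) * (PowerSeries.X * PowerSeries.derivative R c)) := by
  refine monoSubst_ext hs (fun n => ?_) fun d hd => ?_
  · rw [coeff_weightDer, coeff_monoSubst_nsmul, PowerSeries.coeff_C_mul]
    rcases n with _ | n
    · simp
    · rw [PowerSeries.coeff_succ_X_mul, PowerSeries.coeff_derivative, map_nsmul, nsmul_eq_mul]
      push_cast
      ring
  · rw [coeff_weightDer, coeff_monoSubst_of_ne s hs c d hd, mul_zero]

variable {k : Type*} [CommRing k] [Algebra k R]

/-- The derivation that acts on every coefficient by a given derivation. -/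
def coeffDer (D : Derivation k R R) : Derivation k (MvPowerSeries σ R) (MvPowerSeries σ R) :=
  Derivation.mk'
    { toFun := fun F => (fun d => D (MvPowerSeries.coeff d F) : (σ →₀ ℕ) → R)
      map_add' := fun F G => by
        funext d
        exact map_add _ _ _
      map_smul' := fun r F => by
        funext d
        exact D.map_smul _ _ } <| by
    classical
    intro F G
    ext d
    change D (MvPowerSeries.coeff d (F * G)) = MvPowerSeries.coeff d (F * _ + G * _)
    rw [map_add, mul_comm G, MvPowerSeries.coeff_mul, MvPowerSeries.coeff_mul,
      MvPowerSeries.coeff_mul, map_sum, ← Finset.sum_add_distrib]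
    refine Finset.sum_congr rfl fun p hp => ?_
    rw [D.leibniz, smul_eq_mul, smul_eq_mul, mul_comm (MvPowerSeries.coeff p.2 G)]
    rfl

theorem coeff_coeffDer (D : Derivation k R R) (F : MvPowerSeries σ R) (d : σ →₀ ℕ) :
    MvPowerSeries.coeff d (coeffDer D F) = D (MvPowerSeries.coeff d F) := rfl

theorem coeffDer_monoSubst (D : Derivation k R R) (s : σ →₀ ℕ) (hs : s ≠ 0) (c : PowerSeries R) :
    coeffDer D (monoSubst s hs c) =
      monoSubst s hs (PowerSeries.mk fun n => D (PowerSeries.coeff n c)) := by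
  refine monoSubst_ext hs (fun n => ?_) fun d hd => ?_
  · rw [coeff_coeffDer, coeff_monoSubst_nsmul, PowerSeries.coeff_mk]
  · rw [coeff_coeffDer, coeff_monoSubst_of_ne s hs c d hd, map_zero]

theorem coeffDer_monomial_one (D : Derivation k R R) (s : σ →₀ ℕ) :
    coeffDer D (MvPowerSeries.monomial s (1 : R)) = 0 := by
  classical
  ext d
  rw [coeff_coeffDer, MvPowerSeries.coeff_monomial]
  split_ifs <;> simp

theorem coeffDer_C (D : Derivation k R R) (r : R) :
    coeffDer D (MvPowerSeries.C r : MvPowerSeries σ R) = MvPowerSeries.C (D r) := by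
  classical
  ext d
  rw [coeff_coeffDer, MvPowerSeries.coeff_C, MvPowerSeries.coeff_C]
  split_ifs <;> simp

theorem weightDer_monomial (ℓ : (σ →₀ ℕ) →+ R) (s : σ →₀ ℕ) (r : R) :
    weightDer ℓ (MvPowerSeries.monomial s r) = MvPowerSeries.C (ℓ s) * MvPowerSeries.monomial s r := by
  classical
  ext d
  rw [coeff_weightDer, MvPowerSeries.coeff_C_mul, MvPowerSeries.coeff_monomial]
  split_ifs with h
  · rw [h]
  · simp

end Derivations

/-! ### The binomial series -/

section Binomial

variable {R : Type*} [CommRing R]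

/-- The series `(1 - a X)⁻¹`. -/
def geomSeries (a : R) : PowerSeries R := PowerSeries.mk fun n => a ^ n

theorem one_sub_mul_geomSeries (a : R) :
    (1 - PowerSeries.C a * PowerSeries.X) * geomSeries a = 1 := by
  ext n
  rw [sub_mul, one_mul, map_sub, mul_assoc, PowerSeries.coeff_C_mul]
  rcases n with _ | n
  · simp [geomSeries]
  · rw [PowerSeries.coeff_succ_X_mul]
    simp [geomSeries, pow_succ, mul_comm, PowerSeries.coeff_one]

variable [Algebra ℂ R]

/-- The series `(1 - a X)^κ`. -/
def binomialPow (κ : ℝ) (a : R) : PowerSeries R :=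
  PowerSeries.mk fun n => algebraMap ℂ R (((-1) ^ n * Ring.choose κ n : ℝ) : ℂ) * a ^ n

theorem choose_succ_mul (κ : ℝ) (n : ℕ) :
    Ring.choose κ (n + 1) * (n + 1) = Ring.choose κ n * (κ - n) := by
  have h := Ring.choose_smul_choose κ (n := n + 1) (k := n) (Nat.le_succ n)
  rw [Nat.choose_succ_self_right, nsmul_eq_mul] at h
  simp only [Nat.add_sub_cancel_left, Ring.choose_one_right] at h
  push_cast at h
  linarith

theorem coeff_binomialPow_succ (κ : ℝ) (a : R) (n : ℕ) :
    PowerSeries.coeff (n + 1) (binomialPow κ a) * (n + 1) =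
      algebraMap ℂ R (n - κ) * a * PowerSeries.coeff n (binomialPow κ a) := by
  have h := congrArg (fun r : ℝ => algebraMap ℂ R ((r : ℝ) : ℂ)) (choose_succ_mul κ n)
  simp only [Complex.ofReal_mul, map_mul, Complex.ofReal_add, Complex.ofReal_natCast, map_add,
    Complex.ofReal_one, map_one, map_natCast, Complex.ofReal_sub, map_sub] at h
  simp only [binomialPow, PowerSeries.coeff_mk, pow_succ, Complex.ofReal_mul, map_mul,
    Complex.ofReal_pow, Complex.ofReal_neg, Complex.ofReal_one, map_pow, map_neg, map_one, map_sub,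
    map_natCast]
  linear_combination (-1) ^ n * (-1) * a ^ n * a * h

theorem binomialPow_ode (κ : ℝ) (a : R) :
    (1 - PowerSeries.C a * PowerSeries.X) * PowerSeries.derivative R (binomialPow κ a) =
      -(PowerSeries.C (algebraMap ℂ R κ * a) * binomialPow κ a) := by
  ext n
  rw [sub_mul, one_mul, map_sub, mul_assoc, PowerSeries.coeff_C_mul, map_neg,
    PowerSeries.coeff_C_mul, PowerSeries.coeff_derivative, coeff_binomialPow_succ]
  rcases n with _ | n
  · simp
  · rw [PowerSeries.coeff_succ_X_mul, PowerSeries.coeff_derivative]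
    simp only [map_sub, map_natCast]
    push_cast
    ring

/-- The differential equation is multiplied by X (1 - aX)⁻¹, and a X (1 - aX)⁻¹ = (1 - aX)⁻¹ - 1.
The result is a logarithmic derivative written without quotients, so a monomial can be substituted
for X. -/
theorem X_mul_derivative_binomialPow (κ : ℝ) (a : R) :
    PowerSeries.X * PowerSeries.derivative R (binomialPow κ a) =
      -(PowerSeries.C (algebraMap ℂ R κ) * (geomSeries a - 1) * binomialPow κ a) := by
  have h₁ := one_sub_mul_geomSeries a
  have h₂ := binomialPow_ode κ a
  rw [map_mul] at h₂
  linear_combination (PowerSeries.X * PowerSeries.derivative R (binomialPow κ a) -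
    PowerSeries.C (algebraMap ℂ R κ) * binomialPow κ a) * (-h₁) + geomSeries a * PowerSeries.X * h₂

theorem derivation_binomialPow (D : Derivation ℂ R R) (κ : ℝ) (a : R) :
    (PowerSeries.mk fun n => D (PowerSeries.coeff n (binomialPow κ a))) =
      -(PowerSeries.C (algebraMap ℂ R κ * D a) * PowerSeries.X * geomSeries a *
        binomialPow κ a) := by
  have h₃ : (PowerSeries.mk fun n => D (PowerSeries.coeff n (binomialPow κ a))) =
      PowerSeries.C (D a) * (PowerSeries.X * (PowerSeries.C (-algebraMap ℂ R κ)) * binomialPow κ a +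
        PowerSeries.X * (PowerSeries.X * PowerSeries.derivative R (binomialPow κ a))) := by
    ext n
    rw [PowerSeries.coeff_C_mul, PowerSeries.coeff_mk, map_add, mul_assoc PowerSeries.X]
    rcases n with _ | n
    · simp [binomialPow]
    · rw [PowerSeries.coeff_succ_X_mul, PowerSeries.coeff_succ_X_mul, PowerSeries.coeff_C_mul]
      -- At `a = 1` the recursion concerns the bare binomial coefficients; the powers of `a` come
      -- from D(a^{n+1}) = (n + 1) a^n D a.
      have h := coeff_binomialPow_succ κ (1 : R) n
      have e : PowerSeries.coeff n (PowerSeries.X * PowerSeries.derivative R (binomialPow κ a)) =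
          n * PowerSeries.coeff n (binomialPow κ a) := by
        rcases n with _ | n
        · simp
        · rw [PowerSeries.coeff_succ_X_mul, PowerSeries.coeff_derivative]
          push_cast
          ring
      rw [e]
      simp only [binomialPow, PowerSeries.coeff_mk, D.leibniz, D.leibniz_pow, D.map_algebraMap,
        one_pow, mul_one, map_sub, map_natCast] at h ⊢
      simp
      simp at h
      linear_combination D a * a ^ n * h
  rw [h₃, X_mul_derivative_binomialPow, map_mul, map_neg]
  ring

end Binomial

/-! ### Tail sums -/

/-- The tail sums `n_i + ⋯ + n_N`. -/
def tail : (Fin N → ℤ) →+ (Fin N → ℤ) where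
  toFun n i := ∑ k ∈ Finset.Ici i, n k
  map_zero' := by
    funext i
    simp
  map_add' m n := by
    funext i
    simp [Finset.sum_add_distrib]

theorem tail_apply (n : Fin N → ℤ) (i : Fin N) : tail n i = ∑ k ∈ Finset.Ici i, n k := rfl

theorem below_iff {m n : Fin N → ℤ} : Below m n ↔ tail m ≤ tail n := Iff.rfl

theorem tail_single (k : Fin N) (c : ℤ) (i : Fin N) :
    tail (Pi.single k c) i = if i ≤ k then c else 0 := by
  rw [tail_apply]
  simp [Pi.single_apply]

/-- The component `n_k`, as a function of the tail sums. -/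
def component (R : Type*) [AddCommGroupWithOne R] (k : Fin N) : (Fin N →₀ ℕ) →+ R where
  toFun d := (d k : R) - if h : (k : ℕ) + 1 < N then (d ⟨k + 1, h⟩ : R) else 0
  map_zero' := by simp
  map_add' d e := by
    split_ifs <;> simp; abel

theorem tail_sub_tail_succ (n : Fin N → ℤ) (k : Fin N) :
    tail n k - (if h : (k : ℕ) + 1 < N then tail n ⟨k + 1, h⟩ else 0) = n k := by
  have h : Finset.Ici k = insert k (Finset.Ioi k) := by
    rw [Finset.Ioi_insert]
  rw [tail_apply, h, Finset.sum_insert (by simp)]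
  have h' : (if h : (k : ℕ) + 1 < N then tail n ⟨k + 1, h⟩ else 0) = ∑ i ∈ Finset.Ioi k, n i := by
    split_ifs with hk
    · rw [tail_apply]
      congr 1
      ext i
      simp only [Finset.mem_Ici, Finset.mem_Ioi, Fin.le_def, Fin.lt_def]
      omega
    · symm
      refine Finset.sum_eq_zero fun i hi => ?_
      rw [Finset.mem_Ioi, Fin.lt_def] at hi
      omega
  rw [h']
  ring

theorem tail_injective : Function.Injective (tail : (Fin N → ℤ) →+ (Fin N → ℤ)) := by
  intro m n h
  funext k
  rw [← tail_sub_tail_succ m k, ← tail_sub_tail_succ n k, h]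

theorem Below.antisymm {m n : Fin N → ℤ} (h : Below m n) (h' : Below n m) : m = n :=
  tail_injective (le_antisymm (below_iff.mp h) (below_iff.mp h'))

theorem Below.trans {l m n : Fin N → ℤ} (h : Below l m) (h' : Below m n) : Below l n :=
  fun j => (h j).trans (h' j)

/-- The vector of tail sums as an exponent, for integer vectors with nonnegative tail sums. -/
def tailExp (n : Fin N → ℤ) : Fin N →₀ ℕ := Finsupp.equivFunOnFinite.symm fun i => (tail n i).toNat

theorem tailExp_apply (n : Fin N → ℤ) (i : Fin N) : tailExp n i = (tail n i).toNat := rfl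

theorem natCast_tailExp {n : Fin N → ℤ} (hn : 0 ≤ tail n) (i : Fin N) :
    (tailExp n i : ℤ) = tail n i := by
  rw [tailExp_apply, Int.toNat_of_nonneg (hn i)]

theorem eq_tailExp {n : Fin N → ℤ} {d : Fin N →₀ ℕ} (h : ∀ i, tail n i = d i) :
    d = tailExp n := by
  ext i
  rw [tailExp_apply, h, Int.toNat_natCast]

theorem component_tailExp (R : Type*) [CommRing R] {n : Fin N → ℤ} (hn : 0 ≤ tail n) (k : Fin N) :
    component R k (tailExp n) = n k := by
  have h : ∀ i, (tailExp n i : R) = ((tail n i : ℤ) : R) := fun i => by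
    rw [← natCast_tailExp hn i, Int.cast_natCast]
  change (tailExp n k : R) - (if h : (k : ℕ) + 1 < N then (tailExp n ⟨k + 1, h⟩ : R) else 0) = n k
  rw [← tail_sub_tail_succ n k]
  split_ifs <;> simp [h]

theorem tailExp_add {m n : Fin N → ℤ} (hm : 0 ≤ tail m) (hn : 0 ≤ tail n) :
    tailExp (m + n) = tailExp m + tailExp n := by
  symm
  refine eq_tailExp fun i => ?_
  rw [map_add, Finsupp.add_apply, Nat.cast_add, natCast_tailExp hm, natCast_tailExp hn,
    Pi.add_apply]

/-- The exponent of `1/y_k`. -/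
def yExp (k : Fin N) : Fin N →₀ ℕ := Finsupp.equivFunOnFinite.symm fun i => if i ≤ k then 1 else 0

/-- The exponent of `y_j/y_k`. -/
def tExp (j k : Fin N) : Fin N →₀ ℕ :=
  Finsupp.equivFunOnFinite.symm fun i => if j < i ∧ i ≤ k then 1 else 0

theorem yExp_apply (k i : Fin N) : yExp k i = if i ≤ k then 1 else 0 := rfl

theorem tExp_apply (j k i : Fin N) : tExp j k i = if j < i ∧ i ≤ k then 1 else 0 := rfl

theorem yExp_ne_zero (k : Fin N) : yExp k ≠ 0 := by
  refine Finsupp.ne_iff.mpr ⟨k, ?_⟩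
  simp [yExp_apply]

theorem tExp_ne_zero {j k : Fin N} (h : j < k) : tExp j k ≠ 0 := by
  refine Finsupp.ne_iff.mpr ⟨k, ?_⟩
  simp [tExp_apply, h]

theorem yExp_add_tExp {j k : Fin N} (h : j < k) : yExp j + tExp j k = yExp k := by
  ext i
  rw [Finsupp.add_apply, yExp_apply, tExp_apply, yExp_apply]
  split_ifs <;> omega

theorem tail_single_one (k i : Fin N) : tail (Pi.single k 1) i = yExp k i := by
  rw [tail_single, yExp_apply]
  split_ifs <;> simp

theorem tail_single_sub_single {j k : Fin N} (h : j < k) (i : Fin N) :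
    tail (Pi.single k 1 - Pi.single j 1) i = tExp j k i := by
  rw [map_sub, Pi.sub_apply, tail_single, tail_single, tExp_apply]
  split_ifs <;> omega

theorem yExp_eq (k : Fin N) : yExp k = tailExp (Pi.single k 1) := eq_tailExp (tail_single_one k)

theorem tExp_eq {j k : Fin N} (h : j < k) : tExp j k = tailExp (Pi.single k 1 - Pi.single j 1) :=
  eq_tailExp (tail_single_sub_single h)

theorem component_yExp (R : Type*) [CommRing R] (k i : Fin N) :
    component R i (yExp k) = if i = k then 1 else 0 := by
  rw [yExp_eq, component_tailExp R (fun i => by rw [tail_single_one]; positivity),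
    Pi.single_apply]
  split_ifs <;> simp

theorem component_tExp (R : Type*) [CommRing R] {j k : Fin N} (h : j < k) (i : Fin N) :
    component R i (tExp j k) = (if i = k then 1 else 0) - (if i = j then 1 else 0) := by
  rw [tExp_eq h, component_tailExp R (fun i => by rw [tail_single_sub_single h]; positivity),
    Pi.sub_apply, Pi.single_apply, Pi.single_apply]
  split_ifs <;> simp

/-! ### The generating series -/

section GenSeries

variable {R : Type*} [CommRing R] [Algebra ℂ R]

/-- The pairs `j < k`. -/
abbrev Pairs (N : ℕ) : Type := {jk : Fin N × Fin N // jk.1 < jk.2}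

/-- The generating series `∏_{j<k} (1 - y_j/y_k)^κ / ∏_{j,k} (1 - x_j/y_k)^κ`, as a power series in
`u_1 = 1/y_1` and `u_i = y_{i-1}/y_i` for `i ≥ 2`. -/
def genSeries (κ : ℝ) (x : Fin N → R) : MvPowerSeries (Fin N) R :=
  (∏ jk : Pairs N, monoSubst (tExp jk.1.1 jk.1.2) (tExp_ne_zero jk.2) (binomialPow κ 1)) *
    ∏ jk : Fin N × Fin N, monoSubst (yExp jk.2) (yExp_ne_zero jk.2) (binomialPow (-κ) (x jk.1))

theorem tail_genWeight (e : GenIndex N) (i : Fin N) :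
    tail (genWeight e) i = ((∑ jk, e.1 jk • tExp jk.1.1 jk.1.2 + ∑ jk, e.2 jk • yExp jk.2 :
      Fin N →₀ ℕ) i : ℤ) := by
  have h : genWeight e = ∑ jk : Pairs N, (e.1 jk : ℤ) •
      (Pi.single jk.1.2 1 - Pi.single jk.1.1 1 : Fin N → ℤ) +
      ∑ jk, (e.2 jk : ℤ) • (Pi.single jk.2 1 : Fin N → ℤ) := by
    funext i
    simp only [genWeight, Pi.add_apply, Finset.sum_apply, Pi.smul_apply, Pi.sub_apply,
      Pi.single_apply, smul_eq_mul, eq_comm]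
  rw [h, map_add, map_sum, map_sum]
  simp only [map_zsmul, Pi.add_apply, Finset.sum_apply, Pi.smul_apply, smul_eq_mul,
    Finsupp.add_apply, Finsupp.finsetSum_apply, Finsupp.smul_apply, Nat.cast_add, Nat.cast_sum,
    Nat.cast_mul, tail_single_one]
  congr 1
  exact Finset.sum_congr rfl fun jk _ => by rw [tail_single_sub_single jk.2]

theorem genWeight_eq_iff {n : Fin N → ℤ} (hn : 0 ≤ tail n) (e : GenIndex N) :
    genWeight e = n ↔
      ∑ jk, e.1 jk • tExp jk.1.1 jk.1.2 + ∑ jk, e.2 jk • yExp jk.2 = tailExp n := by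
  constructor
  · rintro rfl
    exact eq_tailExp (tail_genWeight e)
  · intro h
    refine tail_injective (funext fun i => ?_)
    rw [tail_genWeight, h, natCast_tailExp hn]

/-- F contains no negative power of any u_i. This vanishing is the source of finiteness in all sums
over f_m with m ⪯ n. -/
theorem f_eq_zero {κ : ℝ} {n : Fin N → ℤ} (hn : ¬ 0 ≤ tail n) : f κ n = 0 := by
  have : {e : GenIndex N | genWeight e = n} = ∅ := by
    refine Set.eq_empty_of_forall_notMem ?_
    rintro e rfl
    refine hn fun i => ?_
    rw [tail_genWeight, Pi.zero_apply]
    exact Int.natCast_nonneg _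
  rw [f, this, finsum_mem_empty]

theorem coeff_genSeries (κ : ℝ) {n : Fin N → ℤ} (hn : 0 ≤ tail n) :
    MvPowerSeries.coeff (tailExp n)
      (genSeries κ (MvPolynomial.X : Fin N → MvPolynomial (Fin N) ℂ)) = f κ n := by
  -- Both families of factors are merged into one product over a sum type, so that
  -- `coeff_prod_monoSubst` applies once.
  have h : genSeries κ (MvPolynomial.X : Fin N → MvPolynomial (Fin N) ℂ) =
      ∏ i : Pairs N ⊕ (Fin N × Fin N),
        monoSubst (Sum.elim (fun jk : Pairs N => tExp jk.1.1 jk.1.2)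
          (fun jk : Fin N × Fin N => yExp jk.2) i)
          (by
            rcases i with jk | jk
            · exact tExp_ne_zero jk.2
            · exact yExp_ne_zero jk.2)
          (Sum.elim (fun _ => binomialPow κ 1)
            (fun jk : Fin N × Fin N => binomialPow (-κ) (MvPolynomial.X jk.1)) i) := by
    rw [Fintype.prod_sum_type]
    rfl
  rw [h, coeff_prod_monoSubst, f]
  refine finsum_mem_eq_of_bijOn (Equiv.sumArrowEquivProdArrow _ _ _) ?_ ?_
  · refine Equiv.bijOn' _ ?_ ?_
    · intro e he
      rw [Set.mem_ofPred_eq, Fintype.sum_sum_type] at he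
      exact (genWeight_eq_iff hn _).mpr he
    · intro e he
      rw [Set.mem_ofPred_eq, Fintype.sum_sum_type]
      exact (genWeight_eq_iff hn _).mp he
  · intro e _
    have h' : Equiv.sumArrowEquivProdArrow _ _ _ e =
      ((fun jk => e (Sum.inl jk), fun jk => e (Sum.inr jk)) : GenIndex N) := rfl
    rw [Fintype.prod_sum_type, h']
    simp only [Sum.elim_inl, Sum.elim_inr, binomialPow, PowerSeries.coeff_mk, genTerm, one_pow,
      mul_one, Finset.prod_mul_distrib, Complex.ofReal_mul, map_mul, MvPolynomial.algebraMap_eq,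
      Complex.ofReal_prod, map_prod, mul_assoc]

end GenSeries

/-! ### Logarithmic derivatives of the generating series -/

theorem derivation_prod {k A ι : Type*} [CommRing k] [CommRing A] [Algebra k A]
    (D : Derivation k A A) (s : Finset ι) (a l : ι → A) (h : ∀ i ∈ s, D (a i) = l i * a i) :
    D (∏ i ∈ s, a i) = (∑ i ∈ s, l i) * ∏ i ∈ s, a i := by
  classical
  induction s using Finset.induction_on with
  | empty => simp
  | insert i s hi ih =>
    rw [Finset.prod_insert hi, Finset.sum_insert hi, D.leibniz, h i (Finset.mem_insert_self _ _),
      ih fun j hj => h j (Finset.mem_insert_of_mem hj), smul_eq_mul, smul_eq_mul]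
    ring

theorem derivation_sq_mul {k A : Type*} [CommRing k] [CommRing A] [Algebra k A]
    (D : Derivation k A A) {F q : A} (h : D F = q * F) : D (D F) = (D q + q ^ 2) * F := by
  rw [h, D.leibniz, h, smul_eq_mul, smul_eq_mul]
  ring

section Relations

variable {R : Type*} [CommRing R]

/-- The series `1/y_k`. -/
def yInv (R : Type*) [CommRing R] (k : Fin N) : MvPowerSeries (Fin N) R :=
  MvPowerSeries.monomial (yExp k) 1

/-- The series `y_j/y_k` for `j < k`. -/
def ratio (R : Type*) [CommRing R] (jk : Pairs N) : MvPowerSeries (Fin N) R :=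
  MvPowerSeries.monomial (tExp jk.1.1 jk.1.2) 1

/-- The series `(1 - x_j/y_k)⁻¹`. -/
def xGeom (a : R) (k : Fin N) : MvPowerSeries (Fin N) R :=
  monoSubst (yExp k) (yExp_ne_zero k) (geomSeries a)

/-- The series `(1 - y_j/y_k)⁻¹` for `j < k`. -/
def yGeom (R : Type*) [CommRing R] (jk : Pairs N) : MvPowerSeries (Fin N) R :=
  monoSubst (tExp jk.1.1 jk.1.2) (tExp_ne_zero jk.2) (geomSeries 1)

theorem xGeom_mul (a : R) (k : Fin N) :
    xGeom a k * (1 - MvPowerSeries.C a * yInv R k) = 1 := by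
  have h := congrArg (monoSubst (yExp k) (yExp_ne_zero k)) (one_sub_mul_geomSeries a)
  rw [map_mul (monoSubst _ _), map_sub (monoSubst _ _), map_mul (monoSubst _ _), map_one, monoSubst_C, monoSubst_X] at h
  rw [mul_comm]
  exact h

theorem yGeom_mul (jk : Pairs N) : yGeom R jk * (1 - ratio R jk) = 1 := by
  have h := congrArg (monoSubst (tExp jk.1.1 jk.1.2) (tExp_ne_zero jk.2))
    (one_sub_mul_geomSeries (1 : R))
  rw [map_mul (monoSubst _ _), map_sub (monoSubst _ _), map_mul (monoSubst _ _), map_one, monoSubst_C, monoSubst_X, map_one, one_mul] at h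
  rw [mul_comm]
  exact h

theorem yInv_mul_ratio (jk : Pairs N) : yInv R jk.1.1 * ratio R jk = yInv R jk.1.2 := by
  rw [yInv, yInv, ratio, MvPowerSeries.monomial_mul_monomial, yExp_add_tExp jk.2, one_mul]

theorem weightDer_xGeom (ℓ : (Fin N →₀ ℕ) →+ R) (a : R) (k : Fin N) :
    weightDer ℓ (xGeom a k) =
      MvPowerSeries.C (ℓ (yExp k)) * (MvPowerSeries.C a * yInv R k) * xGeom a k ^ 2 := by
  rw [(weightDer ℓ).leibniz_of_mul_eq_one (xGeom_mul a k), map_sub, Derivation.map_one_eq_zero,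
    (weightDer ℓ).leibniz, yInv, weightDer_monomial, ← MvPowerSeries.monomial_zero_eq_C_apply,
    weightDer_monomial, map_zero]
  simp only [smul_eq_mul, map_zero]
  ring

theorem weightDer_yGeom (ℓ : (Fin N →₀ ℕ) →+ R) (jk : Pairs N) :
    weightDer ℓ (yGeom R jk) =
      MvPowerSeries.C (ℓ (tExp jk.1.1 jk.1.2)) * ratio R jk * yGeom R jk ^ 2 := by
  rw [(weightDer ℓ).leibniz_of_mul_eq_one (yGeom_mul jk), map_sub, Derivation.map_one_eq_zero,
    ratio, weightDer_monomial]
  simp only [smul_eq_mul]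
  ring

variable [Algebra ℂ R]

theorem coeffDer_xGeom (D : Derivation ℂ R R) (a : R) (k : Fin N) :
    coeffDer D (xGeom a k) = MvPowerSeries.C (D a) * yInv R k * xGeom a k ^ 2 := by
  rw [(coeffDer D).leibniz_of_mul_eq_one (xGeom_mul a k), map_sub, Derivation.map_one_eq_zero,
    (coeffDer D).leibniz, yInv, coeffDer_monomial_one, coeffDer_C]
  simp only [smul_eq_mul]
  ring

/-- A factor (1 - a u^s)^κ has logarithmic derivative -κ ℓ(s) ((1 - a u^s)⁻¹ - 1). The factors with
x carry -κ, hence the opposite signs of the two sums. -/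
theorem weightDer_genSeries (κ : ℝ) (x : Fin N → R) (ℓ : (Fin N →₀ ℕ) →+ R) :
    weightDer ℓ (genSeries κ x) = MvPowerSeries.C (algebraMap ℂ R κ) *
      (∑ jk : Fin N × Fin N, MvPowerSeries.C (ℓ (yExp jk.2)) * (xGeom (x jk.1) jk.2 - 1) -
        ∑ jk : Pairs N, MvPowerSeries.C (ℓ (tExp jk.1.1 jk.1.2)) * (yGeom R jk - 1)) *
      genSeries κ x := by
  have h₁ : ∀ (s : Fin N →₀ ℕ) (hs : s ≠ 0) (κ : ℝ) (a : R),
      weightDer ℓ (monoSubst s hs (binomialPow κ a)) = -(MvPowerSeries.C (ℓ s) *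
        (MvPowerSeries.C (algebraMap ℂ R κ)) * (monoSubst s hs (geomSeries a) - 1)) *
        monoSubst s hs (binomialPow κ a) := by
    intro s hs κ a
    rw [weightDer_monoSubst, X_mul_derivative_binomialPow, map_mul (monoSubst s hs), monoSubst_C,
      map_neg (monoSubst s hs), map_mul (monoSubst s hs), map_mul (monoSubst s hs),
      map_sub (monoSubst s hs), map_one, monoSubst_C]
    ring
  rw [genSeries, (weightDer ℓ).leibniz, derivation_prod _ _ _ _ fun jk _ => h₁ _ _ _ _,
    derivation_prod _ _ _ _ fun jk _ => h₁ _ _ _ _, Finset.sum_neg_distrib,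
    Finset.sum_neg_distrib]
  have e₁ : ∑ jk : Fin N × Fin N, MvPowerSeries.C (ℓ (yExp jk.2)) *
      (MvPowerSeries.C (algebraMap ℂ R (-κ : ℝ))) *
        (monoSubst (yExp jk.2) (yExp_ne_zero jk.2) (geomSeries (x jk.1)) - 1) =
      -(MvPowerSeries.C (algebraMap ℂ R κ) * ∑ jk : Fin N × Fin N,
        MvPowerSeries.C (ℓ (yExp jk.2)) * (xGeom (x jk.1) jk.2 - 1)) := by
    rw [Finset.mul_sum, ← Finset.sum_neg_distrib]
    refine Finset.sum_congr rfl fun jk _ => ?_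
    rw [xGeom, Complex.ofReal_neg, map_neg, map_neg]
    ring
  have e₂ : ∑ jk : Pairs N, MvPowerSeries.C (ℓ (tExp jk.1.1 jk.1.2)) *
      (MvPowerSeries.C (algebraMap ℂ R κ)) *
        (monoSubst (tExp jk.1.1 jk.1.2) (tExp_ne_zero jk.2) (geomSeries (1 : R)) - 1) =
      MvPowerSeries.C (algebraMap ℂ R κ) * ∑ jk : Pairs N,
        MvPowerSeries.C (ℓ (tExp jk.1.1 jk.1.2)) * (yGeom R jk - 1) := by
    rw [Finset.mul_sum]
    refine Finset.sum_congr rfl fun jk _ => ?_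
    rw [yGeom]
    ring
  rw [e₁, e₂, smul_eq_mul, smul_eq_mul]
  ring

theorem coeffDer_genSeries (κ : ℝ) (x : Fin N → R) (D : Derivation ℂ R R) :
    coeffDer D (genSeries κ x) = MvPowerSeries.C (algebraMap ℂ R κ) *
      (∑ jk : Fin N × Fin N, MvPowerSeries.C (D (x jk.1)) * yInv R jk.2 * xGeom (x jk.1) jk.2) *
      genSeries κ x := by
  have h₁ : ∀ (s : Fin N →₀ ℕ) (hs : s ≠ 0) (κ : ℝ) (a : R),
      coeffDer D (monoSubst s hs (binomialPow κ a)) =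
        -(MvPowerSeries.C (algebraMap ℂ R κ) * (MvPowerSeries.C (D a) *
          MvPowerSeries.monomial s 1 * monoSubst s hs (geomSeries a))) *
        monoSubst s hs (binomialPow κ a) := by
    intro s hs κ a
    rw [coeffDer_monoSubst, derivation_binomialPow, map_neg (monoSubst s hs),
      map_mul (monoSubst s hs), map_mul (monoSubst s hs), map_mul (monoSubst s hs), monoSubst_C,
      monoSubst_X, map_mul]
    ring
  rw [genSeries, (coeffDer D).leibniz, derivation_prod _ _ _ _ fun jk _ => h₁ _ _ _ _,
    derivation_prod _ _ _ _ fun jk _ => h₁ _ _ _ _, Finset.sum_neg_distrib,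
    Finset.sum_neg_distrib, ← Finset.mul_sum, ← Finset.mul_sum, Derivation.map_one_eq_zero]
  simp only [map_zero, zero_mul, Finset.sum_const_zero, mul_zero, neg_zero, add_zero,
    Complex.ofReal_neg, map_neg, smul_eq_mul, neg_mul, neg_neg]
  simp only [xGeom, yInv]
  ring

end Relations

/-! ### Specialization of the x-variables to a point -/

section Evaluate

theorem map_genSeries {S : Type*} [CommRing S] [Algebra ℂ S] {R : Type*} [CommRing R] [Algebra ℂ R]
    (g : R →ₐ[ℂ] S) (κ : ℝ) (x : Fin N → R) :
    MvPowerSeries.map (g : R →+* S) (genSeries κ x) = genSeries κ fun j => g (x j) := by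
  have h : ∀ (κ : ℝ) (a : R), PowerSeries.map (g : R →+* S) (binomialPow κ a) =
      binomialPow κ (g a) := by
    intro κ a
    ext n
    simp [binomialPow]
  simp only [genSeries, map_mul, map_prod, map_monoSubst, h, map_one]

variable (κ : ℝ) (z : Fin N → ℂ)

/-- The generating series of the values of `∂f_n/∂x_j` at `z`. -/
def evalSeriesD (j : Fin N) : MvPowerSeries (Fin N) ℂ :=
  MvPowerSeries.map (MvPolynomial.eval z)
    (coeffDer (MvPolynomial.pderiv j) (genSeries κ MvPolynomial.X))

/-- The generating series of the values of `∂²f_n/∂x_j²` at `z`. -/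
def evalSeriesDD (j : Fin N) : MvPowerSeries (Fin N) ℂ :=
  MvPowerSeries.map (MvPolynomial.eval z)
    (coeffDer (MvPolynomial.pderiv j) (coeffDer (MvPolynomial.pderiv j)
      (genSeries κ MvPolynomial.X)))

theorem map_eval_genSeries :
    MvPowerSeries.map (MvPolynomial.eval z) (genSeries κ MvPolynomial.X) = genSeries κ z := by
  have h := map_genSeries (MvPolynomial.aeval z : MvPolynomial (Fin N) ℂ →ₐ[ℂ] ℂ) κ
    MvPolynomial.X
  simp only [MvPolynomial.aeval_X] at h
  rw [← h]
  congr 1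

theorem map_yInv {R S : Type*} [CommRing R] [CommRing S] (g : R →+* S) (k : Fin N) :
    MvPowerSeries.map g (yInv R k) = yInv S k := by
  rw [yInv, yInv, MvPowerSeries.map_monomial, map_one]

theorem map_xGeom {R S : Type*} [CommRing R] [CommRing S] (g : R →+* S) (a : R) (k : Fin N) :
    MvPowerSeries.map g (xGeom a k) = xGeom (g a) k := by
  rw [xGeom, xGeom, map_monoSubst]
  congr 1
  ext n
  simp [geomSeries]

theorem coeffDer_pderiv_genSeries (j : Fin N) :
    coeffDer (MvPolynomial.pderiv j) (genSeries κ (MvPolynomial.X : _ → MvPolynomial (Fin N) ℂ)) =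
      (MvPowerSeries.C (MvPolynomial.C (κ : ℂ)) *
        ∑ k, yInv _ k * xGeom (MvPolynomial.X j) k) * genSeries κ MvPolynomial.X := by
  rw [coeffDer_genSeries, Fintype.sum_prod_type, Finset.sum_eq_single j]
  · simp [MvPolynomial.algebraMap_eq]
  · intro i _ hi
    simp [MvPolynomial.pderiv_X_of_ne hi]
  · simp

theorem evalSeriesD_eq (j : Fin N) : evalSeriesD κ z j =
    MvPowerSeries.C (κ : ℂ) * (∑ k, yInv ℂ k * xGeom (z j) k) * genSeries κ z := by
  rw [evalSeriesD, coeffDer_pderiv_genSeries, map_mul, map_mul, map_eval_genSeries, map_sum,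
    MvPowerSeries.map_C]
  simp [map_yInv, map_xGeom]

theorem evalSeriesDD_eq (j : Fin N) : evalSeriesDD κ z j =
    (MvPowerSeries.C (κ : ℂ) * (∑ k, yInv ℂ k ^ 2 * xGeom (z j) k ^ 2) +
      (MvPowerSeries.C (κ : ℂ) * ∑ k, yInv ℂ k * xGeom (z j) k) ^ 2) * genSeries κ z := by
  rw [evalSeriesDD, derivation_sq_mul _ (coeffDer_pderiv_genSeries κ j)]
  simp only [Derivation.leibniz, map_sum, coeffDer_C, coeffDer_xGeom, yInv, coeffDer_monomial_one]
  simp only [MvPolynomial.pderiv_X_self, MvPolynomial.pderiv_C, map_zero, mul_zero, add_zero,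
    map_one, one_mul, map_mul, map_add, map_pow, map_sum, map_eval_genSeries, MvPowerSeries.map_C,
    MvPolynomial.eval_C, map_xGeom, MvPolynomial.eval_X, smul_eq_mul, MvPowerSeries.map_monomial]
  simp only [pow_two, mul_assoc]

end Evaluate

/-! ### The relations in a field -/

section Field

variable {K : Type*} [Field K] (φ : MvPowerSeries (Fin N) ℂ →+* K) (κ : ℝ) (z : Fin N → ℂ)

/-- The image of `y_k` in a field that contains the power series. -/
def yElem (k : Fin N) : K := (φ (yInv ℂ k))⁻¹

/-- The image of `x_j` in a field that contains the power series. -/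
def xElem (j : Fin N) : K := φ (MvPowerSeries.C (z j))

theorem yElem_ne_zero (hφ : Function.Injective φ) (k : Fin N) : yElem φ k ≠ 0 := by
  refine inv_ne_zero fun h => ?_
  rw [← map_zero φ] at h
  have := congrArg (MvPowerSeries.coeff (yExp k)) (hφ h)
  rw [yInv, MvPowerSeries.coeff_monomial_same, map_zero] at this
  exact one_ne_zero this

theorem yInv_eq (k : Fin N) : φ (yInv ℂ k) = (yElem φ k)⁻¹ := by
  rw [yElem, inv_inv]

/-- The series 1 - x_j/y_k is a unit, so its image in the field cannot vanish. The same argument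
separates the y_k from each other. -/
theorem yElem_sub_xElem_ne_zero (hφ : Function.Injective φ) (j k : Fin N) : yElem φ k - xElem φ z j ≠ 0 := by
  have hy := yElem_ne_zero φ hφ k
  have h := congrArg φ (xGeom_mul (z j) k)
  rw [map_mul, map_sub, map_one, map_mul, yInv_eq φ] at h
  intro h₀
  have : φ (MvPowerSeries.C (z j)) = yElem φ k := (sub_eq_zero.mp h₀).symm
  rw [this, mul_inv_cancel₀ hy, sub_self, mul_zero] at h
  exact zero_ne_one h

theorem map_xGeom_eq (hφ : Function.Injective φ) (j k : Fin N) :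
    φ (xGeom (z j) k) = yElem φ k / (yElem φ k - xElem φ z j) := by
  have hy := yElem_ne_zero φ hφ k
  have h := congrArg φ (xGeom_mul (z j) k)
  rw [map_mul, map_sub, map_one, map_mul, yInv_eq φ] at h
  rw [eq_div_iff (yElem_sub_xElem_ne_zero φ z hφ j k), xElem]
  field_simp at h
  linear_combination h

theorem ratio_eq (hφ : Function.Injective φ) (jk : Pairs N) : φ (ratio ℂ jk) = yElem φ jk.1.1 / yElem φ jk.1.2 := by
  have hy := yElem_ne_zero φ hφ
  have h := congrArg φ (yInv_mul_ratio (R := ℂ) jk)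
  rw [map_mul, yInv_eq φ, yInv_eq φ] at h
  have h₁ := hy jk.1.1
  have h₂ := hy jk.1.2
  field_simp at h ⊢
  exact h

theorem yElem_sub_yElem_ne_zero (hφ : Function.Injective φ) {j k : Fin N} (hjk : j ≠ k) : yElem φ k - yElem φ j ≠ 0 := by
  have key : ∀ jk : Pairs N, yElem φ jk.1.2 - yElem φ jk.1.1 ≠ 0 := by
    intro jk
    have hy := yElem_ne_zero φ hφ jk.1.2
    have h := congrArg φ (yGeom_mul (R := ℂ) jk)
    rw [map_mul, map_sub, map_one, ratio_eq φ hφ] at h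
    intro h₀
    rw [← sub_eq_zero.mp h₀, div_self hy, sub_self, mul_zero] at h
    exact zero_ne_one h
  rcases lt_or_gt_of_ne hjk with h | h
  · exact key ⟨(j, k), h⟩
  · have := key ⟨(k, j), h⟩
    exact fun h' => this (by linear_combination -h')

theorem yGeom_eq (hφ : Function.Injective φ) (jk : Pairs N) :
    φ (yGeom ℂ jk) = yElem φ jk.1.2 / (yElem φ jk.1.2 - yElem φ jk.1.1) := by
  have hy := yElem_ne_zero φ hφ jk.1.2
  have h := congrArg φ (yGeom_mul (R := ℂ) jk)
  rw [map_mul, map_sub, map_one, ratio_eq φ hφ] at h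
  rw [eq_div_iff (yElem_sub_yElem_ne_zero φ hφ jk.2.ne)]
  field_simp at h
  linear_combination h

theorem field_evalSeriesD (hφ : Function.Injective φ) (j : Fin N) : φ (evalSeriesD κ z j) = φ (MvPowerSeries.C (κ : ℂ)) *
    (∑ k, 1 / (yElem φ k - xElem φ z j)) * φ (genSeries κ z) := by
  rw [evalSeriesD_eq, map_mul, map_mul, map_sum]
  congr 2
  refine Finset.sum_congr rfl fun k _ => ?_
  have hy := yElem_ne_zero φ hφ k
  rw [map_mul, yInv_eq φ, map_xGeom_eq φ z hφ]
  field_simp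

theorem field_evalSeriesDD (hφ : Function.Injective φ) (j : Fin N) : φ (evalSeriesDD κ z j) =
    (φ (MvPowerSeries.C (κ : ℂ)) * (∑ k, 1 / (yElem φ k - xElem φ z j) ^ 2) +
      φ (MvPowerSeries.C (κ : ℂ)) ^ 2 * (∑ k, 1 / (yElem φ k - xElem φ z j)) ^ 2) *
        φ (genSeries κ z) := by
  have h : ∀ k, φ (yInv ℂ k) * φ (xGeom (z j) k) = 1 / (yElem φ k - xElem φ z j) := by
    intro k
    have hy := yElem_ne_zero φ hφ k
    rw [yInv_eq φ, map_xGeom_eq φ z hφ]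
    field_simp
  rw [evalSeriesDD_eq]
  simp only [map_mul, map_add, map_pow, map_sum, ← mul_pow, h, one_div, inv_pow]

theorem sum_pairs {M : Type*} [AddCommMonoid M] (g : Fin N → Fin N → M) :
    ∑ jk : Pairs N, g jk.1.1 jk.1.2 = ∑ j, ∑ k, if j < k then g j k else 0 := by
  rw [← Fintype.sum_prod_type' (fun j k => if j < k then g j k else 0), ← Finset.sum_filter]
  exact (Finset.sum_subtype (Finset.univ.filter fun jk : Fin N × Fin N => jk.1 < jk.2)
    (fun jk => by simp) fun jk => g jk.1 jk.2).symm

/-- The k-th component sees y_j/y_l only if k is one of the two indices, with sign + for the larger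
index and - for the smaller one. -/
theorem sum_pairs_component (k : Fin N) (g : Fin N → Fin N → K) :
    ∑ jk : Pairs N, ((if k = jk.1.2 then 1 else 0) - (if k = jk.1.1 then 1 else 0)) *
      g jk.1.1 jk.1.2 = ∑ j, ((if j < k then g j k else 0) - if k < j then g k j else 0) := by
  rw [sum_pairs (fun j l => ((if k = l then 1 else 0) - (if k = j then 1 else 0)) * g j l),
    Finset.sum_sub_distrib]
  have h : ∀ j l, (if j < l then ((if k = l then (1 : K) else 0) - (if k = j then 1 else 0)) * g j l
      else 0) = (if k = l then (if j < k then g j k else 0) else 0) -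
        (if k = j then (if k < l then g k l else 0) else 0) := by
    intro j l
    by_cases h₁ : k = l <;> by_cases h₂ : k = j <;> by_cases h₃ : j < l <;>
      simp_all [neg_ite]
  simp only [h, Finset.sum_sub_distrib, Finset.sum_ite_eq, Finset.mem_univ, if_true]
  congr 1
  rw [Finset.sum_comm]
  simp

/-- `∑_j 1/(y_k - x_j) - ∑_{l≠k} 1/(y_k - y_l)`. -/
def logDer {ι : Type*} [Fintype ι] (x : ι → K) (y : ι → K) (k : ι) : K :=
  ∑ j, 1 / (y k - x j) - ∑ l, 1 / (y k - y l)

/-- The derivative of `logDer` with respect to `y_k`. -/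
def logDerDer {ι : Type*} [Fintype ι] (x : ι → K) (y : ι → K) (k : ι) : K :=
  ∑ l, 1 / (y k - y l) ^ 2 - ∑ j, 1 / (y k - x j) ^ 2

/-- The logarithmic derivative of the generating series with respect to `-log y_k`. -/
def logWeight (z : Fin N → ℂ) (k : Fin N) : MvPowerSeries (Fin N) ℂ :=
  ∑ jk : Fin N × Fin N, MvPowerSeries.C (component ℂ k (yExp jk.2)) * (xGeom (z jk.1) jk.2 - 1) -
    ∑ jk : Pairs N, MvPowerSeries.C (component ℂ k (tExp jk.1.1 jk.1.2)) * (yGeom ℂ jk - 1)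

/-- This explains the shift in n^+. The N factors 1/(1 - x_j/y_k) contribute y_k/(y_k - x_j) - 1
each. A pair with l < k contributes y_k/(y_k - y_l) - 1 with a minus sign, and a pair with l > k
contributes y_k/(y_k - y_l) with no constant. The constants add up to -(N - k) for the index k
counted from 0. -/
theorem field_logWeight (hφ : Function.Injective φ) (k : Fin N) :
    φ (logWeight z k) + ((N : K) - (k : ℕ)) =
      yElem φ k * logDer (xElem φ z) (yElem φ) k := by
  have h₁ : ∑ jk : Fin N × Fin N, φ (MvPowerSeries.C (component ℂ k (yExp jk.2))) *
      (φ (xGeom (z jk.1) jk.2) - 1) =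
      ∑ j, (yElem φ k / (yElem φ k - xElem φ z j) - 1) := by
    rw [Fintype.sum_prod_type]
    refine Finset.sum_congr rfl fun j _ => ?_
    rw [Finset.sum_eq_single k]
    · rw [component_yExp, if_pos rfl, map_one, map_one, one_mul, map_xGeom_eq φ z hφ]
    · intro l _ hl
      rw [component_yExp, if_neg hl.symm, map_zero, map_zero, zero_mul]
    · simp
  have h₂ : ∑ jk : Pairs N, φ (MvPowerSeries.C (component ℂ k (tExp jk.1.1 jk.1.2))) *
      (φ (yGeom ℂ jk) - 1) = ∑ l, (yElem φ k / (yElem φ k - yElem φ l)) - (k : ℕ) := by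
    have h : ∀ jk : Pairs N, φ (MvPowerSeries.C (component ℂ k (tExp jk.1.1 jk.1.2))) *
      (φ (yGeom ℂ jk) - 1) = ((if k = jk.1.2 then 1 else 0) - (if k = jk.1.1 then 1 else 0)) *
        (yElem φ jk.1.2 / (yElem φ jk.1.2 - yElem φ jk.1.1) - 1) := by
      intro jk
      rw [component_tExp ℂ jk.2, yGeom_eq φ hφ]
      congr 1
      split_ifs <;> simp
    have hc : ((k : ℕ) : K) = ∑ l : Fin N, if l < k then 1 else 0 := by
      rw [Finset.sum_boole, Finset.filter_gt_eq_Iio, Fin.card_Iio]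
    rw [Finset.sum_congr rfl fun jk _ => h jk, sum_pairs_component k (fun j l =>
      yElem φ l / (yElem φ l - yElem φ j) - 1), hc, ← Finset.sum_sub_distrib]
    refine Finset.sum_congr rfl fun l _ => ?_
    rcases lt_trichotomy l k with hl | hl | hl
    · rw [if_pos hl, if_neg hl.asymm, if_pos hl, sub_zero]
    -- For `l = k` both sides vanish, because division by `y_k - y_k` gives 0.
    · simp [hl]
    · have h₁ := yElem_sub_yElem_ne_zero φ hφ hl.ne
      have h₂ := yElem_sub_yElem_ne_zero φ hφ hl.ne'
      rw [if_pos hl, if_neg hl.asymm, if_neg hl.asymm]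
      field_simp
      ring
  rw [logWeight, map_sub, map_sum, map_sum]
  simp only [map_mul, map_sub, map_one]
  rw [h₁, h₂, logDer, Finset.sum_sub_distrib]
  simp only [Finset.sum_const, Finset.card_univ, Fintype.card_fin, nsmul_eq_mul, mul_one, mul_sub,
    Finset.mul_sum, mul_one_div]
  ring

/-- The weight n_k acts as -y_k ∂/∂y_k. Applied to y_k L - (N - k), with L = `logDer`, it gives -y_k
L - y_k² L'. -/
theorem field_weightDer_logWeight (hφ : Function.Injective φ) (k : Fin N) :
    φ (weightDer (component ℂ k) (logWeight z k)) =
      -(yElem φ k * logDer (xElem φ z) (yElem φ) k) -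
        yElem φ k ^ 2 * logDerDer (xElem φ z) (yElem φ) k := by
  have h₁ : ∑ jk : Fin N × Fin N, φ (MvPowerSeries.C (component ℂ k (yExp jk.2))) *
      φ (MvPowerSeries.C (component ℂ k (yExp jk.2)) * (MvPowerSeries.C (z jk.1) * yInv ℂ jk.2) *
        xGeom (z jk.1) jk.2 ^ 2) =
      ∑ j, (xElem φ z j * yElem φ k / (yElem φ k - xElem φ z j) ^ 2) := by
    rw [Fintype.sum_prod_type]
    refine Finset.sum_congr rfl fun j _ => ?_
    rw [Finset.sum_eq_single k]
    · have hy := yElem_ne_zero φ hφ k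
      rw [component_yExp, if_pos rfl, map_one, map_one, one_mul, one_mul, map_mul, map_mul, map_pow,
        yInv_eq, map_xGeom_eq φ z hφ, xElem]
      field_simp
    · intro l _ hl
      rw [component_yExp, if_neg hl.symm, map_zero, map_zero, zero_mul]
    · simp
  have h₂ : ∑ jk : Pairs N, φ (MvPowerSeries.C (component ℂ k (tExp jk.1.1 jk.1.2))) *
      φ (MvPowerSeries.C (component ℂ k (tExp jk.1.1 jk.1.2)) * ratio ℂ jk * yGeom ℂ jk ^ 2) =
      ∑ l, if l = k then 0 else (yElem φ l * yElem φ k / (yElem φ k - yElem φ l) ^ 2) := by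
    have h : ∀ jk : Pairs N, φ (MvPowerSeries.C (component ℂ k (tExp jk.1.1 jk.1.2))) *
      φ (MvPowerSeries.C (component ℂ k (tExp jk.1.1 jk.1.2)) * ratio ℂ jk * yGeom ℂ jk ^ 2) =
       ((if k = jk.1.2 then 1 else 0) - (if k = jk.1.1 then 1 else 0)) *
        (((if k = jk.1.2 then 1 else 0) - (if k = jk.1.1 then 1 else 0)) *
          (yElem φ jk.1.1 * yElem φ jk.1.2 / (yElem φ jk.1.2 - yElem φ jk.1.1) ^ 2)) := by
      intro jk
      have hy := yElem_ne_zero φ hφ jk.1.2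
      rw [map_mul, map_mul, map_pow, component_tExp ℂ jk.2, yGeom_eq φ hφ, ratio_eq φ hφ]
      have e : φ (MvPowerSeries.C ((if k = jk.1.2 then 1 else 0) - (if k = jk.1.1 then 1 else 0))) =
          (if k = jk.1.2 then 1 else 0) - (if k = jk.1.1 then 1 else 0) := by
        split_ifs <;> simp
      rw [e]
      congr 1
      rw [mul_assoc]
      congr 1
      field_simp
    rw [Finset.sum_congr rfl fun jk _ => h jk, sum_pairs_component k (fun j l =>
      ((if k = l then 1 else 0) - (if k = j then 1 else 0)) *
          (yElem φ j * yElem φ l / (yElem φ l - yElem φ j) ^ 2))]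
    refine Finset.sum_congr rfl fun l _ => ?_
    rcases lt_trichotomy l k with hl | hl | hl
    · simp [hl, hl.asymm, hl.ne, hl.ne']
    · simp [hl]
    · have h₁ := yElem_sub_yElem_ne_zero φ hφ hl.ne
      have h₂ := yElem_sub_yElem_ne_zero φ hφ hl.ne'
      simp only [hl, hl.asymm, hl.ne, hl.ne', if_true, if_false]
      field_simp
      ring
  have h₃ : ∀ s : Fin N →₀ ℕ, weightDer (component ℂ k)
      (MvPowerSeries.C (component ℂ k s) : MvPowerSeries (Fin N) ℂ) = 0 := fun s => by
    rw [← MvPowerSeries.monomial_zero_eq_C_apply, weightDer_monomial, map_zero, map_zero, zero_mul]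
  rw [logWeight, map_sub, map_sum, map_sum]
  simp only [Derivation.leibniz, h₃, map_sub, Derivation.map_one_eq_zero,
    sub_zero, weightDer_xGeom, weightDer_yGeom, smul_eq_mul, map_sum]
  simp only [mul_zero, add_zero, map_mul φ (MvPowerSeries.C _) (_ * _ * _ ^ 2)]
  rw [h₁]
  rw [h₂, logDer, logDerDer, mul_sub, mul_sub, Finset.mul_sum, Finset.mul_sum, Finset.mul_sum,
    Finset.mul_sum]
  have e₁ : ∀ j, xElem φ z j * yElem φ k / (yElem φ k - xElem φ z j) ^ 2 =
      yElem φ k ^ 2 * (1 / (yElem φ k - xElem φ z j) ^ 2) -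
        yElem φ k * (1 / (yElem φ k - xElem φ z j)) := by
    intro j
    have := yElem_sub_xElem_ne_zero φ z hφ j k
    field_simp
    ring
  have e₂ : ∀ l, (if l = k then 0 else (yElem φ l * yElem φ k / (yElem φ k - yElem φ l) ^ 2)) =
      yElem φ k ^ 2 * (1 / (yElem φ k - yElem φ l) ^ 2) -
        yElem φ k * (1 / (yElem φ k - yElem φ l)) := by
    intro l
    split_ifs with hl
    · simp [hl]
    · have := yElem_sub_yElem_ne_zero φ hφ hl
      field_simp
      ring
  simp only [e₁, e₂, Finset.sum_sub_distrib]
  ring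

theorem weightDer_component_genSeries (k : Fin N) :
    weightDer (component ℂ k) (genSeries κ z) =
      (MvPowerSeries.C (κ : ℂ) * logWeight z k) * genSeries κ z :=
  weightDer_genSeries κ z _

theorem field_weightDer (hφ : Function.Injective φ) (k : Fin N) :
    φ (weightDer (component ℂ k) (genSeries κ z)) +
      φ (MvPowerSeries.C (κ : ℂ)) * ((N : K) - (k : ℕ)) * φ (genSeries κ z) =
      φ (MvPowerSeries.C (κ : ℂ)) * (yElem φ k * logDer (xElem φ z) (yElem φ) k) *
        φ (genSeries κ z) := by
  rw [weightDer_component_genSeries, map_mul, map_mul]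
  linear_combination φ (MvPowerSeries.C (κ : ℂ)) * φ (genSeries κ z) * field_logWeight φ z hφ k

/-- The left side is n_k^+ (n_k^+ + 1) F. Conjugation by y_k^{-c} turns n_k^+ into -y_k ∂_k, hence
n_k^+ (n_k^+ + 1) into y_k² ∂_k². As the logarithmic derivative in question is -κ L, the second
derivative yields κ² L² - κ L'. -/
theorem field_weightDer_weightDer (hφ : Function.Injective φ) (k : Fin N) (c : K)
    (hc : c = φ (MvPowerSeries.C (κ : ℂ)) * ((N : K) - (k : ℕ))) :
    φ (weightDer (component ℂ k) (weightDer (component ℂ k) (genSeries κ z))) +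
      (2 * c + 1) * φ (weightDer (component ℂ k) (genSeries κ z)) +
        c * (c + 1) * φ (genSeries κ z) =
      yElem φ k ^ 2 * (φ (MvPowerSeries.C (κ : ℂ)) ^ 2 * logDer (xElem φ z) (yElem φ) k ^ 2 -
        φ (MvPowerSeries.C (κ : ℂ)) * logDerDer (xElem φ z) (yElem φ) k) *
        φ (genSeries κ z) := by
  have h₀ : weightDer (component ℂ k) (MvPowerSeries.C (κ : ℂ) : MvPowerSeries (Fin N) ℂ) = 0 := by
    rw [← MvPowerSeries.monomial_zero_eq_C_apply, weightDer_monomial, map_zero, map_zero, zero_mul]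
  rw [derivation_sq_mul _ (weightDer_component_genSeries κ z k), weightDer_component_genSeries,
    Derivation.leibniz, h₀, smul_zero, add_zero, smul_eq_mul]
  simp only [map_mul, map_add, map_pow]
  have h₁ := field_logWeight φ z hφ k
  have h₂ := field_weightDer_logWeight φ z hφ k
  have h₃ : φ (logWeight z k) = yElem φ k * logDer (xElem φ z) (yElem φ) k -
      ((N : K) - (k : ℕ)) := by linear_combination h₁
  rw [h₂, h₃, hc]
  ring

end Field

/-! ### Rational identities for sums over particles -/

section Rational

variable {K ι : Type*} [Field K] [Fintype ι]

/-- Expanding the square, the terms with k = l give the two-body sum. The others, symmetrized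
cyclically over three distinct points, are second divided differences of a quadratic polynomial,
hence equal to a₂. The last bracket is the sum of m_j m_k m_l over ordered triples of distinct
indices, by inclusion and exclusion. -/
theorem three_body (a₂ a₁ a₀ : K) {X : ι → K} (hX : Function.Injective X) (m : ι → K) :
    3 * ∑ j, m j * (a₂ * X j ^ 2 + a₁ * X j + a₀) * (∑ k, m k / (X j - X k)) ^ 2 =
      3 * ∑ j, ∑ k, m j * m k ^ 2 * (a₂ * X j ^ 2 + a₁ * X j + a₀) / (X j - X k) ^ 2 +
        a₂ * ((∑ j, m j) ^ 3 - 3 * (∑ j, m j) * (∑ j, m j ^ 2) + 2 * ∑ j, m j ^ 3) := by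
  classical
  set A : ι → K := fun j => a₂ * X j ^ 2 + a₁ * X j + a₀ with hA
  set G : ι → ι → ι → K := fun j k l =>
    if k = l then 0 else m j * A j * (m k / (X j - X k) * (m l / (X j - X l))) with hG
  have h₁ : ∑ j, m j * A j * (∑ k, m k / (X j - X k)) ^ 2 =
      ∑ j, ∑ k, m j * m k ^ 2 * A j / (X j - X k) ^ 2 + ∑ j, ∑ k, ∑ l, G j k l := by
    rw [← Finset.sum_add_distrib]
    refine Finset.sum_congr rfl fun j _ => ?_
    rw [pow_two, Finset.sum_mul_sum, Finset.mul_sum, ← Finset.sum_add_distrib]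
    refine Finset.sum_congr rfl fun k _ => ?_
    rw [Finset.mul_sum]
    have : ∀ l, m j * A j * (m k / (X j - X k) * (m l / (X j - X l))) =
        (if k = l then m j * m k ^ 2 * A j / (X j - X k) ^ 2 else 0) + G j k l := by
      intro l
      simp only [hG]
      split_ifs with h
      · rw [h, div_mul_div_comm, add_zero]
        ring
      · rw [zero_add]
    rw [Finset.sum_congr rfl fun l _ => this l, Finset.sum_add_distrib, Finset.sum_ite_eq,
      if_pos (Finset.mem_univ _)]
  have h₂ : ∑ j, ∑ k, ∑ l, G j k l = ∑ j, ∑ k, ∑ l, G k l j := by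
    conv_lhs => rw [Finset.sum_congr rfl fun j _ => Finset.sum_comm, Finset.sum_comm]
  have h₃ : ∑ j, ∑ k, ∑ l, G j k l = ∑ j, ∑ k, ∑ l, G l j k := by
    conv_rhs => rw [Finset.sum_congr rfl fun j _ => Finset.sum_comm, Finset.sum_comm]
  -- If j = k or j = l, the corresponding quotient is a division by 0 and equals 0; if k = l, `G` is
  -- 0 by definition. The bracket on the right is the indicator of three distinct indices.
  have h₄ : ∀ j k l, G j k l + G k l j + G l j k = a₂ * (m j * m k * m l *
      (1 - (if j = k then 1 else 0) - (if k = l then 1 else 0) - (if j = l then 1 else 0) +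
        2 * if j = k then (if k = l then 1 else 0) else 0)) := by
    intro j k l
    by_cases hjk : j = k
    · by_cases hkl : k = l
      · subst hjk hkl
        simp [hG]
        norm_num
      · subst hjk
        simp [hG, hkl, Ne.symm hkl]
    · by_cases hkl : k = l
      · subst hkl
        simp [hG, hjk, Ne.symm hjk]
      · by_cases hjl : j = l
        · subst hjl
          simp [hG, hjk, hkl]
        · have e₁ := sub_ne_zero.mpr (hX.ne hjk)
          have e₂ := sub_ne_zero.mpr (hX.ne hkl)
          have e₃ := sub_ne_zero.mpr (hX.ne hjl)
          have e₄ := sub_ne_zero.mpr (hX.ne hjk).symm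
          have e₅ := sub_ne_zero.mpr (hX.ne hkl).symm
          have e₆ := sub_ne_zero.mpr (hX.ne hjl).symm
          simp only [hG, hA, hjk, hkl, hjl, Ne.symm hjl, if_false]
          rw [← neg_sub (X j) (X k), ← neg_sub (X k) (X l), ← neg_sub (X j) (X l)]
          field_simp
          ring
  have h₅ : 3 * ∑ j, ∑ k, ∑ l, G j k l = a₂ * ((∑ j, m j) ^ 3 -
      3 * (∑ j, m j) * (∑ j, m j ^ 2) + 2 * ∑ j, m j ^ 3) := by
    have : 3 * ∑ j, ∑ k, ∑ l, G j k l = ∑ j, ∑ k, ∑ l, (G j k l + G k l j + G l j k) := by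
      simp only [Finset.sum_add_distrib]
      rw [← h₂, ← h₃]
      ring
    rw [this]
    simp only [h₄, ← Finset.mul_sum]
    congr 1
    simp only [mul_add, mul_sub, Finset.sum_add_distrib, Finset.sum_sub_distrib, mul_ite, mul_one,
      mul_zero, Finset.sum_ite_eq, Finset.mem_univ, if_true]
    have s₁ : ∑ j, ∑ k, ∑ l, m j * m k * m l = (∑ j, m j) ^ 3 := by
      rw [pow_succ, pow_two, Finset.sum_mul_sum, Finset.sum_mul]
      refine Finset.sum_congr rfl fun j _ => ?_
      rw [Finset.sum_mul_sum]
    have s₂ : ∑ j, ∑ k, ∑ l, (if j = k then m j * m k * m l else 0) =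
        (∑ j, m j) * ∑ j, m j ^ 2 := by
      rw [mul_comm, Finset.sum_mul]
      refine Finset.sum_congr rfl fun j _ => ?_
      rw [Finset.sum_comm]
      simp [pow_two, Finset.mul_sum]
    have s₃ : ∑ j, ∑ k, m j * m k * m k = (∑ j, m j) * ∑ j, m j ^ 2 := by
      rw [Finset.sum_mul_sum]
      simp only [pow_two, mul_assoc]
    have s₄ : ∑ j, ∑ k, m j * m k * m j = (∑ j, m j) * ∑ j, m j ^ 2 := by
      rw [mul_comm, Finset.sum_mul_sum]
      refine Finset.sum_congr rfl fun j _ => Finset.sum_congr rfl fun k _ => ?_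
      ring
    have s₅ : ∑ j, ∑ k, ∑ l, (if j = k then (if k = l then m j * m k * m l * 2 else 0) else 0) =
        2 * ∑ j, m j ^ 3 := by
      rw [Finset.mul_sum]
      refine Finset.sum_congr rfl fun j _ => ?_
      rw [Finset.sum_comm]
      simp
      ring
    rw [s₁, s₂, s₃, s₄, s₅]
    ring
  rw [h₁, mul_add, h₅]

/-- Exchanging k and l, a pair contributes ((p y_k + q) - (p y_l + q))/(y_k - y_l) = p. -/
theorem sum_div_sub (p q : K) {y : ι → K} (hy : Function.Injective y) :
    2 * ∑ k, (p * y k + q) * ∑ l, 1 / (y k - y l) =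
      p * (Fintype.card ι * (Fintype.card ι - 1)) := by
  classical
  have h₁ : ∑ k, (p * y k + q) * ∑ l, 1 / (y k - y l) =
      ∑ k, ∑ l, (p * y k + q) * (1 / (y k - y l)) := by
    simp only [Finset.mul_sum]
  have h₂ : 2 * ∑ k, (p * y k + q) * ∑ l, 1 / (y k - y l) =
      ∑ k, ∑ l, ((p * y k + q) * (1 / (y k - y l)) + (p * y l + q) * (1 / (y l - y k))) := by
    simp only [Finset.sum_add_distrib]
    rw [h₁, two_mul]
    congr 1
    exact Finset.sum_comm
  have h₃ : ∀ k l, (p * y k + q) * (1 / (y k - y l)) + (p * y l + q) * (1 / (y l - y k)) =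
      p - if k = l then p else 0 := by
    intro k l
    split_ifs with h
    · simp [h]
    · have e₁ := sub_ne_zero.mpr (hy.ne h)
      have e₂ := sub_ne_zero.mpr (hy.ne h).symm
      rw [← neg_sub (y k) (y l)]
      field_simp
      ring
  rw [h₂]
  simp only [h₃, Finset.sum_sub_distrib, Finset.sum_ite_eq, Finset.mem_univ, if_true,
    Finset.sum_const, Finset.card_univ, nsmul_eq_mul]
  ring

/-- The left side is the reduced operator on F divided by F, written with x-derivatives; the right
side expresses it through y only. With B_j = ∑_k 1/(x_j - x_k) and s_j = ∑_k 1/(y_k - x_j),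
completing the square in s_j² + 2 s_j B_j = (s_j + B_j)² - B_j² makes the κ² terms three-body sums.
The mixed x-y terms that remain are collected in `XY` and removed by `hc`. -/
theorem kernel_identity [CharZero K] (κ a₂ a₁ a₀ b₁ b₀ : K) {x y : ι → K}
    (hx : Function.Injective x) (hy : Function.Injective y) (hxy : ∀ j k, y k - x j ≠ 0) :
    ∑ j, (a₂ * x j ^ 2 + a₁ * x j + a₀) *
          (κ * (∑ k, 1 / (y k - x j) ^ 2) + κ ^ 2 * (∑ k, 1 / (y k - x j)) ^ 2) +
        ∑ j, (b₁ * x j + b₀) * (κ * ∑ k, 1 / (y k - x j)) +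
        2 * κ * ∑ j, (a₂ * x j ^ 2 + a₁ * x j + a₀) * (κ * ∑ k, 1 / (y k - x j)) *
          ∑ k, 1 / (x j - x k) =
      ∑ k, ((a₂ * y k ^ 2 + a₁ * y k + a₀) * (κ ^ 2 * logDer x y k ^ 2 - κ * logDerDer x y k) -
        κ * (1 + κ) * (2 * a₂ * y k + a₁) * logDer x y k +
        κ * (b₁ * y k + b₀) * logDer x y k) -
      κ * (κ - 1) * (∑ k, ∑ l, (a₂ * y k ^ 2 + a₁ * y k + a₀) / (y k - y l) ^ 2) +
      ((κ ^ 2 + κ) * a₂ * Fintype.card ι -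
        κ ^ 2 * a₂ * (Fintype.card ι * (Fintype.card ι - 1) * (Fintype.card ι - 2)) / 3 -
        b₁ * κ * (Fintype.card ι * (Fintype.card ι + 1)) / 2) := by
  set A : K → K := fun t => a₂ * t ^ 2 + a₁ * t + a₀ with hA
  set s : ι → K := fun j => ∑ k, 1 / (y k - x j) with hs
  set B : ι → K := fun j => ∑ k, 1 / (x j - x k) with hB
  set XY : K := ∑ k, ∑ j, (A (x j) - A (y k)) / (y k - x j) ^ 2 with hXY
  set Xp : K := ∑ j, ∑ k, A (x j) / (x j - x k) ^ 2 with hXp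
  set Yp : K := ∑ k, ∑ l, A (y k) / (y k - y l) ^ 2 with hYp
  set n : K := (Fintype.card ι : K) with hn
  have ha : ∑ j, A (x j) * (B j + s j) ^ 2 - ∑ k, A (y k) * logDer x y k ^ 2 = Xp - Yp + XY := by
    -- One system of 2n particles with masses 1 at x and -1 at y. The total mass and the sum of the
    -- cubes vanish, so `three_body` has no constant term here.
    have hinj : Function.Injective (Sum.elim x y) := by
      refine hx.sumElim hy fun j k h => hxy j k ?_
      rw [h, sub_self]
    have h := three_body a₂ a₁ a₀ hinj (Sum.elim (fun _ => 1) fun _ => -1)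
    simp only [Fintype.sum_sum_type, Sum.elim_inl, Sum.elim_inr] at h
    have h₁ : ∀ j, ∑ k, 1 / (x j - x k) + ∑ k, -1 / (x j - y k) = B j + s j := by
      intro j
      simp only [hB, hs]
      congr 1
      refine Finset.sum_congr rfl fun k _ => ?_
      rw [← neg_sub, div_neg, neg_div, neg_neg]
    have h₂ : ∀ k, ∑ j, 1 / (y k - x j) + ∑ l, -1 / (y k - y l) = logDer x y k := by
      intro k
      simp only [logDer, neg_div, Finset.sum_neg_distrib, sub_eq_add_neg]
    have h₃ : ∑ j, ∑ k, A (x j) / (x j - y k) ^ 2 - ∑ k, ∑ j, A (y k) / (y k - x j) ^ 2 = XY := by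
      rw [Finset.sum_comm, hXY, ← Finset.sum_sub_distrib]
      refine Finset.sum_congr rfl fun k _ => ?_
      rw [← Finset.sum_sub_distrib]
      refine Finset.sum_congr rfl fun j _ => ?_
      rw [sub_div, ← neg_sub (y k) (x j), neg_sq]
    have h₄ : (-1 : K) ^ 3 = -1 := by norm_num
    simp only [h₁, h₂] at h
    simp only [one_mul, one_pow, neg_mul, neg_one_sq, neg_div, h₄,
      Finset.sum_neg_distrib, Finset.sum_add_distrib] at h
    simp only [hXp, hYp, hA]
    simp only [hXY, hA] at h₃
    linear_combination h / 3 + h₃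
  have hb : ∑ j, A (x j) * B j ^ 2 = Xp + a₂ * (n * (n - 1) * (n - 2)) / 3 := by
    have h := three_body a₂ a₁ a₀ hx (fun _ => 1)
    simp only [one_mul, one_pow, Finset.sum_const, Finset.card_univ, nsmul_eq_mul, mul_one] at h
    rw [eq_comm, ← sub_eq_zero] at h ⊢
    simp only [hXp, hB, hA]
    linear_combination h / 3
  -- Taylor expansion of the quadratic A at y_k gives (A(x_j) - A(y_k))/(y_k - x_j)² + A'(y_k)/(y_k
  -- - x_j) = a₂ for each of the n² pairs; the y-y terms are handled by `sum_div_sub`.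
  have hc : XY + ∑ k, (2 * a₂ * y k + a₁) * logDer x y k = a₂ * n := by
    have h := sum_div_sub (2 * a₂) a₁ hy
    have h₁ : XY + ∑ k, (2 * a₂ * y k + a₁) * ∑ j, 1 / (y k - x j) = a₂ * n ^ 2 := by
      have : a₂ * n ^ 2 = ∑ k : ι, ∑ j : ι, a₂ := by
        simp only [Finset.sum_const, Finset.card_univ, nsmul_eq_mul]
        ring
      rw [this, hXY, ← Finset.sum_add_distrib]
      refine Finset.sum_congr rfl fun k _ => ?_
      rw [Finset.mul_sum, ← Finset.sum_add_distrib]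
      refine Finset.sum_congr rfl fun j _ => ?_
      have := hxy j k
      simp only [hA]
      field_simp
      ring
    simp only [logDer, mul_sub, Finset.sum_sub_distrib]
    linear_combination h₁ - h / 2
  have hd : ∑ j, (b₁ * x j + b₀) * s j - ∑ k, (b₁ * y k + b₀) * logDer x y k =
      - b₁ * (n * (n + 1)) / 2 := by
    have h := sum_div_sub b₁ b₀ hy
    have h₁ : ∑ j, (b₁ * x j + b₀) * s j - ∑ k, (b₁ * y k + b₀) * ∑ j, 1 / (y k - x j) =
        -(b₁ * n ^ 2) := by
      have : b₁ * n ^ 2 = ∑ k : ι, ∑ j : ι, b₁ := by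
        simp only [Finset.sum_const, Finset.card_univ, nsmul_eq_mul]
        ring
      simp only [hs, Finset.mul_sum]
      rw [Finset.sum_comm, this, ← Finset.sum_sub_distrib, ← Finset.sum_neg_distrib]
      refine Finset.sum_congr rfl fun k _ => ?_
      rw [← Finset.sum_sub_distrib, ← Finset.sum_neg_distrib]
      refine Finset.sum_congr rfl fun j _ => ?_
      have := hxy j k
      field_simp
      ring
    simp only [logDer, mul_sub, Finset.sum_sub_distrib]
    linear_combination h₁ + h / 2
  have he : ∑ j, A (x j) * ∑ k, 1 / (y k - x j) ^ 2 =
      XY + Yp - ∑ k, A (y k) * logDerDer x y k := by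
    simp only [logDerDer, mul_sub, Finset.sum_sub_distrib, Finset.mul_sum, mul_one_div, hXY, hYp,
      sub_div]
    rw [Finset.sum_comm]
    ring
  have e₁ : ∀ j, A (x j) * (κ * (∑ k, 1 / (y k - x j) ^ 2) + κ ^ 2 * (s j) ^ 2) =
      κ * (A (x j) * ∑ k, 1 / (y k - x j) ^ 2) + κ ^ 2 * (A (x j) * s j ^ 2) := fun j => by ring
  have e₂ : ∀ j, (b₁ * x j + b₀) * (κ * s j) = κ * ((b₁ * x j + b₀) * s j) := fun j => by ring
  have e₃ : ∀ j, A (x j) * (κ * s j) * B j = κ * (A (x j) * (s j * B j)) := fun j => by ring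
  have e₄ : ∀ k, A (y k) * (κ ^ 2 * logDer x y k ^ 2 - κ * logDerDer x y k) -
        κ * (1 + κ) * (2 * a₂ * y k + a₁) * logDer x y k +
        κ * (b₁ * y k + b₀) * logDer x y k = κ ^ 2 * (A (y k) * logDer x y k ^ 2) -
        κ * (A (y k) * logDerDer x y k) - κ * (1 + κ) * ((2 * a₂ * y k + a₁) * logDer x y k) +
        κ * ((b₁ * y k + b₀) * logDer x y k) := fun k => by ring
  have e₅ : ∀ j, A (x j) * (B j + s j) ^ 2 =
      A (x j) * B j ^ 2 + 2 * (A (x j) * (s j * B j)) + A (x j) * s j ^ 2 := fun j => by ring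
  simp only [e₅, Finset.sum_add_distrib, ← Finset.mul_sum] at ha
  change ∑ j, A (x j) * (κ * (∑ k, 1 / (y k - x j) ^ 2) + κ ^ 2 * (s j) ^ 2) +
    ∑ j, (b₁ * x j + b₀) * (κ * s j) + 2 * κ * ∑ j, A (x j) * (κ * s j) * B j =
    ∑ k, (A (y k) * (κ ^ 2 * logDer x y k ^ 2 - κ * logDerDer x y k) -
        κ * (1 + κ) * (2 * a₂ * y k + a₁) * logDer x y k +
        κ * (b₁ * y k + b₀) * logDer x y k) - κ * (κ - 1) * Yp + _
  simp only [e₁, e₂, e₃, e₄, Finset.sum_add_distrib, Finset.sum_sub_distrib, ← Finset.mul_sum]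
  linear_combination κ ^ 2 * ha - κ ^ 2 * hb + κ * he + κ * hd + (κ ^ 2 + κ) * hc

end Rational

/-! ### The differential equation of the generating series -/

section Series

/-- The coefficients `2ν - p` with `ν = m + 1`. -/
def stepSeries (p : ℕ) : PowerSeries ℂ := PowerSeries.mk fun m => 2 * ((m + 1 : ℕ) : ℂ) - p

/-- The coefficient is (2 - p) + 2m, so the series is a combination of 1/(1 - X) and X/(1 - X)².
This closed form evaluates the sum over ν in the field. -/
theorem stepSeries_eq (p : ℕ) : stepSeries p = PowerSeries.C (2 - p : ℂ) * geomSeries 1 +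
    PowerSeries.C 2 * (PowerSeries.X * geomSeries 1 ^ 2) := by
  have h := one_sub_mul_geomSeries (1 : ℂ)
  rw [mul_comm] at h
  have h₁ := (PowerSeries.derivative ℂ).leibniz_of_mul_eq_one h
  simp only [map_one, one_mul, map_sub, Derivation.map_one_eq_zero, PowerSeries.derivative_X,
    smul_eq_mul] at h₁
  have h₂ : geomSeries (1 : ℂ) ^ 2 = PowerSeries.derivative ℂ (geomSeries 1) := by
    rw [h₁]
    ring
  rw [h₂]
  ext m
  rw [map_add, PowerSeries.coeff_C_mul, PowerSeries.coeff_C_mul]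
  rcases m with _ | m
  · simp [stepSeries, geomSeries]
  · rw [PowerSeries.coeff_succ_X_mul, PowerSeries.coeff_derivative]
    simp [stepSeries, geomSeries]
    ring

/-- The reduced operator, applied to the generating series. -/
def reducedSeries (κ : ℝ) (α β : ℂ[X]) (z : Fin N → ℂ) : MvPowerSeries (Fin N) ℂ :=
  ∑ j, MvPowerSeries.C (α.eval (z j)) * evalSeriesDD κ z j +
    ∑ j, MvPowerSeries.C (β.eval (z j)) * evalSeriesD κ z j +
    MvPowerSeries.C (2 * κ : ℂ) * ∑ j, ∑ k ∈ Finset.Ioi j, MvPowerSeries.C (z j - z k)⁻¹ *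
      (MvPowerSeries.C (α.eval (z j)) * evalSeriesD κ z j -
        MvPowerSeries.C (α.eval (z k)) * evalSeriesD κ z k)

/-- The operator `n_k`. -/
def nOp (k : Fin N) (G : MvPowerSeries (Fin N) ℂ) : MvPowerSeries (Fin N) ℂ :=
  weightDer (component ℂ k) G

/-- The operator `n_k^+`. -/
def shiftOp (κ : ℝ) (k : Fin N) (G : MvPowerSeries (Fin N) ℂ) : MvPowerSeries (Fin N) ℂ :=
  nOp k G + MvPowerSeries.C (κ * (N + 1 - (k + 1 : ℕ)) : ℂ) * G

theorem sum_Ioi_add {M : Type*} [AddCommMonoid M] (G : Fin N → Fin N → M) (h : ∀ j, G j j = 0) :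
    ∑ j, ∑ k ∈ Finset.Ioi j, (G j k + G k j) = ∑ j, ∑ k, G j k := by
  have h₁ : ∀ j : Fin N, Finset.Ioi j = Finset.univ.filter fun k => j < k := fun j => by
    ext k
    simp
  have h₂ : ∀ j k, G j k = (if j < k then G j k else 0) + if k < j then G j k else 0 := by
    intro j k
    rcases lt_trichotomy j k with hjk | hjk | hjk
    · rw [if_pos hjk, if_neg hjk.asymm, add_zero]
    · simp [hjk, h]
    · rw [if_neg hjk.asymm, if_pos hjk, zero_add]
  rw [Finset.sum_congr rfl fun j _ => Finset.sum_congr rfl fun k _ => h₂ j k]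
  simp only [h₁, Finset.sum_filter, Finset.sum_add_distrib]
  congr 1
  exact Finset.sum_comm

theorem sum_Ioi_sub_div {K : Type*} [Field K] (x G : Fin N → K) :
    ∑ j, ∑ k ∈ Finset.Ioi j, (G j - G k) / (x j - x k) = ∑ j, G j * ∑ k, 1 / (x j - x k) := by
  simp only [Finset.mul_sum]
  rw [← sum_Ioi_add (fun j k => G j * (1 / (x j - x k))) fun j => by simp]
  refine Finset.sum_congr rfl fun j _ => Finset.sum_congr rfl fun k _ => ?_
  rw [← neg_sub (x j) (x k), one_div, one_div, inv_neg]
  ring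

theorem sum_sub_val {K : Type*} [Field K] [CharZero K] (N : ℕ) :
    ∑ k : Fin N, ((N : K) - (k : ℕ)) = N * (N + 1) / 2 := by
  have h : ∀ n : ℕ, ∑ k ∈ Finset.range n, (k : K) = (n : K) * (n - 1) / 2 := by
    intro n
    induction n with
    | zero => simp
    | succ n ih =>
      rw [Finset.sum_range_succ, ih]
      push_cast
      ring
  rw [Fin.sum_univ_eq_sum_range (fun k : ℕ => (N : K) - k), Finset.sum_sub_distrib, h]
  simp
  ring

theorem sum_sub_val_sq {K : Type*} [Field K] [CharZero K] (N : ℕ) :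
    ∑ k : Fin N, ((N : K) - (k : ℕ)) ^ 2 = N * (N + 1) * (2 * N + 1) / 6 := by
  have h : ∀ n : ℕ, ∑ k ∈ Finset.range n, ((k : K) + 1) ^ 2 = (n : K) * (n + 1) * (2 * n + 1) / 6 := by
    intro n
    induction n with
    | zero => simp
    | succ n ih =>
      rw [Finset.sum_range_succ, ih]
      push_cast
      ring
  rw [Fin.sum_univ_eq_sum_range (fun k : ℕ => ((N : K) - k) ^ 2), ← h,
    ← Finset.sum_range_reflect]
  refine Finset.sum_congr rfl fun k hk => ?_
  have := Finset.mem_range.mp hk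
  rw [Nat.cast_sub (by omega), Nat.cast_sub (by omega)]
  push_cast
  ring

theorem eval_eq_of_natDegree_le_two {α : ℂ[X]} (hα : α.natDegree ≤ 2) (t : ℂ) :
    α.eval t = α.coeff 2 * t ^ 2 + α.coeff 1 * t + α.coeff 0 := by
  rw [Polynomial.eval_eq_sum_range' (Nat.lt_succ_of_le hα), Finset.sum_range_succ,
    Finset.sum_range_succ, Finset.sum_range_one]
  ring

theorem eval_eq_of_natDegree_le_one {β : ℂ[X]} (hβ : β.natDegree ≤ 1) (t : ℂ) :
    β.eval t = β.coeff 1 * t + β.coeff 0 := by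
  rw [Polynomial.eval_eq_sum_range' (Nat.lt_succ_of_le hβ), Finset.sum_range_succ,
    Finset.sum_range_one]
  ring

theorem map_C_shift {K : Type*} [Field K] (φ : MvPowerSeries (Fin N) ℂ →+* K) (κ : ℝ) (k : Fin N) :
    φ (MvPowerSeries.C (κ * (N + 1 - (k + 1 : ℕ)) : ℂ)) =
      φ (MvPowerSeries.C (κ : ℂ)) * ((N : K) - (k : ℕ)) := by
  simp only [map_mul, map_sub, map_add, map_natCast, map_one, Nat.cast_add, Nat.cast_one]
  ring

theorem nOp_shiftOp (κ : ℝ) (k : Fin N) (G : MvPowerSeries (Fin N) ℂ) :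
    nOp k (shiftOp κ k G) = nOp k (nOp k G) +
      MvPowerSeries.C (κ * (N + 1 - (k + 1 : ℕ)) : ℂ) * nOp k G := by
  simp only [shiftOp, nOp, map_add, ← MvPowerSeries.smul_eq_C_mul]
  rw [Derivation.map_smul]

/-- The operators n_k and n_k^+ are translated into `logDer` and `logDerDer`, after which
`kernel_identity` applies. The remaining constants agree by the formulas for ∑ (N - k) and ∑ (N -
k)². -/
theorem reducedSeries_field {K : Type*} [Field K] [CharZero K]
    (φ : MvPowerSeries (Fin N) ℂ →+* K) (hφ : Function.Injective φ)
    (κ : ℝ) (α β : ℂ[X]) (hα : α.natDegree ≤ 2) (hβ : β.natDegree ≤ 1)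
    (z : Fin N → ℂ) (hz : Function.Injective z) :
    φ (reducedSeries κ α β z) = φ (∑ k, (MvPowerSeries.C (α.coeff 2) * (nOp k (nOp k (genSeries κ z)) +
          MvPowerSeries.C (2 * κ * (N - (k + 1 : ℕ)) - 1 : ℂ) * nOp k (genSeries κ z)) +
        MvPowerSeries.C (β.coeff 1) * nOp k (genSeries κ z)) +
      ∑ k, (MvPowerSeries.C (α.coeff 0) * (yInv ℂ k ^ 2 *
          (shiftOp κ k (shiftOp κ k (genSeries κ z)) + shiftOp κ k (genSeries κ z))) +
        yInv ℂ k * (MvPowerSeries.C (α.coeff 1) * (shiftOp κ k (shiftOp κ k (genSeries κ z)) -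
          MvPowerSeries.C (κ : ℂ) * shiftOp κ k (genSeries κ z)) +
          MvPowerSeries.C (β.coeff 0) * shiftOp κ k (genSeries κ z))) -
      ∑ jk : Pairs N, ∑ p : Fin 3, MvPowerSeries.C (κ * (κ - 1) * α.coeff p : ℂ) *
        (monoSubst (tExp jk.1.1 jk.1.2) (tExp_ne_zero jk.2) (stepSeries p) *
          (yInv ℂ jk.1.2 ^ (2 - (p : ℕ)) * genSeries κ z))) := by
  set P := φ (genSeries κ z) with hP
  set x := xElem φ z with hx
  set y : Fin N → K := yElem φ with hy
  set q := φ (MvPowerSeries.C (κ : ℂ)) with hq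
  set a₂ := φ (MvPowerSeries.C (α.coeff 2)) with ha₂
  set a₁ := φ (MvPowerSeries.C (α.coeff 1)) with ha₁
  set a₀ := φ (MvPowerSeries.C (α.coeff 0)) with ha₀
  set b₁ := φ (MvPowerSeries.C (β.coeff 1)) with hb₁
  set b₀ := φ (MvPowerSeries.C (β.coeff 0)) with hb₀
  have hinj : Function.Injective x := fun j k h => hz (MvPowerSeries.C_injective (hφ h))
  have hyinj : Function.Injective y := fun j k h => by
    by_contra hjk
    exact yElem_sub_yElem_ne_zero φ hφ hjk (sub_eq_zero.mpr h.symm)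
  have hy₀ : ∀ k, y k ≠ 0 := yElem_ne_zero φ hφ
  have hα' : ∀ j, φ (MvPowerSeries.C (α.eval (z j))) = a₂ * x j ^ 2 + a₁ * x j + a₀ := fun j => by
    rw [eval_eq_of_natDegree_le_two hα]
    simp only [map_add, map_mul, map_pow]
    rfl
  have hβ' : ∀ j, φ (MvPowerSeries.C (β.eval (z j))) = b₁ * x j + b₀ := fun j => by
    rw [eval_eq_of_natDegree_le_one hβ]
    simp only [map_add, map_mul]
    rfl
  have hid := kernel_identity q a₂ a₁ a₀ b₁ b₀ hinj hyinj
    (fun j k => yElem_sub_xElem_ne_zero φ z hφ j k)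
  have hlhs : φ (reducedSeries κ α β z) =
      (∑ j, (a₂ * x j ^ 2 + a₁ * x j + a₀) *
          (q * (∑ k, 1 / (y k - x j) ^ 2) + q ^ 2 * (∑ k, 1 / (y k - x j)) ^ 2) +
        ∑ j, (b₁ * x j + b₀) * (q * ∑ k, 1 / (y k - x j)) +
        2 * q * ∑ j, (a₂ * x j ^ 2 + a₁ * x j + a₀) * (q * ∑ k, 1 / (y k - x j)) *
          ∑ k, 1 / (x j - x k)) * P := by
    have h : ∀ j k, φ (MvPowerSeries.C (z j - z k)⁻¹) = (x j - x k)⁻¹ := fun j k => by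
      change ((φ.comp MvPowerSeries.C) (z j - z k)⁻¹) = _
      rw [map_inv₀, map_sub]
      rfl
    rw [reducedSeries, map_add, map_add, map_mul, map_sum, map_sum, map_sum]
    simp only [map_sum, map_mul, map_sub, hα', hβ', h, field_evalSeriesDD φ κ z hφ,
      field_evalSeriesD φ κ z hφ, map_ofNat]
    simp only [← hP, ← hx, ← hy, ← hq, inv_mul_eq_div]
    rw [sum_Ioi_sub_div, add_mul, add_mul, Finset.sum_mul, Finset.sum_mul, mul_assoc (2 * q),
      Finset.sum_mul]
    congr 1
    · congr 1
      · exact Finset.sum_congr rfl fun j _ => by ring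
      · exact Finset.sum_congr rfl fun j _ => by ring
    · congr 1
      exact Finset.sum_congr rfl fun j _ => by ring
  have hdiag : ∀ k, φ (MvPowerSeries.C (α.coeff 2) * (nOp k (nOp k (genSeries κ z)) +
          MvPowerSeries.C (2 * κ * (N - (k + 1 : ℕ)) - 1 : ℂ) * nOp k (genSeries κ z)) +
        MvPowerSeries.C (β.coeff 1) * nOp k (genSeries κ z)) +
      φ (MvPowerSeries.C (α.coeff 0) * (yInv ℂ k ^ 2 *
          (shiftOp κ k (shiftOp κ k (genSeries κ z)) + shiftOp κ k (genSeries κ z))) +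
        yInv ℂ k * (MvPowerSeries.C (α.coeff 1) * (shiftOp κ k (shiftOp κ k (genSeries κ z)) -
          MvPowerSeries.C (κ : ℂ) * shiftOp κ k (genSeries κ z)) +
          MvPowerSeries.C (β.coeff 0) * shiftOp κ k (genSeries κ z))) =
      ((a₂ * y k ^ 2 + a₁ * y k + a₀) * (q ^ 2 * logDer x y k ^ 2 - q * logDerDer x y k) -
        q * (1 + q) * (2 * a₂ * y k + a₁) * logDer x y k +
        q * (b₁ * y k + b₀) * logDer x y k) * P +
      ((a₂ * (1 + 2 * q) - b₁) * q * ((N : K) - (k : ℕ)) -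
        a₂ * q ^ 2 * ((N : K) - (k : ℕ)) ^ 2) * P := by
    intro k
    have e₁ := field_weightDer φ κ z hφ k
    have e₂ := field_weightDer_weightDer φ κ z hφ k _ rfl
    change φ (nOp k (genSeries κ z)) + _ = _ at e₁
    change φ (nOp k (nOp k (genSeries κ z))) + _ * φ (nOp k (genSeries κ z)) + _ = _ at e₂
    have e₃ : shiftOp κ k (shiftOp κ k (genSeries κ z)) = nOp k (nOp k (genSeries κ z)) +
        MvPowerSeries.C (κ * (N + 1 - (k + 1 : ℕ)) : ℂ) * nOp k (genSeries κ z) +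
        MvPowerSeries.C (κ * (N + 1 - (k + 1 : ℕ)) : ℂ) * shiftOp κ k (genSeries κ z) := by
      rw [← nOp_shiftOp]
      rfl
    have e₄ : φ (MvPowerSeries.C (2 * κ * (N - (k + 1 : ℕ)) - 1 : ℂ)) =
        2 * (q * ((N : K) - (k : ℕ))) - 2 * q - 1 := by
      simp only [map_mul, map_sub, map_natCast, map_one, map_ofNat, Nat.cast_add, Nat.cast_one,
        map_add, ← hq]
      ring
    rw [e₃]
    have e₅ : φ (shiftOp κ k (genSeries κ z)) = φ (nOp k (genSeries κ z)) +
        q * ((N : K) - (k : ℕ)) * P := by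
      rw [shiftOp, map_add, map_mul, map_C_shift]
    simp only [map_add φ, map_mul φ, map_sub φ, map_pow φ, map_C_shift φ κ k, e₄, e₅, yInv_eq φ,
      ← hP, ← hx, ← hy, ← hq, ← ha₂, ← ha₁, ← ha₀, ← hb₁, ← hb₀] at e₁ e₂ ⊢
    -- The terms with α_0 and α_1 carry y_k^{-2} and y_k^{-1}. The combination below uses n^+(n^+ +
    -- 1) - (1 + κ) n^+ = n^+(n^+ - κ) for α_1, and n^+(n^+ + 1) - (2κ + 2) n^+ for α_2, which
    -- differs from the diagonal part by a constant.
    have e₆ := congrArg (fun t => (y k)⁻¹ * t) e₁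
    have e₇ := congrArg (fun t => (y k)⁻¹ ^ 2 * t) e₂
    have e₈ := congrArg (fun t => (y k)⁻¹ * t) e₂
    have hyk : (y k)⁻¹ * y k = 1 := inv_mul_cancel₀ (hy₀ k)
    beta_reduce at e₆ e₇ e₈
    linear_combination a₂ * (e₂ - (2 * q + 2) * e₁) + b₁ * e₁ + a₀ * e₇ +
      a₁ * (e₈ - (1 + q) * e₆) + b₀ * e₆ + (b₀ - a₁ * (1 + q)) * q * logDer x y k * P * hyk +
      (q ^ 2 * logDer x y k ^ 2 - q * logDerDer x y k) * P *
        (a₀ * ((y k)⁻¹ * y k + 1) + a₁ * y k) * hyk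
  -- Summed over ν and p, the off-diagonal steps form the two-body potential in y, up to `a₂`: for p
  -- = 2 the series gives 2 y_j y_k/(y_j - y_k)² = (y_j² + y_k²)/(y_j - y_k)² - 1.
  have hoff : ∀ jk : Pairs N, φ (∑ p : Fin 3, MvPowerSeries.C (κ * (κ - 1) * α.coeff p : ℂ) *
        (monoSubst (tExp jk.1.1 jk.1.2) (tExp_ne_zero jk.2) (stepSeries p) *
          (yInv ℂ jk.1.2 ^ (2 - (p : ℕ)) * genSeries κ z))) =
      q * (q - 1) * P * (((a₂ * y jk.1.1 ^ 2 + a₁ * y jk.1.1 + a₀) / (y jk.1.1 - y jk.1.2) ^ 2 +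
        (a₂ * y jk.1.2 ^ 2 + a₁ * y jk.1.2 + a₀) / (y jk.1.2 - y jk.1.1) ^ 2) - a₂) := by
    intro jk
    have h₁ := yElem_sub_yElem_ne_zero φ hφ jk.2.ne
    have h₂ := hy₀ jk.1.2
    have hstep : ∀ p : ℕ, φ (monoSubst (tExp jk.1.1 jk.1.2) (tExp_ne_zero jk.2) (stepSeries p)) =
        (2 - p) * (y jk.1.2 / (y jk.1.2 - y jk.1.1)) +
          2 * (y jk.1.1 / y jk.1.2 * (y jk.1.2 / (y jk.1.2 - y jk.1.1)) ^ 2) := by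
      intro p
      rw [stepSeries_eq, map_add (monoSubst _ _), map_mul (monoSubst _ _), map_mul (monoSubst _ _),
        map_mul (monoSubst _ _), map_pow, monoSubst_C, monoSubst_C, monoSubst_X]
      change φ (_ * yGeom ℂ jk + _ * (ratio ℂ jk * yGeom ℂ jk ^ 2)) = _
      simp only [map_add, map_mul, map_pow, map_sub, map_ofNat, map_natCast, yGeom_eq φ hφ,
        ratio_eq φ hφ]
      rfl
    rw [Fin.sum_univ_three]
    simp only [map_add φ, map_mul φ, map_pow φ, hstep, yInv_eq φ]
    simp only [map_mul, map_sub, map_one, ← hq, Fin.val_zero, Fin.val_one, Fin.val_two, ← ha₀,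
      ← ha₁, ← ha₂, ← hP, ← hy]
    change y jk.1.2 - y jk.1.1 ≠ 0 at h₁
    rw [← neg_sub (y jk.1.2) (y jk.1.1), neg_sq]
    push_cast
    field_simp
    ring
  rw [hlhs, hid, map_sub, map_add, map_sum, map_sum, map_sum, ← Finset.sum_add_distrib,
    Finset.sum_congr rfl fun k _ => hdiag k, Finset.sum_congr rfl fun jk _ => hoff jk]
  rw [sum_pairs fun j k => q * (q - 1) * P * (((a₂ * y j ^ 2 + a₁ * y j + a₀) / (y j - y k) ^ 2 +
        (a₂ * y k ^ 2 + a₁ * y k + a₀) / (y k - y j) ^ 2) - a₂)]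
  have hIoi : ∀ g : Fin N → Fin N → K, ∑ j, ∑ k, (if j < k then g j k else 0) =
      ∑ j, ∑ k ∈ Finset.Ioi j, g j k := fun g => by
    refine Finset.sum_congr rfl fun j _ => ?_
    rw [← Finset.sum_filter]
    congr 1
    ext k
    simp
  have hcount : ∑ j : Fin N, ∑ k ∈ Finset.Ioi j, a₂ = a₂ * (N * (N - 1)) / 2 := by
    have := sum_sub_val (K := K) N
    have h : ∀ j : Fin N, ∑ k ∈ Finset.Ioi j, a₂ = a₂ * ((N : K) - (j : ℕ)) - a₂ := by
      intro j
      have hj := j.2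
      rw [Finset.sum_const, Fin.card_Ioi, nsmul_eq_mul, Nat.cast_sub (by omega),
        Nat.cast_sub (by omega)]
      push_cast
      ring
    rw [Finset.sum_congr rfl fun j _ => h j, Finset.sum_sub_distrib, ← Finset.mul_sum, this]
    simp
    ring
  rw [hIoi]
  simp only [← Finset.mul_sum, Finset.sum_sub_distrib, Finset.sum_add_distrib, ← Finset.sum_mul,
    hcount, sum_sub_val_sq, Fintype.card_fin]
  have hpair := sum_Ioi_add (fun j k => (a₂ * y j ^ 2 + a₁ * y j + a₀) / (y j - y k) ^ 2)
    (fun j => by simp)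
  simp only [Finset.sum_add_distrib] at hpair
  have hs := sum_sub_val (K := K) N
  rw [Finset.sum_sub_distrib] at hs
  rw [hpair]
  linear_combination -(P * q * (a₂ * (1 + 2 * q) - b₁)) * hs

/-- Power series over ℂ form a domain, so the identity may be tested in the fraction field. -/
theorem reducedSeries_eq (κ : ℝ) (α β : ℂ[X]) (hα : α.natDegree ≤ 2) (hβ : β.natDegree ≤ 1)
    (z : Fin N → ℂ) (hz : Function.Injective z) :
    reducedSeries κ α β z =
      ∑ k, (MvPowerSeries.C (α.coeff 2) * (nOp k (nOp k (genSeries κ z)) +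
          MvPowerSeries.C (2 * κ * (N - (k + 1 : ℕ)) - 1 : ℂ) * nOp k (genSeries κ z)) +
        MvPowerSeries.C (β.coeff 1) * nOp k (genSeries κ z)) +
      ∑ k, (MvPowerSeries.C (α.coeff 0) * (yInv ℂ k ^ 2 *
          (shiftOp κ k (shiftOp κ k (genSeries κ z)) + shiftOp κ k (genSeries κ z))) +
        yInv ℂ k * (MvPowerSeries.C (α.coeff 1) * (shiftOp κ k (shiftOp κ k (genSeries κ z)) -
          MvPowerSeries.C (κ : ℂ) * shiftOp κ k (genSeries κ z)) +
          MvPowerSeries.C (β.coeff 0) * shiftOp κ k (genSeries κ z))) -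
      ∑ jk : Pairs N, ∑ p : Fin 3, MvPowerSeries.C (κ * (κ - 1) * α.coeff p : ℂ) *
        (monoSubst (tExp jk.1.1 jk.1.2) (tExp_ne_zero jk.2) (stepSeries p) *
          (yInv ℂ jk.1.2 ^ (2 - (p : ℕ)) * genSeries κ z)) := by
  have : IsDomain (MvPowerSeries (Fin N) ℂ) := NoZeroDivisors.to_isDomain _
  have hφ := IsFractionRing.injective (MvPowerSeries (Fin N) ℂ)
    (FractionRing (MvPowerSeries (Fin N) ℂ))
  have : CharZero (FractionRing (MvPowerSeries (Fin N) ℂ)) := charZero_of_injective_ringHom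
    (f := (algebraMap (MvPowerSeries (Fin N) ℂ) _).comp MvPowerSeries.C)
    (hφ.comp MvPowerSeries.C_injective)
  exact hφ (reducedSeries_field _ hφ κ α β hα hβ z hz)

end Series

/-! ### Coefficients in terms of integer vectors -/

section Coefficients

open Classical in
/-- The coefficient of `y^{-n}`. -/
def coeffAt (n : Fin N → ℤ) : MvPowerSeries (Fin N) ℂ →ₗ[ℂ] ℂ :=
  if 0 ≤ tail n then MvPowerSeries.coeff (tailExp n) else 0

theorem coeffAt_of_nonneg {n : Fin N → ℤ} (hn : 0 ≤ tail n) (G : MvPowerSeries (Fin N) ℂ) :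
    coeffAt n G = MvPowerSeries.coeff (tailExp n) G := by
  rw [coeffAt, if_pos hn]

theorem coeffAt_of_not {n : Fin N → ℤ} (hn : ¬ 0 ≤ tail n) (G : MvPowerSeries (Fin N) ℂ) :
    coeffAt n G = 0 := by
  rw [coeffAt, if_neg hn, LinearMap.zero_apply]

theorem coeffAt_C_mul (n : Fin N → ℤ) (c : ℂ) (G : MvPowerSeries (Fin N) ℂ) :
    coeffAt n (MvPowerSeries.C c * G) = c * coeffAt n G := by
  rw [← MvPowerSeries.smul_eq_C_mul, map_smul, smul_eq_mul]

theorem coeffAt_nOp (n : Fin N → ℤ) (k : Fin N) (G : MvPowerSeries (Fin N) ℂ) :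
    coeffAt n (nOp k G) = n k * coeffAt n G := by
  by_cases hn : 0 ≤ tail n
  · rw [coeffAt_of_nonneg hn, coeffAt_of_nonneg hn, nOp, coeff_weightDer, component_tailExp ℂ hn]
  · rw [coeffAt_of_not hn, coeffAt_of_not hn, mul_zero]

theorem coeffAt_shiftOp (κ : ℝ) (n : Fin N → ℤ) (k : Fin N) (G : MvPowerSeries (Fin N) ℂ) :
    coeffAt n (shiftOp κ k G) = shift κ n k * coeffAt n G := by
  rw [shiftOp, map_add, coeffAt_nOp, coeffAt_C_mul, shift]
  ring

theorem coeffAt_monomial_mul (n v : Fin N → ℤ) (hv : 0 ≤ tail v) (G : MvPowerSeries (Fin N) ℂ) :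
    coeffAt n (MvPowerSeries.monomial (tailExp v) 1 * G) = coeffAt (n - v) G := by
  by_cases hn : 0 ≤ tail n
  · rw [coeffAt_of_nonneg hn, MvPowerSeries.coeff_monomial_mul, one_mul]
    by_cases hnv : 0 ≤ tail (n - v)
    · have h : tailExp n = tailExp (n - v) + tailExp v := by
        rw [← tailExp_add hnv hv, sub_add_cancel]
      rw [h, if_pos le_add_self, add_tsub_cancel_right, coeffAt_of_nonneg hnv]
    · rw [coeffAt_of_not hnv, if_neg]
      intro h
      refine hnv fun i => ?_
      have := Int.ofNat_le.mpr (h i)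
      rw [natCast_tailExp hv, natCast_tailExp hn] at this
      change 0 ≤ tail (n - v) i
      rw [map_sub, Pi.sub_apply]
      omega
  -- Subtracting `v`, whose tail sums are nonnegative, cannot repair a negative tail sum of `n`.
  · rw [coeffAt_of_not hn, coeffAt_of_not]
    intro h
    refine hn fun i => ?_
    have h₁ : 0 ≤ tail (n - v) i := h i
    have h₂ : 0 ≤ tail v i := hv i
    change 0 ≤ tail n i
    rw [map_sub, Pi.sub_apply] at h₁
    omega

theorem coeffAt_genSeries (κ : ℝ) (z : Fin N → ℂ) (n : Fin N → ℤ) :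
    coeffAt n (genSeries κ z) = MvPolynomial.eval z (f κ n) := by
  by_cases hn : 0 ≤ tail n
  · rw [coeffAt_of_nonneg hn, ← map_eval_genSeries, MvPowerSeries.coeff_map, coeff_genSeries κ hn]
  · rw [coeffAt_of_not hn, f_eq_zero hn, map_zero]

theorem coeffAt_reducedSeries (κ : ℝ) (α β : ℂ[X]) (z : Fin N → ℂ) (n : Fin N → ℤ) :
    coeffAt n (reducedSeries κ α β z) = reducedOp κ α β (f κ n) z := by
  have h₁ : ∀ j, coeffAt n (evalSeriesD κ z j) =
      MvPolynomial.eval z (MvPolynomial.pderiv j (f κ n)) := by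
    intro j
    by_cases hn : 0 ≤ tail n
    · rw [coeffAt_of_nonneg hn, evalSeriesD, MvPowerSeries.coeff_map, coeff_coeffDer,
        coeff_genSeries κ hn]
    · rw [coeffAt_of_not hn, f_eq_zero hn, map_zero, map_zero]
  have h₂ : ∀ j, coeffAt n (evalSeriesDD κ z j) =
      MvPolynomial.eval z (MvPolynomial.pderiv j (MvPolynomial.pderiv j (f κ n))) := by
    intro j
    by_cases hn : 0 ≤ tail n
    · rw [coeffAt_of_nonneg hn, evalSeriesDD, MvPowerSeries.coeff_map, coeff_coeffDer,
        coeff_coeffDer, coeff_genSeries κ hn]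
    · rw [coeffAt_of_not hn, f_eq_zero hn, map_zero, map_zero, map_zero]
  simp only [reducedSeries, map_add, map_sum, coeffAt_C_mul, map_sub, h₁, h₂, reducedOp,
    div_eq_inv_mul]

theorem coeffAt_yInv_pow_mul (n : Fin N → ℤ) (k : Fin N) (r : ℕ) (G : MvPowerSeries (Fin N) ℂ) :
    coeffAt n (yInv ℂ k ^ r * G) = coeffAt (n - r • Pi.single k 1) G := by
  induction r generalizing n with
  | zero => simp
  | succ r ih =>
    rw [pow_succ', mul_assoc, yInv, yExp_eq, coeffAt_monomial_mul, ← yExp_eq, ← yInv, ih]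
    · congr 1
      rw [succ_nsmul, sub_sub, add_comm]
    · intro i
      rw [tail_single_one]
      positivity

theorem coeffAt_ratio_mul (n : Fin N → ℤ) (jk : Pairs N) (m : ℕ) (G : MvPowerSeries (Fin N) ℂ) :
    coeffAt n (MvPowerSeries.monomial (m • tExp jk.1.1 jk.1.2) 1 * G) =
      coeffAt (n - m • (Pi.single jk.1.2 1 - Pi.single jk.1.1 1)) G := by
  induction m generalizing n with
  | zero => simp
  | succ m ih =>
    have : (MvPowerSeries.monomial ((m + 1) • tExp jk.1.1 jk.1.2) (1 : ℂ)) =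
        MvPowerSeries.monomial (tExp jk.1.1 jk.1.2) 1 *
          MvPowerSeries.monomial (m • tExp jk.1.1 jk.1.2) 1 := by
      rw [MvPowerSeries.monomial_mul_monomial, succ_nsmul', one_mul]
    rw [this, mul_assoc, tExp_eq jk.2, coeffAt_monomial_mul, ← tExp_eq jk.2, ih]
    · congr 1
      rw [succ_nsmul _ m, sub_sub, add_comm]
    · intro i
      rw [tail_single_sub_single jk.2]
      positivity

/-- The m-th power of y_j/y_k contains u_k^m, and u_k occurs in y^{-n} with exponent `tail n k < B`;
all terms with m ≥ B drop out. -/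
theorem coeffAt_monoSubst_mul (n : Fin N → ℤ) (jk : Pairs N) (c : PowerSeries ℂ) (B : ℕ)
    (hB : ∀ i, tail n i < B) (G : MvPowerSeries (Fin N) ℂ) :
    coeffAt n (monoSubst (tExp jk.1.1 jk.1.2) (tExp_ne_zero jk.2) c * G) =
      ∑ m ∈ Finset.range B, PowerSeries.coeff m c *
        coeffAt (n - m • (Pi.single jk.1.2 1 - Pi.single jk.1.1 1)) G := by
  simp only [← coeffAt_ratio_mul]
  by_cases hn : 0 ≤ tail n
  · simp only [coeffAt_of_nonneg hn]
    refine coeff_monoSubst_mul _ _ _ _ _ _ fun h => ?_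
    have h₁ := Int.ofNat_le.mpr (h jk.1.2)
    rw [natCast_tailExp hn, Finsupp.smul_apply, tExp_apply, if_pos ⟨jk.2, le_rfl⟩] at h₁
    have h₂ := hB jk.1.2
    simp only [smul_eq_mul, mul_one] at h₁
    omega
  · simp only [coeffAt_of_not hn, mul_zero, Finset.sum_const_zero]

end Coefficients

/-! ### The action of the reduced operator on `f_n` -/

/-- The step with indices `j < k`, `p` and `ν = m + 1`. -/
def offStep (jk : Pairs N) (p : Fin 3) (m : ℕ) : Step N :=
  ⟨jk.1.1, jk.1.2, p, m + 1, jk.2.le, Nat.le_add_left _ _⟩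

/-- The step with indices `k = k`, `p` and `ν = m + 1`. -/
def diagStep (k : Fin N) (p : Fin 3) (m : ℕ) : Step N :=
  ⟨k, k, p, m + 1, le_rfl, Nat.le_add_left _ _⟩

/-- Steps as quadruples. -/
def stepEquiv : (Pairs N × Fin 3 × ℕ) ⊕ (Fin N × Fin 3 × ℕ) ≃ Step N :=
  Equiv.ofBijective
    (Sum.elim (fun x => offStep x.1 x.2.1 x.2.2) (fun x => diagStep x.1 x.2.1 x.2.2)) <| by
    constructor
    · rintro (⟨⟨⟨j, k⟩, h⟩, p, m⟩ | ⟨k, p, m⟩) (⟨⟨⟨j', k'⟩, h'⟩, p', m'⟩ | ⟨k', p', m'⟩) e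
      · simp only [Sum.elim_inl, offStep, Step.mk.injEq, Nat.add_right_cancel_iff] at e
        obtain ⟨rfl, rfl, rfl, rfl⟩ := e
        rfl
      · simp only [Sum.elim_inl, Sum.elim_inr, offStep, diagStep, Step.mk.injEq] at e
        obtain ⟨rfl, rfl, -, -⟩ := e
        exact absurd h (lt_irrefl _)
      · simp only [Sum.elim_inl, Sum.elim_inr, offStep, diagStep, Step.mk.injEq] at e
        obtain ⟨rfl, rfl, -, -⟩ := e
        exact absurd h' (lt_irrefl _)
      · simp only [Sum.elim_inr, diagStep, Step.mk.injEq, Nat.add_right_cancel_iff] at e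
        obtain ⟨rfl, -, rfl, rfl⟩ := e
        rfl
    · rintro ⟨j, k, p, ν, h, hν⟩
      obtain ⟨m, rfl⟩ := Nat.exists_eq_add_of_le' hν
      rcases h.lt_or_eq with h | rfl
      · exact ⟨Sum.inl (⟨(j, k), h⟩, p, m), rfl⟩
      · exact ⟨Sum.inr (j, p, m), rfl⟩

theorem stepEquiv_inl (x : Pairs N × Fin 3 × ℕ) :
    stepEquiv (Sum.inl x) = offStep x.1 x.2.1 x.2.2 := rfl

theorem stepEquiv_inr (x : Fin N × Fin 3 × ℕ) :
    stepEquiv (Sum.inr x) = diagStep x.1 x.2.1 x.2.2 := rfl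

theorem offStep_E (jk : Pairs N) (p : Fin 3) (m : ℕ) : (offStep jk p m).E =
    m • (Pi.single jk.1.2 1 - Pi.single jk.1.1 1) + (2 - (p : ℕ)) • Pi.single jk.1.2 1 := by
  have hp : (p : ℕ) ≤ 2 := by omega
  funext i
  simp only [Step.E, offStep, Pi.add_apply, Pi.smul_apply, Pi.sub_apply, Pi.single_apply]
  simp only [nsmul_eq_mul, Nat.cast_sub hp]
  push_cast
  split_ifs <;> ring

theorem diagStep_E (k : Fin N) (p : Fin 3) :
    (diagStep k p 0).E = (2 - (p : ℕ)) • Pi.single k 1 := by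
  have hp : (p : ℕ) ≤ 2 := by omega
  funext i
  simp only [Step.E, diagStep, Pi.add_apply, Pi.smul_apply, Pi.single_apply]
  simp only [nsmul_eq_mul, Nat.cast_sub hp]
  push_cast
  split_ifs <;> ring

theorem offStep_g (κ : ℝ) (α β : ℂ[X]) (jk : Pairs N) (p : Fin 3) (m : ℕ) (n : Fin N → ℤ) :
    (offStep jk p m).g κ α β n = κ * (κ - 1) * α.coeff p * PowerSeries.coeff m (stepSeries p) := by
  have h : jk.1.1 ≠ jk.1.2 := jk.2.ne
  simp [Step.g, offStep, h, stepSeries]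

theorem diagStep_g_zero (κ : ℝ) (α β : ℂ[X]) (k : Fin N) (p : Fin 3) (n : Fin N → ℤ) :
    (diagStep k p 0).g κ α β n = -(shift κ n k *
        ((if p = 0 then α.coeff 0 * (shift κ n k + 1) else 0) +
          (if p = 1 then α.coeff 1 * (shift κ n k - κ) + β.coeff 0 else 0))) := by
  simp [Step.g, diagStep]

theorem diagStep_g_succ (κ : ℝ) (α β : ℂ[X]) (k : Fin N) (p : Fin 3) (m : ℕ) (n : Fin N → ℤ) :
    (diagStep k p (m + 1)).g κ α β n = 0 := by
  simp [Step.g, diagStep]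

theorem f_sub_offStep_eq_zero {κ : ℝ} {n : Fin N → ℤ} {jk : Pairs N} {p : Fin 3} {m : ℕ}
    (hm : tail n jk.1.2 < m) : f κ (n - (offStep jk p m).E) = 0 := by
  refine f_eq_zero fun h => ?_
  have h₁ : 0 ≤ tail (n - (offStep jk p m).E) jk.1.2 := h jk.1.2
  rw [offStep_E, map_sub, map_add, map_nsmul, map_nsmul, Pi.sub_apply, Pi.add_apply, Pi.smul_apply,
    Pi.smul_apply, tail_single_sub_single jk.2, tail_single_one, tExp_apply, yExp_apply,
    if_pos ⟨jk.2, le_rfl⟩, if_pos le_rfl] at h₁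
  simp only [nsmul_eq_mul] at h₁
  push_cast at h₁
  omega

/-- The support of the expansion of the reduced operator on `f_n` lies in this finite set. -/
def stepIndices (N B : ℕ) : Finset ((Pairs N × Fin 3 × ℕ) ⊕ (Fin N × Fin 3 × ℕ)) :=
  (Finset.univ ×ˢ Finset.univ ×ˢ Finset.range B).disjSum
    (Finset.univ ×ˢ Finset.univ ×ˢ Finset.range 1)

theorem support_step_subset (κ : ℝ) (α β : ℂ[X]) (n : Fin N → ℤ) (B : ℕ) (hB : ∀ i, tail n i < B)
    (z : Fin N → ℂ) :
    (Function.support fun x => (stepEquiv x).g κ α β (n - (stepEquiv x).E) *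
      MvPolynomial.eval z (f κ (n - (stepEquiv x).E))) ⊆ stepIndices N B := by
  rintro (⟨jk, p, m⟩ | ⟨k, p, m⟩) hx
  · simp only [stepIndices, Finset.mem_coe, Finset.inl_mem_disjSum, Finset.mem_product,
      Finset.mem_univ, true_and, Finset.mem_range]
    by_contra hm
    refine hx ?_
    beta_reduce
    have hlt : tail n jk.1.2 < (m : ℤ) := by
      have := hB jk.1.2
      omega
    rw [stepEquiv_inl, f_sub_offStep_eq_zero hlt, map_zero, mul_zero]
  · simp only [stepIndices, Finset.mem_coe, Finset.inr_mem_disjSum, Finset.mem_product,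
      Finset.mem_univ, true_and, Finset.mem_range]
    rcases m with _ | m
    · exact one_pos
    · refine absurd ?_ hx
      beta_reduce
      rw [stepEquiv_inr, diagStep_g_succ, zero_mul]

theorem exists_tail_lt (n : Fin N → ℤ) : ∃ B : ℕ, ∀ i, tail n i < B := by
  refine ⟨(∑ i, (tail n i).toNat) + 1, fun i => ?_⟩
  have := Finset.single_le_sum (f := fun i => (tail n i).toNat) (fun _ _ => Nat.zero_le _)
    (Finset.mem_univ i)
  beta_reduce at this
  omega

/-- This is the coefficient of y^{-n} in `reducedSeries_eq`. Multiplication by y^{-E} shifts the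
index, which is why `g` is evaluated at n - E: the operators n^+ act before the shift. -/
theorem reducedOp_f (κ : ℝ) (α β : ℂ[X]) (hα : α.natDegree ≤ 2) (hβ : β.natDegree ≤ 1)
    (n : Fin N → ℤ) (z : Fin N → ℂ) (hz : Function.Injective z) :
    reducedOp κ α β (f κ n) z = -energy κ α β n * MvPolynomial.eval z (f κ n) -
      ∑ᶠ s : Step N, s.g κ α β (n - s.E) * MvPolynomial.eval z (f κ (n - s.E)) := by
  obtain ⟨B, hB⟩ := exists_tail_lt n
  rw [← finsum_comp_equiv stepEquiv,
    finsum_eq_sum_of_support_subset _ (support_step_subset κ α β n B hB z), stepIndices,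
    Finset.sum_disjSum]
  simp only [Finset.sum_product, Finset.range_one, Finset.sum_singleton, stepEquiv_inl,
    stepEquiv_inr, offStep_g, offStep_E, diagStep_g_zero, diagStep_E]
  have h := congrArg (coeffAt n) (reducedSeries_eq κ α β hα hβ z hz)
  rw [coeffAt_reducedSeries] at h
  rw [h, map_sub, map_add, map_sum, map_sum, map_sum]
  simp only [map_add (coeffAt _), coeffAt_C_mul, coeffAt_nOp, coeffAt_yInv_pow_mul, map_sum,
    coeffAt_monoSubst_mul n _ _ B hB, coeffAt_genSeries, coeffAt_shiftOp]
  have e₁ : ∀ (k : Fin N) G, coeffAt n (yInv ℂ k * G) = coeffAt (n - 1 • Pi.single k 1) G := by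
    intro k G
    rw [← coeffAt_yInv_pow_mul, pow_one]
  simp only [e₁, map_add (coeffAt _), map_sub (coeffAt _), coeffAt_C_mul, coeffAt_shiftOp,
    coeffAt_genSeries]
  rw [add_comm (∑ jk : Pairs N, _) (∑ k : Fin N, _), ← sub_sub]
  congr 1
  · rw [sub_eq_add_neg]
    congr 1
    · rw [energy, neg_neg, Finset.sum_mul]
      exact Finset.sum_congr rfl fun k _ => by ring
    · rw [← Finset.sum_neg_distrib]
      refine Finset.sum_congr rfl fun k _ => ?_
      rw [Fin.sum_univ_three]
      have h₁ : ¬ (1 : Fin 3) = 0 := by decide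
      have h₂ : ¬ (2 : Fin 3) = 0 := by decide
      have h₃ : ¬ (2 : Fin 3) = 1 := by decide
      have h₄ : ¬ (0 : Fin 3) = 1 := by decide
      simp only [h₁, h₂, h₃, h₄, if_true, if_false, Fin.val_zero, Fin.val_one, tsub_zero]
      ring
  · refine Finset.sum_congr rfl fun jk _ => Finset.sum_congr rfl fun p _ => ?_
    rw [Finset.mul_sum]
    refine Finset.sum_congr rfl fun m _ => ?_
    rw [sub_sub]
    ring

/-! ### Symmetry -/

/-- The generating series involves the x_j only through a product over all j. -/
theorem f_isSymmetric (κ : ℝ) (n : Fin N → ℤ) : (f κ n).IsSymmetric := by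
  intro σ
  by_cases hn : 0 ≤ tail n
  · have h := map_genSeries (MvPolynomial.rename σ : MvPolynomial (Fin N) ℂ →ₐ[ℂ] _) κ
      MvPolynomial.X
    have h' : genSeries κ (fun j => MvPolynomial.rename σ (MvPolynomial.X j)) =
        genSeries κ (MvPolynomial.X : Fin N → MvPolynomial (Fin N) ℂ) := by
      simp only [genSeries, MvPolynomial.rename_X]
      congr 1
      exact Equiv.prod_comp (σ.prodCongr (Equiv.refl _)) fun jk : Fin N × Fin N =>
        monoSubst (yExp jk.2) (yExp_ne_zero jk.2)
          (binomialPow (-κ) (MvPolynomial.X jk.1 : MvPolynomial (Fin N) ℂ))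
    rw [h'] at h
    have h₁ := congrArg (MvPowerSeries.coeff (tailExp n)) h
    rw [MvPowerSeries.coeff_map, coeff_genSeries κ hn] at h₁
    exact h₁
  · rw [f_eq_zero hn, map_zero]

/-! ### Bounds on the steps that contribute -/

theorem size_add (m n : Fin N → ℤ) : size (m + n) = size m + size n := by
  simp [size, Finset.sum_add_distrib]

theorem size_sub (m n : Fin N → ℤ) : size (m - n) = size m - size n := by
  simp [size, Finset.sum_sub_distrib]

theorem size_sum {ι : Type*} (s : Finset ι) (v : ι → Fin N → ℤ) :
    size (∑ i ∈ s, v i) = ∑ i ∈ s, size (v i) := by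
  simp only [size, Finset.sum_apply]
  exact Finset.sum_comm

theorem size_E (s : Step N) : size s.E = 2 - (s.p : ℕ) := by
  rw [Step.E, size_add]
  simp [size]
  ring

theorem effDegree_le {α β : ℂ[X]} (hα : α.natDegree ≤ 2) : effDegree α β ≤ 2 := by
  rw [effDegree]
  split_ifs <;> omega

/-- A step has size 2 - p, so this bound makes every contributing step lower the size by at least 2
- d. The exceptional value d = 1 for constant α accounts for β_0, which enters with p = 1. -/
theorem le_effDegree {κ : ℝ} {α β : ℂ[X]} {s : Step N} {m : Fin N → ℤ} (h : s.g κ α β m ≠ 0) :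
    (s.p : ℕ) ≤ effDegree α β := by
  have hdeg : ∀ p : ℕ, α.coeff p ≠ 0 → p ≤ effDegree α β := fun p hp =>
    (Polynomial.le_natDegree_of_ne_zero hp).trans (le_max_left _ _)
  by_contra hlt
  have h₀ : α.coeff s.p = 0 := by
    by_contra h'
    exact hlt (hdeg _ h')
  refine h ?_
  rw [Step.g, h₀]
  by_cases hp₀ : s.p = 0
  · exact absurd (by simp [hp₀]) hlt
  · by_cases hp₁ : s.p = 1
    · rw [hp₁] at h₀ hlt
      have hβ : β.coeff 0 = 0 := by
        by_contra hβ
        refine hlt ?_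
        rw [effDegree, if_neg hβ]
        exact le_max_right _ _
      have h₁ : α.coeff 1 = 0 := by simpa using h₀
      simp [hp₁, h₁, hβ]
    · simp [hp₀, hp₁]

/-- Every contributing step is strictly positive in the order, and its ν is controlled by a tail
sum. This bounds both the length of chains and the indices ν in them. -/
theorem step_bounds {κ : ℝ} {α β : ℂ[X]} {s : Step N} {m : Fin N → ℤ} (h : s.g κ α β m ≠ 0) :
    (∀ i, 0 ≤ tail s.E i) ∧ ∃ i, 1 ≤ tail s.E i ∧ (s.ν : ℤ) ≤ tail s.E i + 1 := by
  obtain ⟨x, rfl⟩ := stepEquiv.surjective s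
  rcases x with ⟨jk, p, m⟩ | ⟨k, p, m⟩
  · rw [stepEquiv_inl] at h ⊢
    simp only at h ⊢
    have ht : ∀ i, tail (offStep jk p m).E i =
        m * (tExp jk.1.1 jk.1.2 i : ℤ) + (2 - (p : ℕ) : ℕ) * (yExp jk.1.2 i : ℤ) := by
      intro i
      rw [offStep_E, map_add, map_nsmul, map_nsmul, Pi.add_apply, Pi.smul_apply, Pi.smul_apply,
        tail_single_sub_single jk.2, tail_single_one, nsmul_eq_mul, nsmul_eq_mul]
    refine ⟨fun i => ?_, jk.1.2, ?_, ?_⟩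
    · rw [ht]
      positivity
    · rw [ht, tExp_apply, yExp_apply, if_pos ⟨jk.2, le_rfl⟩, if_pos le_rfl]
      -- Only p = 2, ν = 1 gives E a zero tail sum at `k`, and there the factor 2ν - p of `g`
      -- vanishes.
      by_contra hcon
      have hm : m = 0 := by
        push_cast at hcon
        omega
      have hp : (p : ℕ) = 2 := by
        push_cast at hcon
        omega
      refine h ?_
      rw [offStep_g, hm, hp]
      simp [stepSeries]
    · rw [ht, tExp_apply, yExp_apply, if_pos ⟨jk.2, le_rfl⟩, if_pos le_rfl]
      simp only [offStep]
      push_cast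
      omega
  · rw [stepEquiv_inr] at h ⊢
    simp only at h ⊢
    rcases m with _ | m
    · have ht : ∀ i, tail (diagStep k p 0).E i = (2 - (p : ℕ) : ℕ) * (yExp k i : ℤ) := by
        intro i
        rw [diagStep_E, map_nsmul, Pi.smul_apply, tail_single_one, nsmul_eq_mul]
      have hp : (p : ℕ) ≠ 2 := by
        intro hp
        have h2 : p = 2 := Fin.ext hp
        refine h ?_
        rw [diagStep_g_zero, h2]
        simp
      refine ⟨fun i => ?_, k, ?_, ?_⟩
      · rw [ht]
        positivity
      · rw [ht, yExp_apply, if_pos le_rfl]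
        push_cast
        omega
      · rw [ht, yExp_apply, if_pos le_rfl]
        simp only [diagStep]
        push_cast
        omega
    · exact absurd (diagStep_g_succ κ α β k p m _) h

theorem finite_steps_le (N B : ℕ) : {s : Step N | s.ν ≤ B}.Finite := by
  refine Set.Finite.of_finite_image (f := fun s : Step N => (s.j, s.k, s.p, s.ν))
    ((Set.finite_univ.prod (Set.finite_univ.prod (Set.finite_univ.prod (Set.finite_Iic B)))).subset
      ?_) ?_
  · rintro _ ⟨s, hs, rfl⟩
    exact ⟨Set.mem_univ _, Set.mem_univ _, Set.mem_univ _, hs⟩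
  · rintro ⟨j, k, p, ν, h, h'⟩ _ ⟨j', k', p', ν', h₁, h₁'⟩ _ e
    simp only [Prod.mk.injEq] at e
    obtain ⟨rfl, rfl, rfl, rfl⟩ := e
    rfl

/-- The sum of all tail sums is additive along a chain, at least 1 for each step, and fixed in total
by n - m. It bounds the number of steps by `B` and each ν by `B + 1`. -/
theorem finite_chains (κ : ℝ) (α β : ℂ[X]) (n m : Fin N → ℤ) :
    {s : Steps N | m + ∑ t, (s.2 t).E = n ∧ ∏ r, (s.2 r).g κ α β (s.vertex n r) ≠ 0}.Finite := by
  obtain ⟨B, hB⟩ : ∃ B : ℕ, ∑ i, tail (n - m) i ≤ B := ⟨_, Int.self_le_toNat _⟩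
  refine ((Set.finite_Iic B).biUnion (t := fun l => (fun t : Fin (l + 1) → Step N =>
    (⟨l, t⟩ : Steps N)) '' Set.pi Set.univ fun _ => {s : Step N | s.ν ≤ B + 1})
    fun l _ => (Set.Finite.pi fun _ => finite_steps_le N _).image _).subset ?_
  rintro ⟨l, t⟩ ⟨hsum, hprod⟩
  simp only at hsum hprod
  rw [Finset.prod_ne_zero_iff] at hprod
  have hb := fun r => step_bounds (hprod r (Finset.mem_univ _))
  have hone : ∀ r, 1 ≤ ∑ i, tail (t r).E i := fun r => by
    obtain ⟨h₀, i, h₁, -⟩ := hb r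
    exact h₁.trans (Finset.single_le_sum (fun i _ => h₀ i) (Finset.mem_univ i))
  have htot : ∑ r, ∑ i, tail (t r).E i = ∑ i, tail (n - m) i := by
    rw [← hsum, add_sub_cancel_left, map_sum, Finset.sum_comm]
    simp only [Finset.sum_apply]
  have hl : ((l + 1 : ℕ) : ℤ) ≤ B := by
    refine le_trans ?_ (htot.le.trans hB)
    calc ((l + 1 : ℕ) : ℤ) = ∑ _r : Fin (l + 1), 1 := by simp
      _ ≤ _ := Finset.sum_le_sum fun r _ => hone r
  simp only [Set.mem_iUnion, Set.mem_Iic, Set.mem_image]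
  refine ⟨l, by omega, t, fun r _ => ?_, rfl⟩
  obtain ⟨h₀, i, -, h₂⟩ := hb r
  have h₃ : tail (t r).E i ≤ B := by
    refine le_trans ?_ (htot.le.trans hB)
    exact (Finset.single_le_sum (fun i _ => h₀ i) (Finset.mem_univ i)).trans
      (Finset.single_le_sum (f := fun r => ∑ i, tail (t r).E i)
        (fun r _ => zero_le_one.trans (hone r)) (Finset.mem_univ r))
  change (t r).ν ≤ B + 1
  omega

theorem uTerm_ne_zero {κ : ℝ} {α β : ℂ[X]} {n m : Fin N → ℤ} {s : Steps N}
    (h : uTerm κ α β n m s ≠ 0) :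
    m + ∑ t, (s.2 t).E = n ∧ ∏ r, (s.2 r).g κ α β (s.vertex n r) ≠ 0 := by
  rw [uTerm] at h
  constructor
  · by_contra h'
    rw [if_neg h', zero_mul] at h
    exact h rfl
  · have h₁ := right_ne_zero_of_mul h
    rw [Finset.prod_ne_zero_iff] at h₁ ⊢
    exact fun r hr => (div_ne_zero_iff.mp (h₁ r hr)).1

theorem finite_uTerm (κ : ℝ) (α β : ℂ[X]) (n m : Fin N → ℤ) :
    {s : Steps N | uTerm κ α β n m s ≠ 0}.Finite :=
  (finite_chains κ α β n m).subset fun _ hs => uTerm_ne_zero hs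

/-- The tail sums of the steps are nonnegative and one of them is positive, hence strictness. For
the size, one step already lowers it by 2 - d and no other raises it, since p ≤ 2. -/
theorem mem_lowerIndices_of_sum {κ : ℝ} {α β : ℂ[X]} (hα : α.natDegree ≤ 2) {ι : Type*}
    {q : Finset ι} (hq : q.Nonempty) {t : ι → Step N} {v : ι → Fin N → ℤ}
    (h : ∀ i ∈ q, (t i).g κ α β (v i) ≠ 0) (n : Fin N → ℤ) :
    n - ∑ i ∈ q, (t i).E ∈ lowerIndices α β n := by
  have hb := fun i hi => step_bounds (h i hi)
  have htail : ∀ k, 0 ≤ tail (∑ i ∈ q, (t i).E) k := by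
    intro k
    rw [map_sum, Finset.sum_apply]
    exact Finset.sum_nonneg fun i hi => (hb i hi).1 k
  refine ⟨⟨?_, ?_⟩, ?_⟩
  · rw [below_iff]
    intro k
    change tail (n - _) k ≤ tail n k
    rw [map_sub, Pi.sub_apply]
    have := htail k
    omega
  · intro hn
    obtain ⟨i, hi⟩ := hq
    obtain ⟨h₀, k, h₁, -⟩ := hb i hi
    have h₂ : tail (∑ i ∈ q, (t i).E) k = 0 := by
      rw [sub_eq_self.mp hn, map_zero, Pi.zero_apply]
    rw [map_sum, Finset.sum_apply] at h₂
    have := Finset.single_le_sum (fun i hi => (hb i hi).1 k) hi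
    omega
  · rw [size_sub, size_sum]
    have hd := effDegree_le (β := β) hα
    have hp : ∀ i ∈ q, (0 : ℤ) ≤ size (t i).E ∧ 2 - (effDegree α β : ℤ) ≤ size (t i).E := by
      intro i hi
      have := le_effDegree (h i hi)
      rw [size_E]
      omega
    obtain ⟨i, hi⟩ := hq
    have := Finset.single_le_sum (fun i hi => (hp i hi).1) hi
    have := (hp i hi).2
    omega

theorem vertex_mem_lowerIndices {κ : ℝ} {α β : ℂ[X]} (hα : α.natDegree ≤ 2) {n : Fin N → ℤ}
    {s : Steps N} (h : ∏ r, (s.2 r).g κ α β (s.vertex n r) ≠ 0) (r : Fin (s.1 + 1)) :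
    s.vertex n r ∈ lowerIndices α β n := by
  rw [Finset.prod_ne_zero_iff] at h
  exact mem_lowerIndices_of_sum hα ⟨r, Finset.mem_Ici.mpr le_rfl⟩ (fun i _ => h i (Finset.mem_univ i))
    n

theorem mem_lowerIndices_of_u_ne_zero {κ : ℝ} {α β : ℂ[X]} (hα : α.natDegree ≤ 2)
    {n m : Fin N → ℤ} (h : u κ α β n m ≠ 0) : m ∈ lowerIndices α β n := by
  obtain ⟨s, hs⟩ : ∃ s, uTerm κ α β n m s ≠ 0 := by
    by_contra! hcon
    refine h ?_
    rw [u, finsum_congr hcon, finsum_zero]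
  obtain ⟨h₁, h₂⟩ := uTerm_ne_zero hs
  have h₃ := vertex_mem_lowerIndices hα h₂ 0
  have h₄ : (Finset.Ici 0 : Finset (Fin (s.1 + 1))) = Finset.univ := by
    ext r
    simp
  rw [Steps.vertex, h₄, ← h₁, add_sub_cancel_right] at h₃
  rwa [h₁] at h₃

/-! ### The recursion for the coefficients -/

/-- The coefficient of `f_m` in `P_n`. -/
def coeffP (κ : ℝ) (α β : ℂ[X]) (n m : Fin N → ℤ) : ℂ := (if m = n then 1 else 0) + u κ α β n m

/-- Prepending a step to a possibly empty sequence of steps. -/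
def consSteps : Step N × Option (Steps N) → Steps N
  | (s, none) => ⟨0, fun _ => s⟩
  | (s, some t) => ⟨t.1 + 1, Fin.cons s t.2⟩

theorem consSteps_bijective : Function.Bijective (consSteps (N := N)) := by
  constructor
  · rintro ⟨s, _ | ⟨l, t⟩⟩ ⟨s', _ | ⟨l', t'⟩⟩ h
    · simp only [consSteps, Sigma.mk.injEq, heq_eq_eq, true_and] at h
      rw [congrFun h 0]
    · simp [consSteps] at h
    · simp [consSteps] at h
    · simp only [consSteps, Sigma.mk.injEq, Nat.add_right_cancel_iff] at h
      obtain ⟨rfl, h⟩ := h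
      rw [heq_eq_eq, Fin.cons_inj] at h
      rw [h.1, h.2]
  · rintro ⟨l, t⟩
    rcases l with _ | l
    · refine ⟨(t 0, none), ?_⟩
      simp only [consSteps, Sigma.mk.injEq, heq_eq_eq, true_and]
      funext r
      rw [show r = 0 from Fin.ext (by omega)]
    · exact ⟨(t 0, some ⟨l, Fin.tail t⟩), by simp [consSteps]⟩

/-- The term of the coefficient of `f_m` that belongs to a possibly empty sequence of steps. -/
def optionTerm (κ : ℝ) (α β : ℂ[X]) (n m : Fin N → ℤ) : Option (Steps N) → ℂ
  | none => if m = n then 1 else 0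
  | some t => uTerm κ α β n m t

theorem Ici_zero_eq_univ (l : ℕ) : (Finset.Ici 0 : Finset (Fin (l + 1))) = Finset.univ := by
  ext r
  simp

/-- The product of the quotients in the term of a sequence of steps that ends at `n`. -/
def chainTerm (κ : ℝ) (α β : ℂ[X]) (n : Fin N → ℤ) {l : ℕ} (t : Fin (l + 1) → Step N) : ℂ :=
  ∏ r, (t r).g κ α β (n - ∑ q ∈ Finset.Ici r, (t q).E) /
    b κ α β n (n - ∑ q ∈ Finset.Ici r, (t q).E)

theorem uTerm_of_sum_eq {κ : ℝ} {α β : ℂ[X]} {n m : Fin N → ℤ} {l : ℕ} {t : Fin (l + 1) → Step N}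
    (h : m + ∑ q, (t q).E = n) : uTerm κ α β n m ⟨l, t⟩ = chainTerm κ α β n t := by
  rw [uTerm, if_pos h, one_mul]
  rfl

theorem uTerm_of_sum_ne {κ : ℝ} {α β : ℂ[X]} {n m : Fin N → ℤ} {l : ℕ} {t : Fin (l + 1) → Step N}
    (h : m + ∑ q, (t q).E ≠ n) : uTerm κ α β n m ⟨l, t⟩ = 0 := by
  rw [uTerm, if_neg h, zero_mul]

theorem sum_Ici_succ_cons {l : ℕ} (s : Step N) (t : Fin l → Step N) (r : Fin l) :
    ∑ q ∈ Finset.Ici r.succ, ((Fin.cons s t : Fin (l + 1) → Step N) q).E =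
      ∑ q ∈ Finset.Ici r, (t q).E := by
  rw [← Fin.map_succEmb_Ici, Finset.sum_map]
  simp

theorem chainTerm_cons (κ : ℝ) (α β : ℂ[X]) (n : Fin N → ℤ) {l : ℕ} (s : Step N)
    (t : Fin (l + 1) → Step N) :
    chainTerm κ α β n (Fin.cons s t : Fin (l + 1 + 1) → Step N) =
      s.g κ α β (n - (s.E + ∑ q, (t q).E)) / b κ α β n (n - (s.E + ∑ q, (t q).E)) *
        chainTerm κ α β n t := by
  rw [chainTerm, Fin.prod_univ_succ]
  congr 1
  · rw [Ici_zero_eq_univ, Fin.sum_univ_succ]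
    simp only [Fin.cons_zero, Fin.cons_succ]
  · refine Finset.prod_congr rfl fun r _ => ?_
    rw [sum_Ici_succ_cons, Fin.cons_succ]

/-- The vertex at the first step is n minus the whole sum of steps, that is `m` itself; the later
vertices do not involve the first step. -/
theorem uTerm_consSteps (κ : ℝ) (α β : ℂ[X]) (n m : Fin N → ℤ) (s : Step N)
    (o : Option (Steps N)) : uTerm κ α β n m (consSteps (s, o)) =
      s.g κ α β m / b κ α β n m * optionTerm κ α β n (m + s.E) o := by
  rcases o with _ | ⟨l, t⟩
  · have hs : ∑ _q : Fin (0 + 1), s.E = s.E := Fin.sum_univ_one _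
    rw [consSteps, optionTerm]
    by_cases h : m + s.E = n
    · rw [if_pos h, mul_one, uTerm_of_sum_eq (by rw [hs, h]), chainTerm, Fin.prod_univ_one,
        Ici_zero_eq_univ, hs, ← h, add_sub_cancel_right]
    · rw [if_neg h, mul_zero, uTerm_of_sum_ne (by rwa [hs])]
  · have hs : ∑ q, ((Fin.cons s t : Fin (l + 1 + 1) → Step N) q).E = s.E + ∑ q, (t q).E := by
      rw [Fin.sum_univ_succ]
      simp only [Fin.cons_zero, Fin.cons_succ]
    rw [consSteps, optionTerm]
    by_cases h : m + s.E + ∑ q, (t q).E = n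
    · rw [uTerm_of_sum_eq h, uTerm_of_sum_eq (by rw [hs, ← add_assoc, h]), chainTerm_cons, ← h,
        add_assoc, add_sub_cancel_right]
    · rw [uTerm_of_sum_ne h, mul_zero, uTerm_of_sum_ne (by rwa [hs, ← add_assoc])]

theorem finsum_optionTerm (κ : ℝ) (α β : ℂ[X]) (n m : Fin N → ℤ) :
    ∑ᶠ o, optionTerm κ α β n m o = coeffP κ α β n m := by
  have h₁ : optionTerm κ α β n m = fun o => (if o = none then (if m = n then (1 : ℂ) else 0) else 0)
      + (Option.elim o 0 (uTerm κ α β n m)) := by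
    funext o
    rcases o with _ | t <;> simp [optionTerm]
  have h₂ : (Function.support fun o : Option (Steps N) => Option.elim o 0 (uTerm κ α β n m)) ⊆
      Set.range some := by
    rintro (_ | t) ht
    · exact absurd rfl ht
    · exact ⟨t, rfl⟩
  rw [h₁, finsum_add_distrib, finsum_eq_single _ none, if_pos rfl, coeffP, u]
  · congr 1
    rw [← finsum_mem_univ, ← finsum_mem_inter_support, Set.univ_inter,
      ← Set.inter_eq_self_of_subset_right h₂, finsum_mem_inter_support,
      finsum_mem_range (Option.some_injective _)]
    rfl
  · intro o ho
    rw [if_neg ho]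
  · refine (Set.finite_singleton none).subset fun o ho => ?_
    by_contra h
    exact ho (if_neg h)
  · refine ((finite_uTerm κ α β n m).image some).subset ?_
    rintro (_ | t) ht
    · exact absurd rfl ht
    · exact ⟨t, ht, rfl⟩

/-- Chains are sorted by their first step. The rest of the chain is empty or a chain from m + E to
n, and the empty one accounts for the delta in `coeffP`. -/
theorem u_eq (κ : ℝ) (α β : ℂ[X]) (n m : Fin N → ℤ) :
    u κ α β n m = ∑ᶠ s : Step N, s.g κ α β m / b κ α β n m * coeffP κ α β n (m + s.E) := by
  rw [u, ← finsum_comp_equiv (Equiv.ofBijective consSteps consSteps_bijective), finsum_curry]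
  · refine finsum_congr fun s => ?_
    simp only [Equiv.ofBijective_apply, uTerm_consSteps]
    rw [← mul_finsum, finsum_optionTerm]
  · exact (finite_uTerm κ α β n m).preimage
      (Equiv.injective (Equiv.ofBijective consSteps consSteps_bijective)).injOn

theorem mem_insert_lowerIndices {κ : ℝ} {α β : ℂ[X]} (hα : α.natDegree ≤ 2) {n m : Fin N → ℤ}
    (h : coeffP κ α β n m ≠ 0) : m ∈ insert n (lowerIndices α β n) := by
  by_cases hm : m = n
  · exact Or.inl hm
  · rw [coeffP, if_neg hm, zero_add] at h
    exact Or.inr (mem_lowerIndices_of_u_ne_zero hα h)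

theorem sub_mem_lowerIndices {κ : ℝ} {α β : ℂ[X]} (hα : α.natDegree ≤ 2) {n m : Fin N → ℤ}
    {s : Step N} (hs : s.g κ α β m ≠ 0) (h : m + s.E ∈ insert n (lowerIndices α β n)) :
    m ∈ lowerIndices α β n := by
  have h₁ := mem_lowerIndices_of_sum (q := {()}) (t := fun _ => s) (v := fun _ => m) hα
    (Finset.singleton_nonempty _) (fun _ _ => hs) (m + s.E)
  rw [Finset.sum_singleton, add_sub_cancel_right] at h₁
  rcases h with h | h
  · rwa [← h]
  · refine ⟨⟨h₁.1.1.trans h.1.1, fun hm => ?_⟩, ?_⟩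
    · rw [← hm] at h
      exact h.1.2 (h.1.1.antisymm h₁.1.1)
    · have := h₁.2
      have := h.2
      have := effDegree_le (β := β) hα
      omega

/-- Inside the index set this is `u_eq` multiplied by the nonzero b_n(m). Outside it both sides
vanish, in particular at m = n because b_n(n) = 0; thus the sums over m in `reducedOp_P` can run
over all integer vectors. -/
theorem coeffP_recursion {κ : ℝ} {α β : ℂ[X]} (hα : α.natDegree ≤ 2) {n : Fin N → ℤ}
    (hn : NonResonant κ α β n) (m : Fin N → ℤ) :
    b κ α β n m * coeffP κ α β n m =
      ∑ᶠ s : Step N, s.g κ α β m * coeffP κ α β n (m + s.E) := by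
  by_cases hm : m ∈ lowerIndices α β n
  · have hb := hn m hm
    rw [coeffP, if_neg hm.1.2, zero_add, u_eq, mul_finsum]
    refine finsum_congr fun s => ?_
    field_simp
  · have h₁ : b κ α β n m * coeffP κ α β n m = 0 := by
      by_contra h
      rcases mem_insert_lowerIndices hα (right_ne_zero_of_mul h) with rfl | h'
      · exact h (by rw [b, sub_self, zero_mul])
      · exact hm h'
    rw [h₁]
    symm
    -- A nonzero summand would put `m` below `m + E`, which is `n` or lies in the index set, and
    -- thus into the index set.
    rw [← finsum_zero (α := Step N)]
    refine finsum_congr fun s => ?_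
    by_contra h
    exact hm (sub_mem_lowerIndices hα (left_ne_zero_of_mul h)
      (mem_insert_lowerIndices hα (right_ne_zero_of_mul h)))

/-! ### The polynomials `P_n` -/

theorem wellDefined {κ : ℝ} {α β : ℂ[X]} (hα : α.natDegree ≤ 2) {n : Fin N → ℤ}
    (hn : NonResonant κ α β n) : WellDefined κ α β n := by
  refine ⟨fun m _ => ⟨finite_uTerm κ α β n m, fun s _ hs r => hn _ (vertex_mem_lowerIndices hα hs r)⟩,
    ?_⟩
  refine Set.Finite.subset (Set.Finite.preimage (f := tail) tail_injective.injOn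
    (Set.finite_Icc 0 (tail n))) ?_
  rintro m ⟨hm, h⟩
  refine ⟨?_, below_iff.mp hm.1.1⟩
  by_contra h₀
  exact h (by rw [f_eq_zero h₀, smul_zero])

theorem finite_box (n : Fin N → ℤ) : {m : Fin N → ℤ | 0 ≤ tail m ∧ Below m n}.Finite :=
  Set.Finite.subset (Set.Finite.preimage (f := tail) tail_injective.injOn
    (Set.finite_Icc 0 (tail n))) fun _ hm => ⟨hm.1, below_iff.mp hm.2⟩

theorem below_of_coeffP_ne_zero {κ : ℝ} {α β : ℂ[X]} (hα : α.natDegree ≤ 2) {n m : Fin N → ℤ}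
    (h : coeffP κ α β n m ≠ 0) : Below m n := by
  rcases mem_insert_lowerIndices hα h with rfl | h
  · exact fun _ => le_rfl
  · exact h.1.1

theorem finite_support_coeffP_smul {κ : ℝ} {α β : ℂ[X]} (hα : α.natDegree ≤ 2) (n : Fin N → ℤ) :
    (Function.support fun m => coeffP κ α β n m • f κ m).Finite := by
  refine (finite_box n).subset fun m hm => ⟨?_, below_of_coeffP_ne_zero (κ := κ) (β := β) hα ?_⟩
  · by_contra h₀
    exact hm (by beta_reduce; rw [f_eq_zero h₀, smul_zero])
  · intro h
    exact hm (by beta_reduce; rw [h, zero_smul])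

/-- Since u_n(m) vanishes off the index set, that set can be forgotten and the leading term
absorbed. -/
theorem P_eq_finsum {κ : ℝ} {α β : ℂ[X]} (hα : α.natDegree ≤ 2) (n : Fin N → ℤ) :
    P κ α β n = ∑ᶠ m, coeffP κ α β n m • f κ m := by
  have h₁ : (Function.support fun m => (if m = n then (1 : ℂ) else 0) • f κ m).Finite := by
    refine (Set.finite_singleton n).subset fun m hm => ?_
    by_contra h
    exact hm (by beta_reduce; rw [if_neg (show m ≠ n from h), zero_smul])
  have h₂ : (Function.support fun m => u κ α β n m • f κ m).Finite := by
    refine ((finite_support_coeffP_smul (κ := κ) (β := β) hα n).union h₁).subset fun m hm => ?_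
    by_contra h
    rw [Set.mem_union, Function.mem_support, Function.mem_support] at h
    push Not at h
    refine hm ?_
    have h' := h.1
    rw [coeffP, add_smul, h.2, zero_add] at h'
    exact h'
  rw [P, finsum_congr fun m => show coeffP κ α β n m • f κ m =
    (if m = n then (1 : ℂ) else 0) • f κ m + u κ α β n m • f κ m by rw [coeffP, add_smul],
    finsum_add_distrib h₁ h₂,
    finsum_eq_single (fun m => (if m = n then (1 : ℂ) else 0) • f κ m) n
      fun m hm => by rw [if_neg hm, zero_smul],
    if_pos rfl, one_smul]
  congr 1
  rw [← finsum_mem_univ (fun m => u κ α β n m • f κ m)]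
  refine finsum_mem_inter_support_eq' _ _ _ fun m hm => ⟨fun _ => trivial, fun _ =>
    mem_lowerIndices_of_u_ne_zero (κ := κ) (β := β) hα fun h => hm ?_⟩
  beta_reduce
  rw [h, zero_smul]

theorem P_isSymmetric {κ : ℝ} {α β : ℂ[X]} (hα : α.natDegree ≤ 2) (n : Fin N → ℤ) :
    (P κ α β n).IsSymmetric := by
  rw [P_eq_finsum hα, ← MvPolynomial.mem_symmetricSubalgebra,
    finsum_eq_sum _ (finite_support_coeffP_smul (κ := κ) (β := β) hα n)]
  exact Subalgebra.sum_mem _ fun m _ => Subalgebra.smul_mem _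
    ((MvPolynomial.mem_symmetricSubalgebra _).mpr (f_isSymmetric κ m)) _

/-- The reduced operator at a point as a linear functional. -/
def reducedOpLinear (κ : ℝ) (α β : ℂ[X]) (z : Fin N → ℂ) : MvPolynomial (Fin N) ℂ →ₗ[ℂ] ℂ where
  toFun Q := reducedOp κ α β Q z
  map_add' Q R := by
    simp only [reducedOp, map_add, mul_add, Finset.sum_add_distrib, sub_eq_add_neg, neg_add,
      add_div, neg_div]
    ring
  map_smul' c Q := by
    simp only [reducedOp, Derivation.map_smul, MvPolynomial.smul_eval, RingHom.id_apply,
      smul_eq_mul, mul_add, Finset.mul_sum]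
    congr 1
    · congr 1 <;> exact Finset.sum_congr rfl fun j _ => by ring
    · exact Finset.sum_congr rfl fun j _ => Finset.sum_congr rfl fun k _ => by ring

/-- Needed to exchange the sums over m and s. The vector m lies in the box 0 ≤ tail m ≤ tail n, and
ν is bounded because tail E ≤ tail n - tail m. -/
theorem finite_support_step_pairs {κ : ℝ} {α β : ℂ[X]} (hα : α.natDegree ≤ 2) (n : Fin N → ℤ)
    (z : Fin N → ℂ) : (Function.support fun x : (Fin N → ℤ) × Step N =>
      x.2.g κ α β x.1 * coeffP κ α β n (x.1 + x.2.E) * MvPolynomial.eval z (f κ x.1)).Finite := by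
  obtain ⟨B, hB⟩ := exists_tail_lt n
  refine ((finite_box n).prod (finite_steps_le N (B + 1))).subset ?_
  rintro ⟨m, s⟩ h
  rw [Function.mem_support] at h
  have hg := left_ne_zero_of_mul (left_ne_zero_of_mul h)
  have hc := right_ne_zero_of_mul (left_ne_zero_of_mul h)
  have hm : 0 ≤ tail m := by
    by_contra h₀
    exact h (by rw [f_eq_zero h₀, map_zero, mul_zero])
  have hlow := sub_mem_lowerIndices hα hg (mem_insert_lowerIndices hα hc)
  refine ⟨⟨hm, hlow.1.1⟩, ?_⟩
  obtain ⟨-, i, -, h₁⟩ := step_bounds hg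
  have h₂ := below_of_coeffP_ne_zero hα hc i
  change tail (m + s.E) i ≤ tail n i at h₂
  rw [map_add, Pi.add_apply] at h₂
  have h₃ : 0 ≤ tail m i := hm i
  have h₄ := hB i
  change (s.ν : ℤ) ≤ tail s.E i + 1 at h₁
  change s.ν ≤ B + 1
  omega

/-- Apply `reducedOp_f` to each term and substitute m for m - E in the double sum. By the recursion,
the coefficient of f_m coming from the steps is b_n(m) c(m), which changes -Ẽ_m c(m) into -Ẽ_n c(m).
-/
theorem reducedOp_P {κ : ℝ} {α β : ℂ[X]} (hα : α.natDegree ≤ 2) (hβ : β.natDegree ≤ 1)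
    {n : Fin N → ℤ} (hn : NonResonant κ α β n) (z : Fin N → ℂ) (hz : Function.Injective z) :
    reducedOp κ α β (P κ α β n) z = -energy κ α β n * MvPolynomial.eval z (P κ α β n) := by
  have hfin := finite_support_coeffP_smul (κ := κ) (β := β) hα n
  have hP : ∀ φ : MvPolynomial (Fin N) ℂ →ₗ[ℂ] ℂ,
      φ (P κ α β n) = ∑ᶠ m, coeffP κ α β n m * φ (f κ m) := by
    intro φ
    rw [P_eq_finsum hα]
    refine (φ.toAddMonoidHom.map_finsum hfin).trans (finsum_congr fun m => ?_)
    exact φ.map_smul _ _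
  have hfinφ : ∀ (φ : MvPolynomial (Fin N) ℂ →ₗ[ℂ] ℂ) (c : (Fin N → ℤ) → ℂ),
      (Function.support fun m => c m * (coeffP κ α β n m * φ (f κ m))).Finite := by
    intro φ c
    refine hfin.subset fun m hm h => hm ?_
    have := congrArg φ h
    rw [map_smul, map_zero, smul_eq_mul] at this
    beta_reduce
    rw [this, mul_zero]
  have hop := hP (reducedOpLinear κ α β z)
  have hev := hP (MvPolynomial.aeval z).toLinearMap
  change reducedOp κ α β (P κ α β n) z =
    ∑ᶠ m, coeffP κ α β n m * reducedOp κ α β (f κ m) z at hop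
  change MvPolynomial.aeval z (P κ α β n) =
    ∑ᶠ m, coeffP κ α β n m * MvPolynomial.aeval z (f κ m) at hev
  simp only [MvPolynomial.aeval_eq_eval] at hev
  have hev' := hfinφ (MvPolynomial.aeval z).toLinearMap
  change ∀ c : (Fin N → ℤ) → ℂ, (Function.support fun m => c m *
    (coeffP κ α β n m * MvPolynomial.aeval z (f κ m))).Finite at hev'
  simp only [MvPolynomial.aeval_eq_eval] at hev'
  have hop' := hfinφ (reducedOpLinear κ α β z) 1
  change (Function.support fun m => 1 *
    (coeffP κ α β n m * reducedOp κ α β (f κ m) z)).Finite at hop'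
  simp only [one_mul] at hop'
  have hpairs := finite_support_step_pairs (κ := κ) (β := β) hα n z
  -- The substitution m ↦ m - E_s, with s kept.
  let τ : (Fin N → ℤ) × Step N ≃ (Fin N → ℤ) × Step N :=
    { toFun := fun x => (x.1 - x.2.E, x.2)
      invFun := fun x => (x.1 + x.2.E, x.2)
      left_inv := fun x => by simp
      right_inv := fun x => by simp }
  have hswap : ∑ᶠ m, (energy κ α β m * (coeffP κ α β n m * MvPolynomial.eval z (f κ m)) +
        coeffP κ α β n m * reducedOp κ α β (f κ m) z) =
      -∑ᶠ m, b κ α β n m * (coeffP κ α β n m * MvPolynomial.eval z (f κ m)) := by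
    have h₁ : ∀ m, energy κ α β m * (coeffP κ α β n m * MvPolynomial.eval z (f κ m)) +
        coeffP κ α β n m * reducedOp κ α β (f κ m) z =
        -∑ᶠ s : Step N, s.g κ α β (m - s.E) * coeffP κ α β n m *
          MvPolynomial.eval z (f κ (m - s.E)) := by
      intro m
      rw [reducedOp_f κ α β hα hβ m z hz, mul_sub, mul_finsum,
        finsum_congr fun s : Step N => show s.g κ α β (m - s.E) * coeffP κ α β n m *
          MvPolynomial.eval z (f κ (m - s.E)) = coeffP κ α β n m * (s.g κ α β (m - s.E) *
          MvPolynomial.eval z (f κ (m - s.E))) by ring]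
      ring
    have h₂ : ∀ m, b κ α β n m * (coeffP κ α β n m * MvPolynomial.eval z (f κ m)) =
        ∑ᶠ s : Step N, s.g κ α β m * coeffP κ α β n (m + s.E) * MvPolynomial.eval z (f κ m) := by
      intro m
      rw [← mul_assoc, coeffP_recursion hα hn, finsum_mul]
    rw [finsum_congr h₁, finsum_congr h₂, finsum_neg_distrib, ← finsum_curry _ hpairs,
      ← finsum_comp_equiv τ]
    congr 1
    have h₃ := finsum_curry (fun x : (Fin N → ℤ) × Step N =>
      (τ x).2.g κ α β (τ x).1 * coeffP κ α β n ((τ x).1 + (τ x).2.E) *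
        MvPolynomial.eval z (f κ (τ x).1)) (hpairs.preimage τ.injective.injOn)
    rw [h₃]
    refine finsum_congr fun m => finsum_congr fun s => ?_
    simp only [τ, Equiv.coe_fn_mk, sub_add_cancel]
  rw [finsum_add_distrib (hev' _) hop', ← hop] at hswap
  rw [hev, mul_finsum, finsum_congr fun m => show
    -energy κ α β n * (coeffP κ α β n m * MvPolynomial.eval z (f κ m)) =
    -(b κ α β n m * (coeffP κ α β n m * MvPolynomial.eval z (f κ m)) +
      energy κ α β m * (coeffP κ α β n m * MvPolynomial.eval z (f κ m))) by rw [b]; ring,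
    finsum_neg_distrib, finsum_add_distrib (hev' _) (hev' _), ← add_eq_zero_iff_eq_neg]
  linear_combination hswap

/-! ### Regularity of the eigenfunctions -/

/-- Gains regularity for `w ∘ z` and the logarithms ℓ, which are only assumed differentiable: their
differential is a C¹ function times that of a C² function. -/
theorem contDiffOn_two_of_hasFDerivAt {E : Type*} [NormedAddCommGroup E] [NormedSpace ℝ E]
    {U : Set E} (hU : IsOpen U) {g h c : E → ℂ} (hh : ContDiffOn ℝ 2 h U)
    (hc : ContDiffOn ℝ 1 c U) (hg : ∀ x ∈ U, HasFDerivAt g (c x • fderiv ℝ h x) x) :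
    ContDiffOn ℝ 2 g U := by
  have h₂ : (2 : WithTop ℕ∞) = 1 + 1 := one_add_one_eq_two.symm
  rw [h₂, contDiffOn_succ_iff_fderiv_of_isOpen hU] at hh ⊢
  refine ⟨fun x hx => (hg x hx).differentiableAt.differentiableWithinAt, fun h => ?_, ?_⟩
  · exact absurd h (by simp)
  · exact (hc.smul hh.2.2).congr fun x hx => (hg x hx).fderiv

theorem contDiffOn_eval {E : Type*} [NormedAddCommGroup E] [NormedSpace ℝ E] {U : Set E}
    {n : WithTop ℕ∞} {Z : Fin N → E → ℂ} (hZ : ∀ j, ContDiffOn ℝ n (Z j) U)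
    (Q : MvPolynomial (Fin N) ℂ) :
    ContDiffOn ℝ n (fun x => MvPolynomial.eval (fun j => Z j x) Q) U := by
  simp only [MvPolynomial.eval_eq]
  exact ContDiffOn.sum fun d _ => contDiffOn_const.mul
    (contDiffOn_prod fun i _ => (hZ i).pow _)

theorem contDiffOn_polynomial_eval {E : Type*} [NormedAddCommGroup E] [NormedSpace ℝ E] {U : Set E}
    {n : WithTop ℕ∞} {h : E → ℂ} (hh : ContDiffOn ℝ n h U) (p : ℂ[X]) :
    ContDiffOn ℝ n (fun x => p.eval (h x)) U := by
  simp only [Polynomial.eval_eq_sum_range]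
  exact ContDiffOn.sum fun i _ => contDiffOn_const.mul (hh.pow _)

section Model

variable {α β : ℂ[X]} {z : ℝ → ℂ} {w : ℂ → ℂ} {U : Set (Fin N → ℝ)}
  {ℓ : Fin N → Fin N → (Fin N → ℝ) → ℂ}

theorem IsModel.contDiffOn_coord (hM : IsModel α β z w U ℓ) (j : Fin N) :
    ContDiffOn ℝ 2 (fun x : Fin N → ℝ => z (x j)) U := fun x hx =>
  ((hM.contDiffAt x hx j).comp x (contDiff_apply ℝ ℝ j).contDiffAt).contDiffWithinAt

theorem IsModel.hasFDerivAt_coord (hM : IsModel α β z w U ℓ) (j : Fin N) {x : Fin N → ℝ}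
    (hx : x ∈ U) : HasFDerivAt (fun x : Fin N → ℝ => z (x j))
      (fderiv ℝ (fun x : Fin N → ℝ => z (x j)) x) x :=
  (((hM.contDiffOn_coord j).contDiffAt (hM.isOpen.mem_nhds hx)).differentiableAt
    (by simp)).hasFDerivAt

theorem IsModel.contDiffOn_potential (hM : IsModel α β z w U ℓ) (j : Fin N) :
    ContDiffOn ℝ 2 (fun x : Fin N → ℝ => w (z (x j))) U := by
  refine contDiffOn_two_of_hasFDerivAt hM.isOpen (hM.contDiffOn_coord j)
    (c := fun x => ((derivative α).eval (z (x j)) - 2 * β.eval (z (x j))) /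
      (4 * α.eval (z (x j)))) ?_ fun x hx => ?_
  · have h := (hM.contDiffOn_coord j).of_le (m := 1) one_le_two
    simp only [div_eq_mul_inv]
    refine ((contDiffOn_polynomial_eval h _).sub
      (contDiffOn_const.mul (contDiffOn_polynomial_eval h _))).mul
      ((contDiffOn_const.mul (contDiffOn_polynomial_eval h _)).inv fun x hx => ?_)
    exact mul_ne_zero (by norm_num) (hM.eval_ne_zero x hx j)
  · exact (hM.hasDerivAt x hx j).comp_hasFDerivAt x (hM.hasFDerivAt_coord j hx)

theorem IsModel.sub_ne_zero (hM : IsModel α β z w U ℓ) {x : Fin N → ℝ} (hx : x ∈ U) {j k : Fin N}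
    (hjk : j < k) : z (x k) - z (x j) ≠ 0 := by
  rw [← hM.exp_eq j k hjk x hx]
  exact Complex.exp_ne_zero _

theorem IsModel.injective (hM : IsModel α β z w U ℓ) {x : Fin N → ℝ} (hx : x ∈ U) :
    Function.Injective fun j => z (x j) := by
  intro j k h
  rcases lt_trichotomy j k with hjk | hjk | hjk
  · exact absurd (by rw [← show z (x j) = z (x k) from h, sub_self]) (hM.sub_ne_zero hx hjk)
  · exact hjk
  · exact absurd (by rw [← show z (x j) = z (x k) from h, sub_self]) (hM.sub_ne_zero hx hjk)

/-- Differentiating exp ℓ = z_k - z_j gives dℓ = (z_k - z_j)⁻¹ d(z_k - z_j), whichever branch was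
chosen. -/
theorem IsModel.contDiffOn_log (hM : IsModel α β z w U ℓ) {j k : Fin N} (hjk : j < k) :
    ContDiffOn ℝ 2 (ℓ j k) U := by
  have hD : ContDiffOn ℝ 2 (fun x : Fin N → ℝ => z (x k) - z (x j)) U :=
    (hM.contDiffOn_coord k).sub (hM.contDiffOn_coord j)
  refine contDiffOn_two_of_hasFDerivAt hM.isOpen hD (c := fun x => (z (x k) - z (x j))⁻¹) ?_
    fun x hx => ?_
  · exact (hD.of_le one_le_two).inv fun x hx => hM.sub_ne_zero hx hjk
  · have h₁ := ((hM.differentiableOn j k hjk).differentiableAt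
      (hM.isOpen.mem_nhds hx)).hasFDerivAt
    have h₂ : HasFDerivAt (fun x => Complex.exp (ℓ j k x))
        (fderiv ℝ (fun x : Fin N → ℝ => z (x k) - z (x j)) x) x := by
      refine HasFDerivAt.congr_of_eventuallyEq (((hD.contDiffAt
        (hM.isOpen.mem_nhds hx)).differentiableAt (by simp)).hasFDerivAt) ?_
      filter_upwards [hM.isOpen.mem_nhds hx] with y hy using hM.exp_eq j k hjk y hy
    rw [← h₁.cexp.unique h₂, smul_smul, hM.exp_eq j k hjk x hx,
      inv_mul_cancel₀ (hM.sub_ne_zero hx hjk), one_smul]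
    exact h₁

theorem IsModel.contDiffOn_groundState (hM : IsModel α β z w U ℓ) (κ : ℝ) :
    ContDiffOn ℝ 2 (groundState κ z w ℓ) U := by
  refine ContDiffOn.mul ?_ ?_
  · exact contDiffOn_prod fun j _ => (hM.contDiffOn_potential j).neg.cexp
  · exact contDiffOn_prod fun j _ => contDiffOn_prod fun k hk =>
      (contDiffOn_const.mul (hM.contDiffOn_log (Finset.mem_Ioi.mp hk))).cexp

/-! ### Derivatives along the coordinate lines -/

theorem hasDerivAt_eval {Z : Fin N → ℝ → ℂ} {Z' : Fin N → ℂ} {t : ℝ}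
    (hZ : ∀ k, HasDerivAt (Z k) (Z' k) t) (Q : MvPolynomial (Fin N) ℂ) :
    HasDerivAt (fun s => MvPolynomial.eval (fun k => Z k s) Q)
      (∑ k, Z' k * MvPolynomial.eval (fun k => Z k t) (MvPolynomial.pderiv k Q)) t := by
  induction Q using MvPolynomial.induction_on with
  | C a => simpa using hasDerivAt_const t a
  | add p q hp hq =>
    simp only [map_add, mul_add, Finset.sum_add_distrib]
    exact hp.add hq
  | mul_X p i hp =>
    simp only [map_mul, MvPolynomial.eval_X]
    refine (hp.mul (hZ i)).congr_deriv ?_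
    simp only [Derivation.leibniz, MvPolynomial.pderiv_X, smul_eq_mul, map_add, map_mul,
      MvPolynomial.eval_X, mul_add, Finset.sum_add_distrib, Finset.sum_mul]
    rw [add_comm]
    congr 1
    · rw [Finset.sum_eq_single i]
      · simp
        ring
      · intro k _ hk
        simp [Pi.single_eq_of_ne hk.symm]
      · simp
    · exact Finset.sum_congr rfl fun k _ => by ring

theorem IsModel.hasDerivAt_coord (hM : IsModel α β z w U ℓ) {x : Fin N → ℝ} (hx : x ∈ U)
    (j k : Fin N) : HasDerivAt (fun t => z (Function.update x j t k))
      (if k = j then deriv z (x j) else 0) (x j) := by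
  by_cases h : k = j
  · subst h
    simp only [Function.update_self, if_true]
    exact ((hM.contDiffAt x hx k).differentiableAt (by simp)).hasDerivAt
  · simp only [Function.update_of_ne h, if_neg h]
    exact hasDerivAt_const _ _

theorem IsModel.eventually_update_mem (hM : IsModel α β z w U ℓ) {x : Fin N → ℝ} (hx : x ∈ U)
    (j : Fin N) : ∀ᶠ t in nhds (x j), Function.update x j t ∈ U := by
  have h : Filter.Tendsto (Function.update x j) (nhds (x j)) (nhds x) := by
    have := (hasDerivAt_update x j (x j)).continuousAt
    rwa [ContinuousAt, Function.update_eq_self] at this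
  exact h (hM.isOpen.mem_nhds hx)

theorem IsModel.hasDerivAt_log (hM : IsModel α β z w U ℓ) {x : Fin N → ℝ} (hx : x ∈ U)
    (j : Fin N) {i k : Fin N} (hik : i < k) :
    HasDerivAt (fun t => ℓ i k (Function.update x j t))
      (((if k = j then deriv z (x j) else 0) - (if i = j then deriv z (x j) else 0)) /
        (z (x k) - z (x i))) (x j) := by
  have h₁ : DifferentiableAt ℝ (fun t => ℓ i k (Function.update x j t)) (x j) := by
    refine DifferentiableAt.comp (x j) ?_ (hasDerivAt_update x j (x j)).differentiableAt
    rw [Function.update_eq_self]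
    exact (hM.differentiableOn i k hik).differentiableAt (hM.isOpen.mem_nhds hx)
  have h₂ : HasDerivAt (fun t => Complex.exp (ℓ i k (Function.update x j t)))
      ((if k = j then deriv z (x j) else 0) - (if i = j then deriv z (x j) else 0)) (x j) := by
    refine HasDerivAt.congr_of_eventuallyEq
      ((hM.hasDerivAt_coord hx j k).sub (hM.hasDerivAt_coord hx j i)) ?_
    filter_upwards [hM.eventually_update_mem hx j] with t ht using hM.exp_eq i k hik _ ht
  rw [← h₁.hasDerivAt.cexp.unique h₂, Function.update_eq_self, hM.exp_eq i k hik x hx,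
    mul_div_cancel_left₀ _ (hM.sub_ne_zero hx hik)]
  exact h₁.hasDerivAt

/-- The logarithmic derivative of the ground state with respect to `z_j`. -/
def groundLogDer (κ : ℝ) (α β : ℂ[X]) (y : Fin N → ℂ) (j : Fin N) : ℂ :=
  (2 * β.eval (y j) - (derivative α).eval (y j)) / (4 * α.eval (y j)) +
    κ * ∑ k, 1 / (y j - y k)

theorem IsModel.hasDerivAt_groundState (hM : IsModel α β z w U ℓ) (κ : ℝ) {x : Fin N → ℝ}
    (hx : x ∈ U) (j : Fin N) : HasDerivAt (fun t => groundState κ z w ℓ (Function.update x j t))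
      (groundState κ z w ℓ x * (deriv z (x j) * groundLogDer κ α β (fun k => z (x k)) j))
      (x j) := by
  set Z' : Fin N → ℂ := fun k => if k = j then deriv z (x j) else 0 with hZ'
  have h₁ : ∀ k, HasDerivAt (fun t => -w (z (Function.update x j t k)))
      (Z' k * ((2 * β.eval (z (x k)) - (derivative α).eval (z (x k))) /
        (4 * α.eval (z (x k))))) (x j) := by
    intro k
    have h := (HasDerivAt.comp_of_eq (x j) (hM.hasDerivAt x hx k) (hM.hasDerivAt_coord hx j k)
      (by rw [Function.update_eq_self])).neg
    refine h.congr_deriv ?_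
    simp only [hZ']
    ring
  have h₂ : HasDerivAt (fun t => ∑ k, -w (z (Function.update x j t k)) +
      ∑ i, ∑ k ∈ Finset.Ioi i, κ * ℓ i k (Function.update x j t))
      (deriv z (x j) * groundLogDer κ α β (fun k => z (x k)) j) (x j) := by
    refine ((HasDerivAt.fun_sum fun k _ => h₁ k).add (HasDerivAt.fun_sum fun i _ =>
      HasDerivAt.fun_sum fun k hk => (hM.hasDerivAt_log hx j
        (Finset.mem_Ioi.mp hk)).const_mul (κ : ℂ))).congr_deriv ?_
    -- The pair sum is symmetrized into a full double sum with zero diagonal. Only the row i = j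
    -- survives, as `Z'` is supported at `j`.
    have h₃ : ∑ i, ∑ k ∈ Finset.Ioi i, (κ : ℂ) * ((Z' k - Z' i) / (z (x k) - z (x i))) =
        ∑ i, ∑ k, κ * (Z' i / (z (x i) - z (x k))) := by
      rw [← sum_Ioi_add (fun i k => (κ : ℂ) * (Z' i / (z (x i) - z (x k)))) fun i => by simp]
      refine Finset.sum_congr rfl fun i _ => Finset.sum_congr rfl fun k _ => ?_
      rw [← neg_sub (z (x k)) (z (x i)), div_neg]
      ring
    rw [h₃, Finset.sum_eq_single j, Finset.sum_eq_single j, groundLogDer, mul_add]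
    · simp only [hZ', if_true]
      rw [Finset.mul_sum, Finset.mul_sum]
      congr 1
      exact Finset.sum_congr rfl fun k _ => by ring
    · intro i _ hi
      simp [hZ', hi]
    · simp
    · intro i _ hi
      simp [hZ', hi]
    · simp
  have h₄ : ∀ y, groundState κ z w ℓ y = Complex.exp (∑ k, -w (z (y k)) +
      ∑ i, ∑ k ∈ Finset.Ioi i, κ * ℓ i k y) := by
    intro y
    rw [groundState, Complex.exp_add, Complex.exp_sum, Complex.exp_sum]
    simp only [Complex.exp_sum]
  simp only [h₄]
  refine h₂.cexp.congr_deriv ?_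
  rw [Function.update_eq_self]

theorem IsModel.deriv_ne_zero (hM : IsModel α β z w U ℓ) {x : Fin N → ℝ} (hx : x ∈ U)
    (j : Fin N) : deriv z (x j) ≠ 0 := by
  intro h
  have h₁ := hM.deriv_sq x hx j
  rw [h, zero_pow two_ne_zero] at h₁
  exact hM.eval_ne_zero x hx j h₁.symm

/-- Differentiating z'² = α(z) gives 2 z' z'' = α'(z) z', and z' ≠ 0 because α(z) ≠ 0. The choice of
the square root is irrelevant. -/
theorem IsModel.hasDerivAt_deriv (hM : IsModel α β z w U ℓ) {x : Fin N → ℝ} (hx : x ∈ U)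
    (j : Fin N) : HasDerivAt (deriv z) ((derivative α).eval (z (x j)) / 2) (x j) := by
  have h₁ : DifferentiableAt ℝ (deriv z) (x j) := by
    have h : ContDiffAt ℝ 1 (deriv z) (x j) := by
      have := (hM.contDiffAt x hx j).fderiv_right (m := 1) (by rw [one_add_one_eq_two])
      exact this.clm_apply contDiffAt_const
    exact h.differentiableAt (by simp)
  have hz := ((hM.contDiffAt x hx j).differentiableAt (by simp)).hasDerivAt
  have h₂ : HasDerivAt (fun t => deriv z t ^ 2)
      ((derivative α).eval (z (x j)) * deriv z (x j)) (x j) := by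
    refine ((α.hasDerivAt (z (x j))).comp (x j) hz).congr_of_eventuallyEq ?_
    filter_upwards [hM.eventually_update_mem hx j] with t ht
    have h := hM.deriv_sq _ ht j
    rwa [Function.update_self] at h
  have h₃ := (h₁.hasDerivAt.pow 2).unique h₂
  refine h₁.hasDerivAt.congr_deriv ?_
  have h₄ := hM.deriv_ne_zero hx j
  have h₅ : (2 * deriv (deriv z) (x j) - (derivative α).eval (z (x j))) * deriv z (x j) = 0 := by
    rw [sub_mul, ← h₃]
    simp
    ring
  have h₆ := (mul_eq_zero.mp h₅).resolve_right h₄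
  linear_combination h₆ / 2

end Model

/-! ### The Schrödinger equation -/

theorem hasDerivAt_groundLogDer {α : ℂ[X]} (κ : ℝ) (β : ℂ[X]) {ζ : ℝ → ℂ} {t : ℝ} {ζ' : ℂ}
    (hζ : HasDerivAt ζ ζ' t) {y : Fin N → ℂ} (hy : Function.Injective y) {j : Fin N}
    (hj : ζ t = y j) (hα : α.eval (y j) ≠ 0) :
    HasDerivAt (fun s => groundLogDer κ α β (Function.update y j (ζ s)) j)
      (ζ' * (((2 * (derivative β).eval (y j) - (derivative (derivative α)).eval (y j)) *
        α.eval (y j) - (2 * β.eval (y j) - (derivative α).eval (y j)) *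
          (derivative α).eval (y j)) / (4 * α.eval (y j) ^ 2) -
        κ * ∑ k, 1 / (y j - y k) ^ 2)) t := by
  have hp : ∀ p : ℂ[X], HasDerivAt (fun s => p.eval (ζ s)) ((derivative p).eval (y j) * ζ') t :=
    fun p => HasDerivAt.comp_of_eq t (p.hasDerivAt (y j)) hζ hj.symm
  have h₁ : HasDerivAt (fun s => (2 * β.eval (ζ s) - (derivative α).eval (ζ s)) /
      (4 * α.eval (ζ s))) _ t :=
    (((hp β).const_mul 2).fun_sub (hp (derivative α))).fun_div ((hp α).const_mul 4)
      (by rw [hj]; exact mul_ne_zero (by norm_num) hα)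
  have h₂ : ∀ k, HasDerivAt (fun s => 1 / (ζ s - Function.update y j (ζ s) k))
      (-ζ' / (y j - y k) ^ 2) t := by
    intro k
    by_cases hk : k = j
    · subst hk
      simp only [Function.update_self, sub_self, div_zero, zero_pow two_ne_zero]
      exact hasDerivAt_const _ _
    · simp only [Function.update_of_ne hk, one_div]
      refine ((hζ.sub_const (y k)).inv ?_).congr_deriv (by rw [hj])
      rw [hj, sub_ne_zero]
      exact fun h => hk (hy h.symm)
  simp only [groundLogDer, Function.update_self]
  refine (h₁.add ((HasDerivAt.fun_sum fun k _ => h₂ k).const_mul (κ : ℂ))).congr_deriv ?_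
  have h₃ : ∑ k, -ζ' / (y j - y k) ^ 2 = -ζ' * ∑ k, 1 / (y j - y k) ^ 2 := by
    rw [Finset.mul_sum]
    exact Finset.sum_congr rfl fun k _ => by ring
  rw [h₃, hj]
  generalize ∑ k, 1 / (y j - y k) ^ 2 = S
  field_simp
  ring

/-- The second derivative of `Ψ_0 Q` with respect to `x_j`, divided by `Ψ_0`. -/
theorem IsModel.iteratedDeriv_two {α β : ℂ[X]} {z : ℝ → ℂ} {w : ℂ → ℂ} {U : Set (Fin N → ℝ)}
    {ℓ : Fin N → Fin N → (Fin N → ℝ) → ℂ} (hM : IsModel α β z w U ℓ) (κ : ℝ)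
    (Q : MvPolynomial (Fin N) ℂ) {x : Fin N → ℝ} (hx : x ∈ U) (j : Fin N) {y : Fin N → ℂ}
    (hy : y = fun k => z (x k)) :
    iteratedDeriv 2 (fun t : ℝ => groundState κ z w ℓ (Function.update x j t) *
        MvPolynomial.eval (fun k => z (Function.update x j t k)) Q) (x j) =
      groundState κ z w ℓ x *
        ((oneBody α β (y j) + κ * (β.eval (y j) * ∑ k, 1 / (y j - y k)) +
            κ ^ 2 * (α.eval (y j) * (∑ k, 1 / (y j - y k)) ^ 2) -
            κ * (α.eval (y j) * ∑ k, 1 / (y j - y k) ^ 2)) * MvPolynomial.eval y Q +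
          (β.eval (y j) + 2 * κ * (α.eval (y j) * ∑ k, 1 / (y j - y k))) *
            MvPolynomial.eval y (MvPolynomial.pderiv j Q) +
          α.eval (y j) * MvPolynomial.eval y (MvPolynomial.pderiv j (MvPolynomial.pderiv j Q))) := by
  have hq : ∀ (R : MvPolynomial (Fin N) ℂ), ∀ v ∈ U,
      HasDerivAt (fun t => MvPolynomial.eval (fun k => z (Function.update v j t k)) R)
        (deriv z (v j) * MvPolynomial.eval (fun k => z (v k)) (MvPolynomial.pderiv j R)) (v j) := by
    intro R v hv
    refine (hasDerivAt_eval (hM.hasDerivAt_coord hv j) R).congr_deriv ?_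
    rw [Finset.sum_eq_single j]
    · rw [if_pos rfl, Function.update_eq_self]
    · intro k _ hk
      rw [if_neg hk, zero_mul]
    · simp
  have hfirst : ∀ v ∈ U, HasDerivAt (fun t : ℝ => groundState κ z w ℓ (Function.update v j t) *
      MvPolynomial.eval (fun k => z (Function.update v j t k)) Q)
      (groundState κ z w ℓ v * deriv z (v j) *
        (groundLogDer κ α β (fun k => z (v k)) j * MvPolynomial.eval (fun k => z (v k)) Q +
          MvPolynomial.eval (fun k => z (v k)) (MvPolynomial.pderiv j Q))) (v j) := by
    intro v hv
    refine ((hM.hasDerivAt_groundState κ hv j).mul (hq Q v hv)).congr_deriv ?_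
    rw [Function.update_eq_self]
    ring
  have hev : deriv (fun t : ℝ => groundState κ z w ℓ (Function.update x j t) *
        MvPolynomial.eval (fun k => z (Function.update x j t k)) Q) =ᶠ[nhds (x j)]
      fun t => groundState κ z w ℓ (Function.update x j t) * deriv z t *
        (groundLogDer κ α β (Function.update y j (z t)) j *
          MvPolynomial.eval (fun k => z (Function.update x j t k)) Q +
          MvPolynomial.eval (fun k => z (Function.update x j t k)) (MvPolynomial.pderiv j Q)) := by
    filter_upwards [hM.eventually_update_mem hx j] with t ht
    have h := (hfirst _ ht).deriv
    simp only [Function.update_idem, Function.update_self] at h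
    rw [h]
    have h' : (fun k => z (Function.update x j t k)) = Function.update y j (z t) := by
      funext k
      by_cases hk : k = j
      · subst hk
        simp
      · simp [hk, hy]
    rw [h']
  have hz := ((hM.contDiffAt x hx j).differentiableAt (by simp)).hasDerivAt
  have hα := hM.eval_ne_zero x hx j
  have hinj := hM.injective hx
  rw [← hy] at hinj
  have hyj : y j = z (x j) := by rw [hy]
  rw [← hyj] at hα
  have hsecond := (((hM.hasDerivAt_groundState κ hx j).mul (hM.hasDerivAt_deriv hx j)).mul
    (((hasDerivAt_groundLogDer κ β hz hinj hyj.symm hα).mul (hq Q x hx)).add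
      (hq (MvPolynomial.pderiv j Q) x hx)))
  have hsq := hM.deriv_sq x hx j
  rw [iteratedDeriv_succ, iteratedDeriv_one, hev.deriv_eq]
  refine hsecond.deriv.trans ?_
  simp only [Pi.mul_apply, Pi.add_apply, Function.update_eq_self, ← hyj, ← hy]
  rw [← hyj] at hsq
  simp only [groundLogDer, oneBody]
  generalize ∑ k, 1 / (y j - y k) = S
  generalize ∑ k, 1 / (y j - y k) ^ 2 = S₂
  generalize MvPolynomial.eval y Q = q
  generalize MvPolynomial.eval y (MvPolynomial.pderiv j (MvPolynomial.pderiv j Q)) = q₂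
  generalize MvPolynomial.eval y (MvPolynomial.pderiv j Q) = q₁
  generalize groundState κ z w ℓ x = Ψ
  -- Replacing α(z_j) by z'(x_j)² leaves a rational identity in d = z'(x_j), the polynomial values
  -- and the generalized sums.
  rw [← hsq] at hα ⊢
  generalize deriv z (x j) = d at hα ⊢
  have hd : d ≠ 0 := fun h => hα (by rw [h, zero_pow two_ne_zero])
  field_simp
  ring

theorem sum_twoBody (κ : ℝ) (α : ℂ[X]) (y : Fin N → ℂ) :
    ∑ j, ∑ k ∈ Finset.Ioi j, twoBody κ α (y j) (y k) =
      κ * (κ - 1) * ∑ j, α.eval (y j) * ∑ k, 1 / (y j - y k) ^ 2 := by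
  simp only [Finset.mul_sum]
  rw [← sum_Ioi_add (fun j k => (κ : ℂ) * (κ - 1) * (α.eval (y j) * (1 / (y j - y k) ^ 2)))
    fun j => by simp]
  refine Finset.sum_congr rfl fun j _ => Finset.sum_congr rfl fun k _ => ?_
  rw [twoBody, ← neg_sub (y j) (y k), neg_sq]
  ring

theorem reducedOp_eq (κ : ℝ) (α β : ℂ[X]) (Q : MvPolynomial (Fin N) ℂ) (y : Fin N → ℂ) :
    reducedOp κ α β Q y = ∑ j,
      ((β.eval (y j) + 2 * κ * (α.eval (y j) * ∑ k, 1 / (y j - y k))) *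
            MvPolynomial.eval y (MvPolynomial.pderiv j Q) +
          α.eval (y j) *
            MvPolynomial.eval y (MvPolynomial.pderiv j (MvPolynomial.pderiv j Q))) := by
  rw [reducedOp, sum_Ioi_sub_div y fun j => α.eval (y j) *
    MvPolynomial.eval y (MvPolynomial.pderiv j Q), Finset.mul_sum, ← Finset.sum_add_distrib,
    ← Finset.sum_add_distrib]
  exact Finset.sum_congr rfl fun j _ => by ring

/-- After division by Ψ_0 the one-body potential cancels in each second derivative. `three_body`
replaces the squares of ∑_k 1/(y_j - y_k) by two-body sums, which then cancel the interaction; its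
constant and that of `sum_div_sub` form E_0. What remains is the reduced operator. -/
theorem isReducedEigenfunction {κ : ℝ} {α β : ℂ[X]} (hα : α.natDegree ≤ 2) (hβ : β.natDegree ≤ 1)
    {Q : MvPolynomial (Fin N) ℂ} {E : ℂ} (hQ : ∀ z : Fin N → ℂ, Function.Injective z →
      reducedOp κ α β Q z = -E * MvPolynomial.eval z Q) : IsReducedEigenfunction κ α β Q E := by
  refine ⟨hQ, fun z w U ℓ hM => ⟨(hM.contDiffOn_groundState κ).mul
    (contDiffOn_eval hM.contDiffOn_coord Q), fun x hx => ?_⟩⟩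
  have hinj := hM.injective hx
  obtain ⟨y, hy⟩ : ∃ y, y = fun k => z (x k) := ⟨_, rfl⟩
  rw [← hy] at hinj
  have hyj : ∀ j, z (x j) = y j := fun j => by rw [hy]
  have hop := hQ y hinj
  have hthree := three_body (α.coeff 2) (α.coeff 1) (α.coeff 0) hinj fun _ => 1
  have hcross := sum_div_sub (β.coeff 1) (β.coeff 0) hinj
  simp only [← eval_eq_of_natDegree_le_two hα, ← eval_eq_of_natDegree_le_one hβ, one_mul, one_pow,
    Finset.sum_const, Finset.card_univ, Fintype.card_fin, nsmul_eq_mul, mul_one] at hthree hcross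
  have hthree' : 3 * ∑ j, α.eval (y j) * (∑ k, 1 / (y j - y k)) ^ 2 =
      3 * ∑ j, α.eval (y j) * ∑ k, 1 / (y j - y k) ^ 2 +
        α.coeff 2 * ((N : ℂ) ^ 3 - 3 * N * N + 2 * N) := by
    rw [hthree]
    simp only [Finset.mul_sum, mul_one_div]
  rw [hamiltonian, Finset.sum_congr rfl fun j _ => hM.iteratedDeriv_two κ Q hx j hy]
  simp only [hyj, sum_twoBody]
  rw [reducedOp_eq] at hop
  rw [← Finset.mul_sum]
  simp only [add_assoc _ (_ * MvPolynomial.eval y (MvPolynomial.pderiv _ Q)) _]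
  rw [Finset.sum_add_distrib, hop, ← Finset.sum_mul, Finset.sum_sub_distrib,
    Finset.sum_add_distrib, Finset.sum_add_distrib, ← Finset.mul_sum, ← Finset.mul_sum,
    ← Finset.mul_sum, groundEnergy]
  rw [show (fun j => y j) = y from rfl]
  linear_combination (-(κ : ℂ) / 2 * hcross - (κ : ℂ) ^ 2 / 3 * hthree') *
    (groundState κ z w ℓ x * MvPolynomial.eval y Q)

/-! ### Expansion in products of the coefficients of `∏_j (1 - x_j T)^{-κ}` -/

/-- The series `∏_j (1 - x_j T)^{-κ}`. -/
def hSeries (N : ℕ) (κ : ℝ) : PowerSeries (MvPolynomial (Fin N) ℂ) :=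
  ∏ j : Fin N, binomialPow (-κ) (MvPolynomial.X j)

/-- The product of the coefficients of `T^{μ_k}` in `∏_j (1 - x_j T)^{-κ}`. -/
def hProd (κ : ℝ) (μ : Fin N → ℕ) : MvPolynomial (Fin N) ℂ :=
  ∏ k, PowerSeries.coeff (μ k) (hSeries N κ)

/-- A vector of natural numbers as an integer vector. -/
def natVec (μ : Fin N → ℕ) : Fin N → ℤ := fun k => μ k

theorem natVec_injective : Function.Injective (natVec (N := N)) := fun _ _ h =>
  funext fun k => Int.natCast_inj.mp (congrFun h k)

theorem tail_natVec (μ : Fin N → ℕ) (i : Fin N) :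
    tail (natVec μ) i = ((∑ k, μ k • yExp k : Fin N →₀ ℕ) i : ℤ) := by
  have h : natVec μ = ∑ k, (μ k : ℤ) • (Pi.single k 1 : Fin N → ℤ) := by
    funext k
    simp only [natVec, Finset.sum_apply, Pi.smul_apply, Pi.single_apply, smul_eq_mul, mul_ite,
      mul_one, mul_zero, Finset.sum_ite_eq, Finset.mem_univ, if_true]
  rw [h, map_sum]
  simp only [map_zsmul, Finset.sum_apply, Pi.smul_apply, smul_eq_mul, Finsupp.finsetSum_apply,
    Finsupp.smul_apply, Nat.cast_sum, Nat.cast_mul, tail_single_one]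

theorem tail_natVec_nonneg (μ : Fin N → ℕ) : 0 ≤ tail (natVec μ) := fun i => by
  rw [tail_natVec]
  exact Int.natCast_nonneg _

/-- The exponents of the variables `y_j/y_k` for `j < k` and `1/y_k`. -/
def factorExp (i : Pairs N ⊕ Fin N) : Fin N →₀ ℕ :=
  Sum.elim (fun jk : Pairs N => tExp jk.1.1 jk.1.2) yExp i

theorem factorExp_ne_zero (i : Pairs N ⊕ Fin N) : factorExp i ≠ 0 := by
  rcases i with jk | k
  · exact tExp_ne_zero jk.2
  · exact yExp_ne_zero k

/-- For fixed k the product over j of the factors (1 - x_j/y_k)^{-κ} is the series `hSeries` in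
1/y_k, so only the pair factors remain to be expanded. -/
theorem f_eq_finsum_hProd (κ : ℝ) {n : Fin N → ℤ} (hn : 0 ≤ tail n) :
    f κ n = ∑ᶠ e ∈ {e : Pairs N ⊕ Fin N → ℕ | ∑ i, e i • factorExp i = tailExp n},
      MvPolynomial.C (∏ jk, ((((-1) ^ e (Sum.inl jk) * Ring.choose κ (e (Sum.inl jk)) : ℝ)) : ℂ)) *
        hProd κ fun k => e (Sum.inr k) := by
  have h : genSeries κ (MvPolynomial.X : Fin N → MvPolynomial (Fin N) ℂ) =
      ∏ i : Pairs N ⊕ Fin N, monoSubst (factorExp i) (factorExp_ne_zero i)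
        (Sum.elim (fun _ => binomialPow κ 1) (fun _ => hSeries N κ) i) := by
    rw [Fintype.prod_sum_type, genSeries, Fintype.prod_prod_type_right]
    congr 1
    refine Finset.prod_congr rfl fun k _ => ?_
    rw [Sum.elim_inr, hSeries, map_prod]
    rfl
  rw [← coeff_genSeries κ hn, h, coeff_prod_monoSubst]
  refine finsum_mem_congr rfl fun e _ => ?_
  rw [Fintype.prod_sum_type, map_prod]
  simp only [Sum.elim_inl, Sum.elim_inr, binomialPow, PowerSeries.coeff_mk, one_pow, mul_one,
    hProd, MvPolynomial.algebraMap_eq]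

theorem below_of_sum_factorExp {n : Fin N → ℤ} (hn : 0 ≤ tail n) {e : Pairs N ⊕ Fin N → ℕ}
    (he : ∑ i, e i • factorExp i = tailExp n) : Below (natVec fun k => e (Sum.inr k)) n := by
  rw [below_iff]
  intro i
  rw [tail_natVec, ← natCast_tailExp hn, ← he, Fintype.sum_sum_type, Finsupp.add_apply,
    Nat.cast_le]
  exact Nat.le_add_left _ _

theorem eq_of_sum_factorExp {n : Fin N → ℤ} (hn : 0 ≤ tail n) {e : Pairs N ⊕ Fin N → ℕ}
    (he : ∑ i, e i • factorExp i = tailExp n) (h : natVec (fun k => e (Sum.inr k)) = n) :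
    ∀ jk, e (Sum.inl jk) = 0 := by
  intro jk
  have h₁ : ∑ jk : Pairs N, e (Sum.inl jk) • tExp jk.1.1 jk.1.2 = 0 := by
    ext i
    have h₂ := natCast_tailExp hn i
    rw [← he, ← congrFun (congrArg tail h) i, tail_natVec, Fintype.sum_sum_type,
      Finsupp.add_apply, Nat.cast_inj] at h₂
    exact Nat.add_eq_right.mp h₂
  rw [Finset.sum_eq_zero_iff] at h₁
  exact (smul_eq_zero.mp (h₁ jk (Finset.mem_univ _))).resolve_right (tExp_ne_zero jk.2)

theorem f_mem_span (κ : ℝ) (n : Fin N → ℤ) :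
    f κ n ∈ Submodule.span ℂ (hProd κ '' {μ | Below (natVec μ) n}) := by
  by_cases hn : 0 ≤ tail n
  · rw [f_eq_finsum_hProd κ hn]
    refine finsum_mem_induction (· ∈ Submodule.span ℂ (hProd κ '' {μ | Below (natVec μ) n}))
      (Submodule.zero_mem _) (fun _ _ => Submodule.add_mem _) fun e he => ?_
    rw [← MvPolynomial.smul_eq_C_mul]
    exact Submodule.smul_mem _ _ (Submodule.subset_span ⟨_, below_of_sum_factorExp hn he, rfl⟩)
  · rw [f_eq_zero hn]
    exact Submodule.zero_mem _

/-- The pair factors y_j/y_k have nonzero nonnegative exponents, so h_ν itself arises from the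
constant terms of all pair factors only, with coefficient 1. All other terms are strictly lower. -/
theorem f_sub_hProd_mem_span (κ : ℝ) (ν : Fin N → ℕ) :
    f κ (natVec ν) - hProd κ ν ∈
      Submodule.span ℂ (hProd κ '' {μ | StrictlyBelow (natVec μ) (natVec ν)}) := by
  have hn := tail_natVec_nonneg ν
  have he₀ : ∑ i, (Sum.elim (fun _ => 0) ν i : ℕ) • factorExp i = tailExp (natVec ν) := by
    rw [Fintype.sum_sum_type]
    simp only [Sum.elim_inl, Sum.elim_inr, zero_smul, Finset.sum_const_zero, zero_add]
    exact eq_tailExp (tail_natVec ν)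
  rw [f_eq_finsum_hProd κ hn, ← finsum_mem_add_sdiff'
    (Set.singleton_subset_iff.mpr (show Sum.elim (fun _ => 0) ν ∈
      {e : Pairs N ⊕ Fin N → ℕ | ∑ i, e i • factorExp i = tailExp (natVec ν)} from he₀))
    ((finite_sum_nsmul_eq factorExp_ne_zero _).inter_of_left _), finsum_mem_singleton]
  simp only [Sum.elim_inl, Sum.elim_inr, pow_zero, Ring.choose_zero_right, mul_one,
    Complex.ofReal_one, Finset.prod_const_one, map_one, one_mul]
  rw [add_sub_cancel_left]
  refine finsum_mem_induction
    (· ∈ Submodule.span ℂ (hProd κ '' {μ | StrictlyBelow (natVec μ) (natVec ν)}))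
    (Submodule.zero_mem _) (fun _ _ => Submodule.add_mem _) fun e he => ?_
  rw [← MvPolynomial.smul_eq_C_mul]
  refine Submodule.smul_mem _ _ (Submodule.subset_span
    ⟨_, ⟨below_of_sum_factorExp hn he.1, fun h => he.2 ?_⟩, rfl⟩)
  have h₁ := eq_of_sum_factorExp hn he.1 h
  have h₂ := natVec_injective h
  refine funext fun i => ?_
  rcases i with jk | k
  · exact h₁ jk
  · exact congrFun h₂ k

/-! ### Partitions -/

theorem hProd_comp_perm (κ : ℝ) (μ : Fin N → ℕ) (σ : Equiv.Perm (Fin N)) :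
    hProd κ (μ ∘ σ) = hProd κ μ :=
  Equiv.prod_comp σ fun k => PowerSeries.coeff (μ k) (hSeries N κ)

/-- Rearrangement inequality: among all orderings the decreasing one has the smallest tail sums.
Since h_μ does not depend on the order, sorting the index keeps expansions triangular. -/
theorem below_comp_perm {μ : Fin N → ℕ} (hμ : Antitone μ) (σ : Equiv.Perm (Fin N)) :
    Below (natVec μ) (natVec (μ ∘ σ)) := by
  intro j
  have hanti : Antivary (fun i : Fin N => if j ≤ i then (1 : ℤ) else 0) (natVec μ) := by
    intro i k hik
    have hik' : k < i := by
      by_contra hcon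
      have h : μ k ≤ μ i := hμ (not_lt.mp hcon)
      have h' : (μ i : ℤ) < (μ k : ℤ) := hik
      omega
    change (if j ≤ k then (1 : ℤ) else 0) ≤ if j ≤ i then 1 else 0
    split_ifs <;> omega
  have h := hanti.sum_mul_le_sum_mul_comp_perm (σ := σ)
  have hs : ∀ v : Fin N → ℤ, ∑ i, (if j ≤ i then (1 : ℤ) else 0) * v i =
      ∑ i ∈ Finset.Ici j, v i := by
    intro v
    simp only [ite_mul, one_mul, zero_mul, ← Finset.sum_filter]
    exact Finset.sum_congr (by ext; simp) fun _ _ => rfl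
  rwa [hs, hs fun i => natVec μ (σ i)] at h

theorem eq_of_antitone_comp_perm {μ ν : Fin N → ℕ} (hμ : Antitone μ) (hν : Antitone ν)
    {σ : Equiv.Perm (Fin N)} (h : ν = μ ∘ σ) : ν = μ := by
  have h₁ := below_comp_perm hμ σ
  have h₂ := below_comp_perm hν σ.symm
  rw [← h] at h₁
  have h₃ : ν ∘ σ.symm = μ := by
    rw [h, Function.comp_assoc, Equiv.self_comp_symm, Function.comp_id]
  rw [h₃] at h₂
  exact natVec_injective (h₂.antisymm h₁)

theorem exists_perm_antitone (μ : Fin N → ℕ) :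
    ∃ σ : Equiv.Perm (Fin N), Antitone (μ ∘ σ) ∧ Below (natVec (μ ∘ σ)) (natVec μ) := by
  refine ⟨Tuple.sort (OrderDual.toDual ∘ μ), ?_⟩
  set σ := Tuple.sort (OrderDual.toDual ∘ μ)
  have hσ : Antitone (μ ∘ σ) := fun i j hij => Tuple.monotone_sort (OrderDual.toDual ∘ μ) hij
  refine ⟨hσ, ?_⟩
  have h := below_comp_perm hσ σ.symm
  rwa [Function.comp_assoc, Equiv.self_comp_symm, Function.comp_id] at h

theorem isPartition_natVec {μ : Fin N → ℕ} : IsPartition (natVec μ) ↔ Antitone μ :=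
  ⟨fun h _ _ hij => Int.ofNat_le.mp (h.1 hij),
    fun h => ⟨fun _ _ hij => Int.ofNat_le.mpr (h hij), fun _ => Int.natCast_nonneg _⟩⟩

theorem IsPartition.exists_natVec {n : Fin N → ℤ} (hn : IsPartition n) :
    ∃ μ : Fin N → ℕ, Antitone μ ∧ n = natVec μ := by
  refine ⟨fun k => (n k).toNat, fun i j hij => Int.toNat_le_toNat (hn.1 hij), funext fun k => ?_⟩
  exact (Int.toNat_of_nonneg (hn.2 k)).symm

/-- `P_λ` equals the product `hProd` plus a combination of lower ones. -/
theorem P_sub_hProd_mem_span (κ : ℝ) (α β : ℂ[X]) (ν : Fin N → ℕ) :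
    P κ α β (natVec ν) - hProd κ ν ∈ Submodule.span ℂ
      (hProd κ '' {μ | Antitone μ ∧ StrictlyBelow (natVec μ) (natVec ν)}) := by
  have hle : Submodule.span ℂ (hProd κ '' {μ | StrictlyBelow (natVec μ) (natVec ν)}) ≤
      Submodule.span ℂ
        (hProd κ '' {μ | Antitone μ ∧ StrictlyBelow (natVec μ) (natVec ν)}) := by
    refine Submodule.span_mono ?_
    rintro _ ⟨μ, hμ, rfl⟩
    obtain ⟨σ, h₁, h₂⟩ := exists_perm_antitone μ
    -- Sorting only lowers the index, so strictness survives.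
    refine ⟨μ ∘ σ, ⟨h₁, h₂.trans hμ.1, fun h => hμ.2 ?_⟩, hProd_comp_perm κ μ σ⟩
    rw [h] at h₂
    exact hμ.1.antisymm h₂
  refine hle ?_
  rw [P, add_sub_right_comm]
  refine Submodule.add_mem _ (f_sub_hProd_mem_span κ ν) ?_
  refine finsum_mem_induction
    (· ∈ Submodule.span ℂ (hProd κ '' {μ | StrictlyBelow (natVec μ) (natVec ν)}))
    (Submodule.zero_mem _) (fun _ _ => Submodule.add_mem _) fun m hm => ?_
  refine Submodule.smul_mem _ _ (Submodule.span_mono (Set.image_mono fun μ hμ => ?_)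
    (f_mem_span κ m))
  refine ⟨Below.trans hμ hm.1.1, fun h => hm.1.2 ?_⟩
  rw [Set.mem_ofPred_eq, h] at hμ
  exact hm.1.1.antisymm hμ

/-! ### Power sums -/

/-- The logarithmic derivative T d/dT of ∏_j (1 - x_j T)^{-κ} is κ ∑_{r≥1} p_r T^r; compare
coefficients. -/
theorem mul_coeff_hSeries (κ : ℝ) (r : ℕ) :
    (r : MvPolynomial (Fin N) ℂ) * PowerSeries.coeff r (hSeries N κ) =
      MvPolynomial.C (κ : ℂ) * ∑ i ∈ Finset.range r,
        MvPolynomial.psum (Fin N) ℂ (i + 1) * PowerSeries.coeff (r - (i + 1)) (hSeries N κ) := by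
  have h₁ := derivation_prod ((PowerSeries.X : PowerSeries (MvPolynomial (Fin N) ℂ)) •
    PowerSeries.derivative (MvPolynomial (Fin N) ℂ)) Finset.univ
    (fun j : Fin N => binomialPow (-κ) (MvPolynomial.X j : MvPolynomial (Fin N) ℂ))
    (fun j => PowerSeries.C (MvPolynomial.C (κ : ℂ)) * (geomSeries (MvPolynomial.X j) - 1))
    (fun j _ => by
      rw [Derivation.smul_apply, smul_eq_mul, X_mul_derivative_binomialPow, Complex.ofReal_neg,
        map_neg, map_neg, MvPolynomial.algebraMap_eq]
      ring)
  rw [Derivation.smul_apply, smul_eq_mul, ← Finset.mul_sum] at h₁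
  change PowerSeries.X * PowerSeries.derivative _ (hSeries N κ) = _ * hSeries N κ at h₁
  have h₂ := congrArg (PowerSeries.coeff r) h₁
  have h₃ : PowerSeries.coeff r (PowerSeries.X *
      PowerSeries.derivative (MvPolynomial (Fin N) ℂ) (hSeries N κ)) =
      r * PowerSeries.coeff r (hSeries N κ) := by
    rcases r with _ | r
    · simp
    · rw [PowerSeries.coeff_succ_X_mul, PowerSeries.coeff_derivative]
      push_cast
      ring
  rw [h₃, mul_assoc, PowerSeries.coeff_C_mul, PowerSeries.coeff_mul,
    Finset.Nat.sum_antidiagonal_eq_sum_range_succ_mk, Finset.sum_range_succ'] at h₂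
  rw [h₂]
  simp only [map_sum, map_sub, geomSeries, PowerSeries.coeff_mk, PowerSeries.coeff_one, pow_zero,
    if_true, sub_self, Finset.sum_const_zero, zero_mul, add_zero, Nat.succ_ne_zero, if_false,
    sub_zero, MvPolynomial.psum]

theorem sum_mul_hProd (κ : ℝ) (μ : Fin N → ℕ) :
    ((∑ k, μ k : ℕ) : MvPolynomial (Fin N) ℂ) * hProd κ μ =
      MvPolynomial.C (κ : ℂ) * ∑ k, ∑ i ∈ Finset.range (μ k),
        MvPolynomial.psum (Fin N) ℂ (i + 1) * hProd κ (μ - Pi.single k (i + 1)) := by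
  have h₁ : ∀ ν : Fin N → ℕ, ∀ k, hProd κ ν = PowerSeries.coeff (ν k) (hSeries N κ) *
      ∏ j ∈ Finset.univ.erase k, PowerSeries.coeff (ν j) (hSeries N κ) := fun ν k =>
    (Finset.mul_prod_erase _ _ (Finset.mem_univ k)).symm
  have h₂ : ∀ k i, hProd κ (μ - Pi.single k (i + 1)) =
      PowerSeries.coeff (μ k - (i + 1)) (hSeries N κ) *
        ∏ j ∈ Finset.univ.erase k, PowerSeries.coeff (μ j) (hSeries N κ) := by
    intro k i
    rw [h₁ _ k, Pi.sub_apply, Pi.single_eq_same]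
    congr 1
    refine Finset.prod_congr rfl fun j hj => ?_
    rw [Pi.sub_apply, Pi.single_eq_of_ne (Finset.ne_of_mem_erase hj), Nat.sub_zero]
  rw [Nat.cast_sum, Finset.sum_mul, Finset.mul_sum]
  refine Finset.sum_congr rfl fun k _ => ?_
  rw [h₁ μ k, ← mul_assoc, mul_coeff_hSeries, mul_assoc, Finset.sum_mul]
  congr 1
  refine Finset.sum_congr rfl fun i _ => ?_
  rw [h₂, mul_assoc]

/-- The monomial with exponent vector `μ`. -/
def monomialX (μ : Fin N → ℕ) : MvPolynomial (Fin N) ℂ := ∏ k, MvPolynomial.X k ^ μ k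

theorem psum_mul_monomialX (r : ℕ) (μ : Fin N → ℕ) :
    MvPolynomial.psum (Fin N) ℂ r * monomialX μ = ∑ k, monomialX (μ + Pi.single k r) := by
  rw [MvPolynomial.psum, Finset.sum_mul]
  refine Finset.sum_congr rfl fun k _ => ?_
  simp only [monomialX, Pi.add_apply, pow_add, Finset.prod_mul_distrib]
  rw [mul_comm]
  congr 1
  rw [Finset.prod_eq_single k, Pi.single_eq_same]
  · intro j _ hj
    rw [Pi.single_eq_of_ne hj, pow_zero]
  · simp

/-! ### The Hermitian form of the kernel `∏_{j,k} (1 - x_j y_k)^{-κ}` -/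

/-- The value of the degree `d` part of the kernel at a functional and its conjugate. -/
def kernelForm (κ : ℝ) (c : MvPolynomial (Fin N) ℂ →ₗ[ℂ] ℂ) (d : ℕ) : ℂ :=
  ∑ μ ∈ Finset.piAntidiag Finset.univ d, c (hProd κ μ) * star (c (monomialX μ))

/-- The functional `q ↦ c (p_r q)`. -/
def mulPsum (r : ℕ) (c : MvPolynomial (Fin N) ℂ →ₗ[ℂ] ℂ) : MvPolynomial (Fin N) ℂ →ₗ[ℂ] ℂ :=
  c ∘ₗ LinearMap.mulLeft ℂ (MvPolynomial.psum (Fin N) ℂ r)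

theorem mulPsum_apply (r : ℕ) (c : MvPolynomial (Fin N) ℂ →ₗ[ℂ] ℂ) (q : MvPolynomial (Fin N) ℂ) :
    mulPsum r c q = c (MvPolynomial.psum (Fin N) ℂ r * q) := rfl

theorem sum_single_nat (k : Fin N) (r : ℕ) : ∑ j, (Pi.single k r : Fin N → ℕ) j = r := by
  simp

theorem single_le_of_le {μ : Fin N → ℕ} {k : Fin N} {r : ℕ} (h : r ≤ μ k) :
    (Pi.single k r : Fin N → ℕ) ≤ μ := by
  intro j
  by_cases hj : j = k
  · subst hj
    rwa [Pi.single_eq_same]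
  · rw [Pi.single_eq_of_ne hj]
    exact Nat.zero_le _

/-- This is d K_d = κ ∑_r p_r(x) p_r(y) K_{d-r} evaluated at c in x and its conjugate in y. Both
factors p_r are absorbed into `mulPsum`, so the right side consists of forms of the same kind. -/
theorem mul_kernelForm (κ : ℝ) (c : MvPolynomial (Fin N) ℂ →ₗ[ℂ] ℂ) (d : ℕ) :
    d * kernelForm κ c d =
      κ * ∑ i ∈ Finset.range d, kernelForm κ (mulPsum (i + 1) c) (d - (i + 1)) := by
  have h₁ : ∀ μ ∈ Finset.piAntidiag (Finset.univ : Finset (Fin N)) d,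
      (d : ℂ) * (c (hProd κ μ) * star (c (monomialX μ))) =
      κ * ∑ k, ∑ i ∈ Finset.range (μ k),
        mulPsum (i + 1) c (hProd κ (μ - Pi.single k (i + 1))) * star (c (monomialX μ)) := by
    intro μ hμ
    have h := congrArg c (sum_mul_hProd κ μ)
    rw [(Finset.mem_piAntidiag.mp hμ).1, ← map_natCast (MvPolynomial.C : ℂ →+* _),
      ← MvPolynomial.smul_eq_C_mul, ← MvPolynomial.smul_eq_C_mul, map_smul, map_smul, map_sum,
      smul_eq_mul, smul_eq_mul] at h
    rw [← mul_assoc, h, mul_assoc, Finset.sum_mul]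
    congr 1
    refine Finset.sum_congr rfl fun k _ => ?_
    rw [map_sum, Finset.sum_mul]
    rfl
  have h₂ : ∀ i ∈ Finset.range d, kernelForm κ (mulPsum (i + 1) c) (d - (i + 1)) =
      ∑ ν ∈ Finset.piAntidiag Finset.univ (d - (i + 1)), ∑ k,
        mulPsum (i + 1) c (hProd κ ν) * star (c (monomialX (ν + Pi.single k (i + 1)))) := by
    intro i _
    refine Finset.sum_congr rfl fun ν _ => ?_
    rw [mulPsum_apply _ _ (monomialX ν), psum_mul_monomialX, map_sum, star_sum, Finset.mul_sum]
  rw [kernelForm, Finset.mul_sum, Finset.sum_congr rfl h₁, Finset.sum_congr rfl h₂,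
    ← Finset.mul_sum]
  congr 1
  simp only [Finset.sum_sigma']
  -- The triples (μ, k, i) and (i, ν, k) correspond by μ = ν + (i + 1) e_k; the bound i < μ_k keeps
  -- the truncated subtraction exact.
  refine Finset.sum_bij' (fun x _ => ⟨x.2.2, ⟨x.1 - Pi.single x.2.1 (x.2.2 + 1), x.2.1⟩⟩)
    (fun x _ => ⟨x.2.1 + Pi.single x.2.2 (x.1 + 1), ⟨x.2.2, x.1⟩⟩) ?_ ?_ ?_ ?_ ?_
  · rintro ⟨μ, k, i⟩ h
    simp only [Finset.mem_sigma, Finset.mem_piAntidiag, Finset.mem_univ, Finset.mem_range,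
      implies_true, and_true, true_and] at h ⊢
    have hle := Finset.single_le_sum (fun j _ => Nat.zero_le (μ j)) (Finset.mem_univ k)
    have hs : ∑ j, (μ - Pi.single k (i + 1) : Fin N → ℕ) j + (i + 1) = ∑ j, μ j := by
      conv_lhs => arg 2; rw [← sum_single_nat k (i + 1)]
      rw [← Finset.sum_add_distrib]
      refine Finset.sum_congr rfl fun j _ => ?_
      exact congrFun (tsub_add_cancel_of_le (single_le_of_le (Nat.succ_le_of_lt h.2))) j
    have hμ : ∑ j, μ j = d := h.1
    change i < d ∧ ∑ j, (μ - Pi.single k (i + 1) : Fin N → ℕ) j = d - (i + 1)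
    omega
  · rintro ⟨i, ν, k⟩ h
    simp only [Finset.mem_sigma, Finset.mem_piAntidiag, Finset.mem_univ, Finset.mem_range,
      implies_true, and_true, true_and] at h ⊢
    have hν : ∑ j, ν j = d - (i + 1) := h.2
    refine ⟨?_, ?_⟩
    · change ∑ j, (ν j + (Pi.single k (i + 1) : Fin N → ℕ) j) = d
      rw [Finset.sum_add_distrib, sum_single_nat]
      omega
    · rw [Pi.add_apply, Pi.single_eq_same]
      omega
  · rintro ⟨μ, k, i⟩ h
    simp only [Finset.mem_sigma, Finset.mem_range] at h
    simp only [tsub_add_cancel_of_le (single_le_of_le (Nat.succ_le_of_lt h.2.2))]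
  · rintro ⟨i, ν, k⟩ _
    simp only [add_tsub_cancel_right]
  · rintro ⟨μ, k, i⟩ h
    simp only [Finset.mem_sigma, Finset.mem_range] at h
    simp only [tsub_add_cancel_of_le (single_le_of_le (Nat.succ_le_of_lt h.2.2))]

theorem coeff_zero_hSeries (κ : ℝ) : PowerSeries.coeff 0 (hSeries N κ) = 1 := by
  rw [hSeries, PowerSeries.coeff_zero_eq_constantCoeff, map_prod]
  refine Finset.prod_eq_one fun j _ => ?_
  rw [← PowerSeries.coeff_zero_eq_constantCoeff, binomialPow, PowerSeries.coeff_mk]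
  simp

-- Induction on d, starting from |c(1)|² in degree 0. For κ > 0 the recursion writes the form as a
-- positive multiple of a sum of nonnegative forms; if it vanishes, so does each of them, which
-- strips one power sum from the product. In the order used here, nonnegative includes real.
open scoped ComplexOrder in
theorem kernelForm_nonneg {κ : ℝ} (hκ : 0 < κ) (d : ℕ) :
    ∀ c : MvPolynomial (Fin N) ℂ →ₗ[ℂ] ℂ, 0 ≤ kernelForm κ c d ∧
      (kernelForm κ c d = 0 → ∀ l : List ℕ, (∀ r ∈ l, r ≠ 0) → l.sum = d →
        c (l.map (MvPolynomial.psum (Fin N) ℂ)).prod = 0) := by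
  induction d using Nat.strong_induction_on with
  | _ d ih =>
    intro c
    rcases Nat.eq_zero_or_pos d with rfl | hd
    · have h : kernelForm κ c 0 = c 1 * star (c 1) := by
        rw [kernelForm, Finset.piAntidiag_zero, Finset.sum_singleton]
        congr 2
        · simp [hProd, coeff_zero_hSeries]
        · simp [monomialX]
      rw [h]
      refine ⟨mul_star_self_nonneg _, fun h₀ l hl hs => ?_⟩
      rcases l with _ | ⟨r, l⟩
      · simpa using h₀
      · have := hl r (by simp)
        rw [List.sum_cons] at hs
        omega
    · have hd' : (d : ℂ) ≠ 0 := Nat.cast_ne_zero.mpr hd.ne'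
      have hq : (0 : ℂ) < ((κ / d : ℝ) : ℂ) := by
        rw [Complex.zero_lt_real]
        positivity
      have h : kernelForm κ c d = ((κ / d : ℝ) : ℂ) *
          ∑ i ∈ Finset.range d, kernelForm κ (mulPsum (i + 1) c) (d - (i + 1)) := by
        push_cast
        rw [div_mul_eq_mul_div, ← mul_kernelForm, mul_div_cancel_left₀ _ hd']
      have hnn : ∀ i ∈ Finset.range d,
          0 ≤ kernelForm κ (mulPsum (i + 1) c) (d - (i + 1)) := fun i hi =>
        (ih _ (by have := Finset.mem_range.mp hi; omega) _).1
      rw [h]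
      refine ⟨mul_nonneg hq.le (Finset.sum_nonneg hnn), fun h₀ l hl hs => ?_⟩
      have h₁ := (Finset.sum_eq_zero_iff_of_nonneg hnn).mp
        ((mul_eq_zero.mp h₀).resolve_left hq.ne')
      rcases l with _ | ⟨r, l⟩
      · rw [List.sum_nil] at hs
        omega
      · have hr := hl r (by simp)
        obtain ⟨i, rfl⟩ := Nat.exists_eq_succ_of_ne_zero hr
        rw [List.sum_cons] at hs
        have hi : i ∈ Finset.range d := Finset.mem_range.mpr (by omega)
        have h₂ := (ih (d - (i + 1)) (by omega) _).2 (h₁ i hi) l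
          (fun r hr => hl r (List.mem_cons_of_mem _ hr)) (by omega)
        rw [List.map_cons, List.prod_cons]
        exact h₂

/-- Newton's identities, with division by k in characteristic 0. -/
theorem esymm_mem_adjoin_psum (k : ℕ) : MvPolynomial.esymm (Fin N) ℂ k ∈
    Algebra.adjoin ℂ (MvPolynomial.psum (Fin N) ℂ '' {r | r ≠ 0}) := by
  induction k using Nat.strong_induction_on with
  | _ k ih =>
    rcases Nat.eq_zero_or_pos k with rfl | hk
    · rw [MvPolynomial.esymm_zero]
      exact Subalgebra.one_mem _
    · have h := MvPolynomial.mul_esymm_eq_sum (Fin N) ℂ k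
      have hk' : (k : ℂ) ≠ 0 := Nat.cast_ne_zero.mpr hk.ne'
      have h₁ : MvPolynomial.esymm (Fin N) ℂ k =
          (k : ℂ)⁻¹ • ((k : MvPolynomial (Fin N) ℂ) * MvPolynomial.esymm (Fin N) ℂ k) := by
        rw [← map_natCast (MvPolynomial.C : ℂ →+* MvPolynomial (Fin N) ℂ),
          ← MvPolynomial.smul_eq_C_mul, smul_smul, inv_mul_cancel₀ hk', one_smul]
      rw [h₁, h]
      refine Subalgebra.smul_mem _ (Subalgebra.mul_mem _
        (Subalgebra.pow_mem _ (Subalgebra.neg_mem _ (Subalgebra.one_mem _)) _)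
        (Subalgebra.sum_mem _ fun a ha => ?_)) _
      rw [Finset.mem_filter, Finset.HasAntidiagonal.mem_antidiagonal] at ha
      refine Subalgebra.mul_mem _ (Subalgebra.mul_mem _
        (Subalgebra.pow_mem _ (Subalgebra.neg_mem _ (Subalgebra.one_mem _)) _) (ih _ ha.2)) ?_
      exact Algebra.subset_adjoin ⟨a.2, by rw [Set.mem_ofPred_eq]; omega, rfl⟩

theorem symmetricSubalgebra_le_adjoin_psum : MvPolynomial.symmetricSubalgebra (Fin N) ℂ ≤
    Algebra.adjoin ℂ (MvPolynomial.psum (Fin N) ℂ '' {r | r ≠ 0}) := by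
  intro q hq
  obtain ⟨p, hp⟩ := MvPolynomial.esymmAlgHom_fin_surjective ℂ le_rfl
    (⟨q, hq⟩ : MvPolynomial.symmetricSubalgebra (Fin N) ℂ)
  have hp' : q = MvPolynomial.aeval (fun i : Fin N => MvPolynomial.esymm (Fin N) ℂ (i + 1)) p := by
    rw [← MvPolynomial.esymmAlgHom_apply, hp]
  rw [hp', MvPolynomial.aeval_def, MvPolynomial.eval₂_eq]
  refine Subalgebra.sum_mem _ fun d _ => Subalgebra.mul_mem _ (Subalgebra.algebraMap_mem _ _)
    (Subalgebra.prod_mem _ fun i _ => Subalgebra.pow_mem _ (esymm_mem_adjoin_psum _) _)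

/-- The products of power sums span the symmetric polynomials. -/
theorem eq_zero_of_kernelForm_eq_zero {κ : ℝ} (hκ : 0 < κ) {c : MvPolynomial (Fin N) ℂ →ₗ[ℂ] ℂ}
    (h : ∀ d, kernelForm κ c d = 0) {q : MvPolynomial (Fin N) ℂ} (hq : q.IsSymmetric) :
    c q = 0 := by
  have h₁ := symmetricSubalgebra_le_adjoin_psum ((MvPolynomial.mem_symmetricSubalgebra q).mpr hq)
  rw [← Subalgebra.mem_toSubmodule, Algebra.adjoin_eq_span] at h₁
  refine (Submodule.span_le (p := LinearMap.ker c)).mpr ?_ h₁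
  intro s hs
  obtain ⟨l, hl, rfl⟩ := Submonoid.exists_list_of_mem_closure hs
  have h₂ : ∃ l' : List ℕ, (∀ r ∈ l', r ≠ 0) ∧ l = l'.map (MvPolynomial.psum (Fin N) ℂ) := by
    clear hs
    induction l with
    | nil => exact ⟨[], by simp, rfl⟩
    | cons a l ih =>
      obtain ⟨l', h₁, h₂⟩ := ih fun y hy => hl y (List.mem_cons_of_mem _ hy)
      obtain ⟨r, hr, hra⟩ := hl a (by simp)
      refine ⟨r :: l', ?_, by rw [List.map_cons, hra, h₂]⟩
      intro r' hr'
      rcases List.mem_cons.mp hr' with rfl | hr'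
      · exact hr
      · exact h₁ r' hr'
  obtain ⟨l', h₃, rfl⟩ := h₂
  exact (kernelForm_nonneg hκ _ c).2 (h _) l' h₃ rfl

/-! ### Bases of the symmetric polynomials -/

theorem coeff_monomialX (μ ν : Fin N → ℕ) :
    MvPolynomial.coeff (Finsupp.equivFunOnFinite.symm ν) (monomialX μ) = if μ = ν then 1 else 0 := by
  have h : monomialX μ = MvPolynomial.monomial (Finsupp.equivFunOnFinite.symm μ) 1 := by
    rw [MvPolynomial.monomial_eq, map_one, one_mul, Finsupp.prod_fintype _ _ fun _ => pow_zero _]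
    rfl
  classical
  rw [h, MvPolynomial.coeff_monomial]
  simp only [Finsupp.equivFunOnFinite.symm.injective.eq_iff]

/-- The functional `q ↦ ∑_ν conj(a_ν) q_ν`, where `q_ν` is the coefficient of the monomial with
exponent vector `ν`. -/
def coeffFunctional (s : Finset {μ : Fin N → ℕ // Antitone μ})
    (a : {μ : Fin N → ℕ // Antitone μ} → ℂ) : MvPolynomial (Fin N) ℂ →ₗ[ℂ] ℂ :=
  ∑ ν ∈ s, star (a ν) • MvPolynomial.lcoeff ℂ (Finsupp.equivFunOnFinite.symm ν.1)

theorem coeffFunctional_monomialX (s : Finset {μ : Fin N → ℕ // Antitone μ})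
    (a : {μ : Fin N → ℕ // Antitone μ} → ℂ) (μ : Fin N → ℕ) :
    coeffFunctional s a (monomialX μ) = ∑ ν ∈ s, if μ = ν.1 then star (a ν) else 0 := by
  simp only [coeffFunctional, LinearMap.sum_apply, LinearMap.smul_apply, MvPolynomial.lcoeff_apply,
    coeff_monomialX, smul_eq_mul, mul_ite, mul_one, mul_zero]

theorem rename_monomialX (σ : Equiv.Perm (Fin N)) (μ : Fin N → ℕ) :
    MvPolynomial.rename σ (monomialX μ) = monomialX (μ ∘ σ.symm) := by
  simp only [monomialX, map_prod, map_pow, MvPolynomial.rename_X]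
  rw [← Equiv.prod_comp σ.symm]
  simp only [Equiv.apply_symm_apply, Function.comp_apply]

/-- Test on the symmetrized monomial x^ν. No other partition is a rearrangement of ν, so the value
is the conjugate of a_ν times the order of the stabilizer of ν. -/
theorem eq_zero_of_coeffFunctional {s : Finset {μ : Fin N → ℕ // Antitone μ}}
    {a : {μ : Fin N → ℕ // Antitone μ} → ℂ}
    (h : ∀ q : MvPolynomial (Fin N) ℂ, q.IsSymmetric → coeffFunctional s a q = 0)
    {ν : {μ : Fin N → ℕ // Antitone μ}} (hν : ν ∈ s) : a ν = 0 := by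
  have hsymm : (∑ σ : Equiv.Perm (Fin N), MvPolynomial.rename σ (monomialX ν.1)).IsSymmetric := by
    intro τ
    rw [map_sum]
    simp only [MvPolynomial.rename_rename]
    exact Equiv.sum_comp (Equiv.mulLeft τ) fun σ : Equiv.Perm (Fin N) =>
      MvPolynomial.rename σ (monomialX ν.1)
  have h₁ := h _ hsymm
  rw [map_sum] at h₁
  have h₂ : ∀ σ : Equiv.Perm (Fin N), coeffFunctional s a (MvPolynomial.rename σ (monomialX ν.1)) =
      (if ν.1 ∘ σ.symm = ν.1 then 1 else 0) * star (a ν) := by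
    intro σ
    rw [rename_monomialX, coeffFunctional_monomialX, Finset.sum_eq_single ν]
    · split_ifs <;> simp
    · intro ρ _ hρ
      rw [if_neg]
      intro heq
      exact hρ (Subtype.ext (eq_of_antitone_comp_perm ν.2 ρ.2 heq.symm))
    · exact fun h => absurd hν h
  rw [Finset.sum_congr rfl fun σ _ => h₂ σ, ← Finset.sum_mul, Finset.sum_boole] at h₁
  refine star_eq_zero.mp ((mul_eq_zero.mp h₁).resolve_left (Nat.cast_ne_zero.mpr ?_))
  refine Finset.card_ne_zero_of_mem (a := (1 : Equiv.Perm (Fin N))) ?_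
  rw [Finset.mem_filter]
  exact ⟨Finset.mem_univ _, rfl⟩

-- Given a relation ∑ a_ν h_ν = 0, the functional c reading off monomial coefficients with weights
-- conj(a_ν) satisfies conj(c(x^ν)) = a_ν. Its forms in all degrees are nonnegative and add up to
-- c(∑ a_ν h_ν) = 0, so each vanishes and c kills the symmetric polynomials.
open scoped ComplexOrder in
theorem linearIndependent_hProd {κ : ℝ} (hκ : 0 < κ) :
    LinearIndependent ℂ fun μ : {μ : Fin N → ℕ // Antitone μ} => hProd κ μ.1 := by
  rw [linearIndependent_iff']
  intro s a ha ν hν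
  set c := coeffFunctional s a with hc
  have hform : ∀ d, kernelForm κ c d =
      ∑ ν ∈ s with ∑ k, ν.1 k = d, a ν * c (hProd κ ν.1) := by
    intro d
    rw [kernelForm, Finset.sum_filter]
    have h₁ : ∀ μ : Fin N → ℕ, c (hProd κ μ) * star (c (monomialX μ)) =
        ∑ ν ∈ s, if μ = ν.1 then a ν * c (hProd κ ν.1) else 0 := by
      intro μ
      rw [hc, coeffFunctional_monomialX, star_sum, Finset.mul_sum]
      refine Finset.sum_congr rfl fun ν _ => ?_
      split_ifs with h
      · rw [star_star, mul_comm, h]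
      · rw [star_zero, mul_zero]
    rw [Finset.sum_congr rfl fun μ _ => h₁ μ, Finset.sum_comm]
    refine Finset.sum_congr rfl fun ν _ => ?_
    rw [Finset.sum_ite_eq']
    simp [Finset.mem_piAntidiag]
  have hzero : ∀ d, kernelForm κ c d = 0 := by
    intro d
    by_cases hd : d ∈ s.image fun ν => ∑ k, ν.1 k
    · have h₁ : ∑ d ∈ s.image (fun ν => ∑ k, ν.1 k), kernelForm κ c d = 0 := by
        rw [Finset.sum_congr rfl fun d _ => hform d,
          Finset.sum_fiberwise_of_maps_to fun ν hν => Finset.mem_image_of_mem _ hν]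
        have h₂ := congrArg c ha
        rw [map_sum, map_zero] at h₂
        rw [← h₂]
        exact Finset.sum_congr rfl fun ν _ => by rw [map_smul, smul_eq_mul]
      exact (Finset.sum_eq_zero_iff_of_nonneg fun d _ => (kernelForm_nonneg hκ d c).1).mp h₁ d hd
    · rw [hform, Finset.filter_eq_empty_iff.mpr, Finset.sum_empty]
      intro ν hν h
      exact hd (Finset.mem_image.mpr ⟨ν, hν, h⟩)
  exact eq_zero_of_coeffFunctional
    (fun q hq => eq_zero_of_kernelForm_eq_zero hκ hzero hq) hν

/-- A functional that vanishes on all h_μ has zero form in every degree, hence kills every symmetric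
polynomial; so none lies outside the span. No dimension count is needed. -/
theorem symmetric_le_span_hProd {κ : ℝ} (hκ : 0 < κ) :
    Subalgebra.toSubmodule (MvPolynomial.symmetricSubalgebra (Fin N) ℂ) ≤
      Submodule.span ℂ (hProd κ '' {μ | Antitone μ}) := by
  intro q hq
  by_contra hcon
  obtain ⟨c, hcq, hc⟩ := Submodule.exists_le_ker_of_notMem hcon
  refine hcq (eq_zero_of_kernelForm_eq_zero hκ (fun d => ?_)
    ((MvPolynomial.mem_symmetricSubalgebra q).mp hq))
  refine Finset.sum_eq_zero fun μ _ => ?_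
  obtain ⟨σ, hσ, -⟩ := exists_perm_antitone μ
  have h : hProd κ μ ∈ LinearMap.ker c := by
    rw [← hProd_comp_perm κ μ σ]
    exact hc (Submodule.subset_span ⟨_, hσ, rfl⟩)
  rw [LinearMap.mem_ker.mp h, zero_mul]

/-! ### Unitriangular families -/

theorem StrictlyBelow.trans {l m n : Fin N → ℤ} (h : StrictlyBelow l m) (h' : StrictlyBelow m n) :
    StrictlyBelow l n := by
  refine ⟨h.1.trans h'.1, fun hln => h.2 ?_⟩
  rw [hln] at h ⊢
  exact h'.1.antisymm h.1 |>.symm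

/-- The sum of all tail sums is a natural number that strictly increases along the order. -/
theorem wellFounded_strictlyBelow_natVec :
    WellFounded fun μ ν : Fin N → ℕ => StrictlyBelow (natVec μ) (natVec ν) := by
  refine Subrelation.wf (r := InvImage (· < ·) fun μ : Fin N → ℕ =>
    (∑ i, tail (natVec μ) i).toNat) ?_ (InvImage.wf _ wellFounded_lt)
  intro μ ν h
  have h₁ : ∑ i, tail (natVec μ) i < ∑ i, tail (natVec ν) i := by
    refine lt_of_le_of_ne (Finset.sum_le_sum fun i _ => h.1 i) fun heq => h.2 ?_
    have h₁ := (Finset.sum_eq_sum_iff_of_le fun i _ => h.1 i).mp heq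
    exact tail_injective (funext fun i => h₁ i (Finset.mem_univ i))
  have h₂ : 0 ≤ ∑ i, tail (natVec μ) i := Finset.sum_nonneg fun i _ => tail_natVec_nonneg μ i
  change Int.toNat _ < Int.toNat _
  omega

section Triangular

variable {K M ι : Type*} [Field K] [AddCommGroup M] [Module K M] {r : ι → ι → Prop} {g p : ι → M}

theorem span_range_eq_of_triangular (hr : WellFounded r)
    (h : ∀ i, p i - g i ∈ Submodule.span K (g '' {j | r j i})) :
    Submodule.span K (Set.range p) = Submodule.span K (Set.range g) := by
  refine le_antisymm (Submodule.span_le.mpr ?_) (Submodule.span_le.mpr ?_)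
  · rintro _ ⟨i, rfl⟩
    have h₁ := Submodule.add_mem _
      (Submodule.span_mono (Set.image_subset_range _ _) (h i))
      (Submodule.subset_span (R := K) (Set.mem_range_self (f := g) i))
    rwa [sub_add_cancel] at h₁
  · rintro _ ⟨i, rfl⟩
    induction i using hr.induction with
    | _ i ih =>
      have h₁ : Submodule.span K (g '' {j | r j i}) ≤ Submodule.span K (Set.range p) := by
        refine Submodule.span_le.mpr ?_
        rintro _ ⟨j, hj, rfl⟩
        exact ih j hj
      have h₂ := Submodule.sub_mem _ (Submodule.subset_span (R := K) (Set.mem_range_self (f := p) i))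
        (h₁ (h i))
      rwa [sub_sub_cancel] at h₂

theorem ne_zero_of_triangular (hg : LinearIndependent K g) (hirr : ∀ i, ¬ r i i) {i : ι}
    (h : p i - g i ∈ Submodule.span K (g '' {j | r j i})) : p i ≠ 0 := by
  intro h₀
  rw [h₀, zero_sub, Submodule.neg_mem_iff] at h
  exact hg.notMem_span_image (s := {j | r j i}) (hirr i) h

theorem linearIndependent_of_triangular (hg : LinearIndependent K g) (hirr : ∀ i, ¬ r i i)
    (htrans : ∀ i j k, r i j → r j k → r i k)
    (h : ∀ i, p i - g i ∈ Submodule.span K (g '' {j | r j i})) : LinearIndependent K p := by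
  classical
  rw [linearIndependent_iff']
  intro s a ha
  by_contra! hcon
  obtain ⟨i₀, hi₀, hai₀⟩ := hcon
  -- A maximal index of the relation: `g i` occurs in no other term, so the relation would place it
  -- in the span of the remaining `g`.
  obtain ⟨i, his, hai, hmax⟩ : ∃ i ∈ s, a i ≠ 0 ∧ ∀ j ∈ s, a j ≠ 0 → ¬ r i j := by
    let t : Type _ := {j // j ∈ s ∧ a j ≠ 0}
    have : Finite t := Set.Finite.subset (Finset.finite_toSet s) fun j hj => hj.1
    have : IsTrans t fun j k => r k.1 j.1 := ⟨fun _ _ _ h₁ h₂ => htrans _ _ _ h₂ h₁⟩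
    have : Std.Irrefl fun j k : t => r k.1 j.1 := ⟨fun j => hirr j.1⟩
    obtain ⟨i, -, hi⟩ := (Finite.wellFounded_of_trans_of_irrefl fun j k : t => r k.1 j.1).has_min
      Set.univ ⟨⟨i₀, hi₀, hai₀⟩, Set.mem_univ _⟩
    exact ⟨i.1, i.2.1, i.2.2, fun j hj haj => hi ⟨j, hj, haj⟩ (Set.mem_univ _)⟩
  have hlow : ∀ j, ¬ r i j → p j - g j ∈ Submodule.span K (g '' {i}ᶜ) := by
    intro j hj
    refine Submodule.span_mono (Set.image_mono ?_) (h j)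
    rintro k hk rfl
    exact hj hk
  have hother : ∀ j ∈ s.erase i, a j • p j ∈ Submodule.span K (g '' {i}ᶜ) := by
    intro j hj
    rw [Finset.mem_erase] at hj
    by_cases haj : a j = 0
    · rw [haj, zero_smul]
      exact Submodule.zero_mem _
    · refine Submodule.smul_mem _ _ ?_
      have h₁ : g j ∈ Submodule.span K (g '' {i}ᶜ) := Submodule.subset_span ⟨j, hj.1, rfl⟩
      rw [← sub_add_cancel (p j) (g j)]
      exact Submodule.add_mem _ (hlow j (hmax j hj.2 haj)) h₁
  rw [← Finset.add_sum_erase _ _ his] at ha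
  have h₂ : a i • p i ∈ Submodule.span K (g '' {i}ᶜ) := by
    rw [eq_neg_of_add_eq_zero_left ha]
    exact Submodule.neg_mem _ (Submodule.sum_mem _ hother)
  have h₃ : p i ∈ Submodule.span K (g '' {i}ᶜ) := (Submodule.smul_mem_iff _ hai).mp h₂
  have h₄ : g i ∈ Submodule.span K (g '' {i}ᶜ) := by
    rw [← sub_sub_cancel (p i) (g i)]
    exact Submodule.sub_mem _ h₃ (hlow i (hirr i))
  exact hg.notMem_span_image (s := {i}ᶜ) (fun h => h rfl) h₄

end Triangular

/-! ### The basis property of the P_λ -/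

/-- Antitone vectors of natural numbers as partitions. -/
def partitionEquiv : {μ : Fin N → ℕ // Antitone μ} ≃ {n : Fin N → ℤ // IsPartition n} :=
  Equiv.ofBijective (fun μ => ⟨natVec μ.1, isPartition_natVec.mpr μ.2⟩)
    ⟨fun _ _ h => Subtype.ext (natVec_injective (congrArg Subtype.val h)), fun n => by
      obtain ⟨μ, hμ, h⟩ := n.2.exists_natVec
      exact ⟨⟨μ, hμ⟩, Subtype.ext h.symm⟩⟩

theorem P_triangular (κ : ℝ) (α β : ℂ[X]) (ν : {μ : Fin N → ℕ // Antitone μ}) :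
    P κ α β (partitionEquiv ν).1 - hProd κ ν.1 ∈
      Submodule.span ℂ ((fun μ : {μ : Fin N → ℕ // Antitone μ} => hProd κ μ.1) ''
        {μ | StrictlyBelow (natVec μ.1) (natVec ν.1)}) := by
  refine Submodule.span_mono ?_ (P_sub_hProd_mem_span κ α β ν.1)
  rintro _ ⟨μ, hμ, rfl⟩
  exact ⟨⟨μ, hμ.1⟩, hμ.2, rfl⟩

theorem P_ne_zero {κ : ℝ} (hκ : 0 < κ) (α β : ℂ[X]) {n : Fin N → ℤ} (hn : IsPartition n) :
    P κ α β n ≠ 0 := by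
  obtain ⟨ν, hν⟩ := partitionEquiv.surjective ⟨n, hn⟩
  have h := ne_zero_of_triangular
    (r := fun μ ν : {μ : Fin N → ℕ // Antitone μ} => StrictlyBelow (natVec μ.1) (natVec ν.1))
    (g := fun μ : {μ : Fin N → ℕ // Antitone μ} => hProd κ μ.1)
    (p := fun ν => P κ α β (partitionEquiv ν).1) (linearIndependent_hProd hκ) (fun μ h => h.2 rfl) (P_triangular κ α β ν)
  beta_reduce at h
  rwa [hν] at h

theorem linearIndependent_P {κ : ℝ} (hκ : 0 < κ) (α β : ℂ[X]) :
    LinearIndependent ℂ fun n : {n : Fin N → ℤ // IsPartition n} => P κ α β n.1 := by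
  rw [← linearIndependent_equiv partitionEquiv]
  exact linearIndependent_of_triangular
    (r := fun μ ν : {μ : Fin N → ℕ // Antitone μ} => StrictlyBelow (natVec μ.1) (natVec ν.1))
    (g := fun μ : {μ : Fin N → ℕ // Antitone μ} => hProd κ μ.1)
    (p := fun ν => P κ α β (partitionEquiv ν).1) (linearIndependent_hProd hκ) (fun μ h => h.2 rfl)
    (fun _ _ _ => StrictlyBelow.trans) (P_triangular κ α β)

theorem span_P {κ : ℝ} (hκ : 0 < κ) {α : ℂ[X]} (β : ℂ[X]) (hα : α.natDegree ≤ 2) :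
    Submodule.span ℂ (Set.range fun n : {n : Fin N → ℤ // IsPartition n} => P κ α β n.1) =
      Subalgebra.toSubmodule (MvPolynomial.symmetricSubalgebra (Fin N) ℂ) := by
  refine le_antisymm (Submodule.span_le.mpr ?_) ((symmetric_le_span_hProd hκ).trans ?_)
  · rintro _ ⟨n, rfl⟩
    exact (MvPolynomial.mem_symmetricSubalgebra _).mpr (P_isSymmetric hα n.1)
  · have h := span_range_eq_of_triangular (K := ℂ)
      (r := fun μ ν : {μ : Fin N → ℕ // Antitone μ} => StrictlyBelow (natVec μ.1) (natVec ν.1))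
      (g := fun μ : {μ : Fin N → ℕ // Antitone μ} => hProd κ μ.1)
      (p := fun ν => P κ α β (partitionEquiv ν).1) (InvImage.wf _ wellFounded_strictlyBelow_natVec)
      (P_triangular κ α β)
    rw [← partitionEquiv.surjective.range_comp]
    refine le_trans (Submodule.span_mono ?_) h.ge
    rintro _ ⟨μ, hμ, rfl⟩
    exact ⟨⟨μ, hμ⟩, rfl⟩

end CalogeroSutherland

end

open CalogeroSutherland in
theorem theorem2 (N : ℕ) (κ : ℝ) (α β : Polynomial ℂ)
    (hα : α.natDegree ≤ 2) (hβ : β.natDegree ≤ 1) :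
    (∀ n : Fin N → ℤ, NonResonant κ α β n →
      WellDefined κ α β n ∧
      (P κ α β n).IsSymmetric ∧
      IsReducedEigenfunction κ α β (P κ α β n) (energy κ α β n) ∧
      (0 < κ → IsPartition n → P κ α β n ≠ 0)) ∧
    (0 < κ → (∀ n : Fin N → ℤ, IsPartition n → NonResonant κ α β n) →
      LinearIndependent ℂ (fun n : {n : Fin N → ℤ // IsPartition n} => P κ α β n.1) ∧
      Submodule.span ℂ (Set.range fun n : {n : Fin N → ℤ // IsPartition n} => P κ α β n.1) =
        Subalgebra.toSubmodule (MvPolynomial.symmetricSubalgebra (Fin N) ℂ)) := by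
  exact ⟨fun n hn => ⟨wellDefined hα hn, P_isSymmetric hα n,
    isReducedEigenfunction hα hβ (reducedOp_P hα hβ hn), fun hκ => P_ne_zero hκ α β⟩,
    fun hκ _ => ⟨linearIndependent_P hκ α β, span_P hκ β hα⟩⟩
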